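/- Let $N\ge 1$, all functions real-valued. Let $X$ be the completion of $C_0^\infty(\mathbb R^N)$ under $\left(\int_{\mathbb R^N}|\Delta u|^2dx+\int_{\mathbb R^N}|x|^2|\nabla u|^2dx\right)^{1/2}$, regarded as a space of functions in $L^2(\mathbb R^N)$ with distributional derivatives $\nabla u,\Delta u$; let $E_{SHUP}=\{\alpha e^{-\beta|x|^2}:\alpha\in\mathbb R,\ \beta>0\}$ and $$\delta_1(u)=\left(\int_{\mathbb R^N}|\Delta u|^2dx\right)^{1/2}\left(\int_{\mathbb R^N}|x|^2|\nabla u|^2dx\right)^{1/2}-\frac{N+2}{2}\int_{\mathbb R^N}|\nabla u|^2dx .$$ For $k\ge 1$ put $$C(N,k)=\inf_{u}\frac{\int_{\mathbb R^{N+2k}}|\Delta u|^2dx+\int_{\mathbb R^{N+2k}}\left(|\nabla u|^2|x|^2-2k|u|^2\right)dx}{\int_{\mathbb R^{N+2k}}|\nabla u|^2dx}-(N+2),$$ the infimum being over all nonzero radial $u\in C_0^\infty(\mathbb R^{N+2k})$, and $C(N)=\inf_{k\ge1}C(N,k)$. **Theorem.** (i) For every $N\ge1$ and every $u\in X$, $$\delta_1(u)\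 \ge\ \frac{C(N)}{4}\,\inf\left\{\|\nabla(u-u^*)\|_2^2:\ u^*\in E_{SHUP},\ \|\nabla u^*\|_2^2=\|\nabla u\|_2^2\right\}.$$ (ii) For every $N\ge2$, $\frac{C(N)}{4}>\frac1{768}$. (iii) $\liminf_{N\to\infty}\frac{C(N)}{4}\ge\frac12$. Consequently, if $c^*(N)$ denotes the sharp (largest) constant that can replace $\frac{C(N)}4$ in the inequality of (i) for all $u\in X$, then $\liminf_{N\to\infty}c^*(N)\ge\frac12$. -/

import Mathlib

open Set Filter Topology MeasureTheory
open scoped Gradient Laplacian ContDiff ENNReal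

noncomputable section

namespace SecondOrderHUP

/-- The class `C₀^∞(ℝⁿ)` of real-valued smooth compactly supported functions. -/
def IsTest {n : ℕ} (φ : EuclideanSpace ℝ (Fin n) → ℝ) : Prop :=
  ContDiff ℝ ∞ φ ∧ HasCompactSupport φ

/-- `G` is the distributional gradient of `u`: both are locally integrable and
`∫ u ∇φ = - ∫ φ G` (an identity in `ℝⁿ`) for all test functions `φ`. -/
def IsWeakGradient {n : ℕ} (u : EuclideanSpace ℝ (Fin n) → ℝ)
    (G : EuclideanSpace ℝ (Fin n) → EuclideanSpace ℝ (Fin n)) : Prop :=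
  LocallyIntegrable u ∧ LocallyIntegrable G ∧
    ∀ φ : EuclideanSpace ℝ (Fin n) → ℝ, IsTest φ →
      ∫ x, u x • (∇ φ) x = - ∫ x, φ x • G x

/-- `L` is the distributional Laplacian of `u`. -/
def IsWeakLaplacian {n : ℕ} (u L : EuclideanSpace ℝ (Fin n) → ℝ) : Prop :=
  LocallyIntegrable u ∧ LocallyIntegrable L ∧
    ∀ φ : EuclideanSpace ℝ (Fin n) → ℝ, IsTest φ →
      ∫ x, u x * (Δ φ) x = ∫ x, φ x * L x

/-- Distributional gradients are unique almost everywhere. -/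
theorem IsWeakGradient.ae_eq {n : ℕ} {u : EuclideanSpace ℝ (Fin n) → ℝ}
    {G G' : EuclideanSpace ℝ (Fin n) → EuclideanSpace ℝ (Fin n)}
    (h : IsWeakGradient u G) (h' : IsWeakGradient u G') : G =ᵐ[volume] G' :=
  ae_eq_of_integral_contDiff_smul_eq h.2.1 h'.2.1 fun φ h1 h2 =>
    neg_injective ((h.2.2 φ ⟨h1, h2⟩).symm.trans (h'.2.2 φ ⟨h1, h2⟩))

/-- Distributional Laplacians are unique almost everywhere. -/
theorem IsWeakLaplacian.ae_eq {n : ℕ} {u L L' : EuclideanSpace ℝ (Fin n) → ℝ}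
    (h : IsWeakLaplacian u L) (h' : IsWeakLaplacian u L') : L =ᵐ[volume] L' :=
  ae_eq_of_integral_contDiff_smul_eq h.2.1 h'.2.1 fun φ h1 h2 =>
    (h.2.2 φ ⟨h1, h2⟩).symm.trans (h'.2.2 φ ⟨h1, h2⟩)

open Classical in
/-- The distributional gradient `∇u` (determined up to a null set; `0` if there is none). -/
def weakGradient {n : ℕ} (u : EuclideanSpace ℝ (Fin n) → ℝ) :
    EuclideanSpace ℝ (Fin n) → EuclideanSpace ℝ (Fin n) :=
  if h : ∃ G, IsWeakGradient u G then h.choose else 0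

open Classical in
/-- The distributional Laplacian `Δu` (determined up to a null set; `0` if there is none). -/
def weakLaplacian {n : ℕ} (u : EuclideanSpace ℝ (Fin n) → ℝ) :
    EuclideanSpace ℝ (Fin n) → ℝ :=
  if h : ∃ L, IsWeakLaplacian u L then h.choose else 0

/-- The completion `X` of `C₀^∞(ℝᴺ)` under `(∫ |Δu|² + ∫ |x|² |∇u|²)^{1/2}`, realized as a
space of functions. Since `∫ |φ|² ≤ (2/N)² ∫ |x|² |∇φ|²` for test functions, sequences that are
Cauchy for this seminorm converge in `L²(ℝᴺ)`; so the elements of the completion are the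
functions in `L²(ℝᴺ)` with a distributional gradient and Laplacian that are limits of test
functions in the seminorm. -/
structure MemX {N : ℕ} (u : EuclideanSpace ℝ (Fin N) → ℝ) : Prop where
  memLp : MemLp u 2 volume
  hasGradient : ∃ G, IsWeakGradient u G
  hasLaplacian : ∃ L, IsWeakLaplacian u L
  approx : ∃ φ : ℕ → EuclideanSpace ℝ (Fin N) → ℝ, (∀ j, IsTest (φ j)) ∧
    Tendsto (fun j =>
      (∫⁻ x, ‖(Δ (φ j)) x - weakLaplacian u x‖ₑ ^ 2) +
        ∫⁻ x, ‖x‖ₑ ^ 2 * ‖(∇ (φ j)) x - weakGradient u x‖ₑ ^ 2) atTop (𝓝 0)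

/-- `‖∇u‖₂²`. -/
def gradNormSq {N : ℕ} (u : EuclideanSpace ℝ (Fin N) → ℝ) : ℝ :=
  ∫ x, ‖weakGradient u x‖ ^ 2

/-- The deficit `δ₁` of the second order Heisenberg uncertainty principle. -/
def deficit {N : ℕ} (u : EuclideanSpace ℝ (Fin N) → ℝ) : ℝ :=
  √(∫ x, weakLaplacian u x ^ 2) * √(∫ x, ‖x‖ ^ 2 * ‖weakGradient u x‖ ^ 2)
    - ((N : ℝ) + 2) / 2 * gradNormSq u

/-- The set `E_SHUP` of Gaussians `α e^{-β|x|²}`, `α ∈ ℝ`, `β > 0`. -/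
def gaussians (N : ℕ) : Set (EuclideanSpace ℝ (Fin N) → ℝ) :=
  {w | ∃ α β : ℝ, 0 < β ∧ w = fun x => α * Real.exp (-β * ‖x‖ ^ 2)}

/-- `inf {‖∇(u - u*)‖₂² : u* ∈ E_SHUP, ‖∇u‖₂² = ‖∇u*‖₂²}`. -/
def normalizedDistSq {N : ℕ} (u : EuclideanSpace ℝ (Fin N) → ℝ) : ℝ :=
  sInf {d : ℝ | ∃ w ∈ gaussians N, gradNormSq u = gradNormSq w ∧
    d = gradNormSq (fun x => u x - w x)}

/-- The quotient whose infimum defines `C(N, k)`, for a function on `ℝ^{N+2k}`. -/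
def radialQuotient (N k : ℕ) (v : EuclideanSpace ℝ (Fin (N + 2 * k)) → ℝ) : ℝ :=
  ((∫ x, (Δ v) x ^ 2) + ∫ x, (‖(∇ v) x‖ ^ 2 * ‖x‖ ^ 2 - 2 * (k : ℝ) * v x ^ 2)) /
    ∫ x, ‖(∇ v) x‖ ^ 2

/-- `C(N, k)`: the infimum is over the nonzero radial functions in `C₀^∞(ℝ^{N+2k})`. -/
def stabilityConstAt (N k : ℕ) : ℝ :=
  sInf {q : ℝ | ∃ v : EuclideanSpace ℝ (Fin (N + 2 * k)) → ℝ,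
    IsTest v ∧ (∀ x y, ‖x‖ = ‖y‖ → v x = v y) ∧ v ≠ 0 ∧ q = radialQuotient N k v}
    - ((N : ℝ) + 2)

/-- `C(N) = inf_{k ≥ 1} C(N, k)`. -/
def stabilityConst (N : ℕ) : ℝ := ⨅ k : ℕ+, stabilityConstAt N k

/-- The sharp constant of the stability inequality with normalized distance: the supremum (in
the extended reals) of the `c` with `δ₁(u) ≥ c · inf {…}` for all `u ∈ X`. -/
def sharpConst (N : ℕ) : EReal :=
  ⨆ c ∈ {c : ℝ | ∀ u : EuclideanSpace ℝ (Fin N) → ℝ, MemX u →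
    c * normalizedDistSq u ≤ deficit u}, (c : EReal)

end SecondOrderHUP

end

open Set Filter Topology MeasureTheory
open scoped Gradient Laplacian ContDiff ENNReal

noncomputable section

namespace SecondOrderHUP

/-! The constant is explicit: C(N) = √(N² + 4N − 4) − N for N ≥ 1, called `gap N` below. Everything
rests on expanding ∫ (Δu + x·∇u + b u)² for test functions. By Green and Pohozaev this equals ∫
|Δu|² + ∫ (x·∇u)² + (b² − bn) ∫ u² + (n − 2 − 2b) ∫ |∇u|² (`IsTest.integral_sq_add_euler`).

Value of C(N). On radial functions of ℝ^{N+2k}, (x·∇v)² = |x|²|∇v|². Choosing b with b² − (N+2k) b =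
−2k makes the numerator of the quotient a square plus (2b − (N+2k) + 2) ∫ |∇v|². The larger root
gives C(N,k) ≥ √((N+2k)² − 8k) − N, whose right side is smallest at k = 1. For k = 1 the bound is
attained in the limit: Δv + x·∇v + b v = 0 has a smooth radial solution, the Laplace transform of a
beta distribution in |x|² (a Kummer function). It is square integrable because b is the larger root,
and its truncations are minimizing. The lower bound C(N) ≥ gap N gives (ii) and (iii), since gap N ≥
2 − 4/(N+1). The upper bound C(N) ≤ gap N is what (i) needs, because (i) is proved with gap N.

Stability at scale one. For a test function u, let m(r) be its mean over the sphere of radius r. The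
claim is that ∫ |Δu|² + ∫ |x|²|∇u|² − (N+2) ∫ |∇u|² is at least gap N times the squared L² distance
from ∇u to the line spanned by x e^{−|x|²/2} (`IsTest.gap_mul_le`). Two estimates are combined. (a)
Expand the square with b = N + gap N / 2 and bound the spherical mean of the square from below by
the square of the mean. The Poincaré inequality on spheres, with constant N − 1, pays for the part
of u with zero spherical mean. The equation κ² + Nκ = N − 1 for κ = gap N / 2 makes all zero-order
terms cancel (`IsTest.stability_sphereMean`). (b) What is left for the radial part is ∫ (Δm + x·∇m +
N m)², which controls 4 ∫ |∇m − t x e^{−|x|²/2}|² for a suitable t. This is a one-dimensional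
inequality proved by an exact completion of squares (`integral_sq_sub_nonneg`). As gap N ≤ 2 ≤ 4,
this is enough.

The spherical Poincaré inequality is obtained from the Gaussian one on ℝⁿ, applied to approximations
of the 1-homogeneous function |x| U(x/|x|). The Gaussian inequality follows by tensorization from
the line.

Conclusion. Dilation gives the estimate at every scale s, and density carries it to X. Requiring the
competitor to have the same gradient norm as u costs a factor 2 in the squared distance
(`normalizedDistSq_le`). Minimizing s² ∫ |Δu|² + s^{−2} ∫ |x|²|∇u|² over s produces twice the
product in the deficit. The two factors 2 account for the 4 in C(N)/4. -/

variable {n : ℕ}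

/-! ### Test functions and integration by parts -/

/-- The Euler derivative `x · ∇u`. -/
def euler (u : EuclideanSpace ℝ (Fin n) → ℝ) (x : EuclideanSpace ℝ (Fin n)) : ℝ :=
  fderiv ℝ u x x

theorem inner_gradient_left (u : EuclideanSpace ℝ (Fin n) → ℝ) (x v : EuclideanSpace ℝ (Fin n)) :
    inner ℝ ((∇ u) x) v = fderiv ℝ u x v := by
  rw [gradient, InnerProductSpace.toDual_symm_apply]

theorem norm_gradient (u : EuclideanSpace ℝ (Fin n) → ℝ) (x : EuclideanSpace ℝ (Fin n)) :
    ‖(∇ u) x‖ = ‖fderiv ℝ u x‖ := by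
  rw [gradient, LinearIsometryEquiv.norm_map]

theorem inner_gradient_eq_sum (u v : EuclideanSpace ℝ (Fin n) → ℝ) (x : EuclideanSpace ℝ (Fin n)) :
    inner ℝ ((∇ u) x) ((∇ v) x) =
      ∑ i, fderiv ℝ u x (EuclideanSpace.basisFun (Fin n) ℝ i) *
        fderiv ℝ v x (EuclideanSpace.basisFun (Fin n) ℝ i) := by
  rw [← OrthonormalBasis.sum_inner_mul_inner (EuclideanSpace.basisFun (Fin n) ℝ)]
  refine Finset.sum_congr rfl fun i _ => ?_
  rw [inner_gradient_left, real_inner_comm, inner_gradient_left]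

theorem laplacian_eq_sum {u : EuclideanSpace ℝ (Fin n) → ℝ} (hu : ContDiff ℝ 2 u)
    (x : EuclideanSpace ℝ (Fin n)) :
    (Δ u) x = ∑ i, fderiv ℝ (fun y => fderiv ℝ u y (EuclideanSpace.basisFun (Fin n) ℝ i)) x
        (EuclideanSpace.basisFun (Fin n) ℝ i) := by
  rw [InnerProductSpace.laplacian_eq_iteratedFDeriv_orthonormalBasis u
    (EuclideanSpace.basisFun (Fin n) ℝ)]
  refine Finset.sum_congr rfl fun i _ => ?_
  rw [iteratedFDeriv_two_apply]
  have h : DifferentiableAt ℝ (fderiv ℝ u) x :=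
    ((hu.fderiv_right (m := 1) (by norm_num)).differentiable (by norm_num)) x
  rw [fderiv_clm_apply h (differentiableAt_const _)]
  simp

protected theorem IsTest.contDiff {u : EuclideanSpace ℝ (Fin n) → ℝ} (hu : IsTest u) {m : ℕ} :
    ContDiff ℝ m u := hu.1.of_le (by exact_mod_cast le_top)

protected theorem IsTest.differentiable {u : EuclideanSpace ℝ (Fin n) → ℝ} (hu : IsTest u) :
    Differentiable ℝ u := hu.1.differentiable (by simp)

protected theorem IsTest.continuous {u : EuclideanSpace ℝ (Fin n) → ℝ} (hu : IsTest u) :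
    Continuous u := hu.1.continuous

protected theorem IsTest.integrable {u : EuclideanSpace ℝ (Fin n) → ℝ} (hu : IsTest u) :
    Integrable u := hu.continuous.integrable_of_hasCompactSupport hu.2

protected theorem IsTest.fderiv_apply {u : EuclideanSpace ℝ (Fin n) → ℝ} (hu : IsTest u)
    (v : EuclideanSpace ℝ (Fin n)) : IsTest fun x => fderiv ℝ u x v :=
  ⟨(hu.1.fderiv_right (m := ∞) (by simp)).clm_apply contDiff_const, hu.2.fderiv_apply ℝ v⟩

protected theorem IsTest.euler {u : EuclideanSpace ℝ (Fin n) → ℝ} (hu : IsTest u) : IsTest (euler u) := by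
  refine ⟨(hu.1.fderiv_right (m := ∞) (by simp)).clm_apply contDiff_id, ?_⟩
  refine (hu.2.fderiv ℝ).mono fun x hx => ?_
  contrapose! hx
  simp only [Function.mem_support, not_not] at hx
  simp [euler, hx]

protected theorem IsTest.add {u v : EuclideanSpace ℝ (Fin n) → ℝ} (hu : IsTest u) (hv : IsTest v) :
    IsTest fun x => u x + v x := ⟨hu.1.add hv.1, hu.2.add hv.2⟩

protected theorem IsTest.const_mul {u : EuclideanSpace ℝ (Fin n) → ℝ} (hu : IsTest u) (c : ℝ) :
    IsTest fun x => c * u x :=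
  ⟨contDiff_const.mul hu.1, hu.2.mul_left⟩

protected theorem IsTest.mul {u v : EuclideanSpace ℝ (Fin n) → ℝ} (hu : IsTest u) (hv : ContDiff ℝ ∞ v) :
    IsTest fun x => u x * v x :=
  ⟨hu.1.mul hv, hu.2.mul_right⟩

protected theorem IsTest.sub {u v : EuclideanSpace ℝ (Fin n) → ℝ} (hu : IsTest u) (hv : IsTest v) :
    IsTest fun x => u x - v x := by
  simpa [sub_eq_add_neg] using hu.add (hv.const_mul (-1))

theorem isTest_zero : IsTest (fun _ : EuclideanSpace ℝ (Fin n) => (0 : ℝ)) :=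
  ⟨contDiff_const, HasCompactSupport.zero⟩

protected theorem IsTest.sum {ι : Type*} (s : Finset ι) {u : ι → EuclideanSpace ℝ (Fin n) → ℝ}
    (hu : ∀ i, IsTest (u i)) : IsTest fun x => ∑ i ∈ s, u i x := by
  classical
  induction s using Finset.induction_on with
  | empty => simpa using isTest_zero
  | insert a s ha ih => simpa [Finset.sum_insert ha] using (hu a).add ih

protected theorem IsTest.laplacian {u : EuclideanSpace ℝ (Fin n) → ℝ} (hu : IsTest u) : IsTest (Δ u) := by
  have : Δ u = fun x => ∑ i, fderiv ℝ (fun y => fderiv ℝ u y (EuclideanSpace.basisFun (Fin n) ℝ i))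
      x (EuclideanSpace.basisFun (Fin n) ℝ i) := funext fun x => laplacian_eq_sum hu.contDiff x
  rw [this]
  exact IsTest.sum _ fun i => (hu.fderiv_apply _).fderiv_apply _

theorem continuous_gradient {u : EuclideanSpace ℝ (Fin n) → ℝ} (hu : ContDiff ℝ 1 u) :
    Continuous (∇ u) :=
  (InnerProductSpace.toDual ℝ _).symm.continuous.comp (hu.continuous_fderiv (by norm_num))

theorem IsTest.hasCompactSupport_gradient {u : EuclideanSpace ℝ (Fin n) → ℝ} (hu : IsTest u) :
    HasCompactSupport (∇ u) :=
  (hu.2.fderiv ℝ).comp_left (g := (InnerProductSpace.toDual ℝ _).symm) (map_zero _)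

protected theorem IsTest.inner_gradient {u v : EuclideanSpace ℝ (Fin n) → ℝ} (hu : IsTest u)
    (hv : IsTest v) : IsTest fun x => inner ℝ ((∇ u) x) ((∇ v) x) := by
  simp_rw [inner_gradient_eq_sum]
  exact IsTest.sum _ fun i => (hu.fderiv_apply _).mul (hv.fderiv_apply _).1

protected theorem IsTest.norm_gradient_sq {u : EuclideanSpace ℝ (Fin n) → ℝ} (hu : IsTest u) :
    IsTest fun x => ‖(∇ u) x‖ ^ 2 := by
  simp_rw [← real_inner_self_eq_norm_sq]
  exact hu.inner_gradient hu

/-- Integration by parts against a smooth function. -/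
theorem IsTest.integral_mul_fderiv {f g : EuclideanSpace ℝ (Fin n) → ℝ} (hf : IsTest f)
    (hg : ContDiff ℝ 1 g) (v : EuclideanSpace ℝ (Fin n)) :
    ∫ x, f x * fderiv ℝ g x v = - ∫ x, fderiv ℝ f x v * g x := by
  have hg' : Continuous fun x => fderiv ℝ g x v :=
    (hg.continuous_fderiv (by norm_num)).clm_apply continuous_const
  refine integral_mul_fderiv_eq_neg_fderiv_mul_of_integrable ?_ ?_ ?_ ?_ ?_
  · exact ((hf.fderiv_apply v).continuous.mul hg.continuous).integrable_of_hasCompactSupport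
      (hf.fderiv_apply v).2.mul_right
  · exact (hf.continuous.mul hg').integrable_of_hasCompactSupport hf.2.mul_right
  · exact (hf.continuous.mul hg.continuous).integrable_of_hasCompactSupport hf.2.mul_right
  · exact fun x _ => hf.differentiable x
  · exact fun x _ => hg.differentiable (by norm_num) x

/-- Green's first identity. -/
theorem IsTest.integral_laplacian_mul {u g : EuclideanSpace ℝ (Fin n) → ℝ} (hu : IsTest u)
    (hg : ContDiff ℝ 1 g) :
    ∫ x, (Δ u) x * g x = - ∫ x, inner ℝ ((∇ u) x) ((∇ g) x) := by
  have hg' (v : EuclideanSpace ℝ (Fin n)) : Continuous fun x => fderiv ℝ g x v :=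
    (hg.continuous_fderiv (by norm_num)).clm_apply continuous_const
  simp_rw [inner_gradient_eq_sum, laplacian_eq_sum hu.contDiff, Finset.sum_mul]
  rw [integral_finsetSum, integral_finsetSum, ← Finset.sum_neg_distrib]
  · refine Finset.sum_congr rfl fun i _ => ?_
    rw [(hu.fderiv_apply _).integral_mul_fderiv hg, neg_neg]
  · intro i _
    exact ((hu.fderiv_apply _).continuous.mul (hg' _)).integrable_of_hasCompactSupport
      (hu.fderiv_apply _).2.mul_right
  · intro i _
    exact (((hu.fderiv_apply _).fderiv_apply _).continuous.mul
      hg.continuous).integrable_of_hasCompactSupport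
      ((hu.fderiv_apply _).fderiv_apply _).2.mul_right

theorem euler_eq_sum (u : EuclideanSpace ℝ (Fin n) → ℝ) (x : EuclideanSpace ℝ (Fin n)) :
    euler u x = ∑ i, x i * fderiv ℝ u x (EuclideanSpace.basisFun (Fin n) ℝ i) := by
  have h := congrArg (fderiv ℝ u x) ((EuclideanSpace.basisFun (Fin n) ℝ).sum_repr x)
  rw [map_sum] at h
  simpa [euler] using h.symm

/-- Integration by parts for the Euler derivative. -/
theorem IsTest.integral_euler {u : EuclideanSpace ℝ (Fin n) → ℝ} (hu : IsTest u) :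
    ∫ x, euler u x = - (n : ℝ) * ∫ x, u x := by
  have hx (i : Fin n) : ContDiff ℝ 1 fun x : EuclideanSpace ℝ (Fin n) => x i := by fun_prop
  have hd (i : Fin n) (x : EuclideanSpace ℝ (Fin n)) :
      fderiv ℝ (fun x : EuclideanSpace ℝ (Fin n) => x i) x
        (EuclideanSpace.basisFun (Fin n) ℝ i) = 1 := by
    have : (fun x : EuclideanSpace ℝ (Fin n) => x i) = EuclideanSpace.proj (𝕜 := ℝ) i := rfl
    rw [this, ContinuousLinearMap.fderiv]
    simp
  simp_rw [euler_eq_sum]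
  rw [integral_finsetSum]
  · have (i : Fin n) : ∫ x : EuclideanSpace ℝ (Fin n),
        x i * fderiv ℝ u x (EuclideanSpace.basisFun (Fin n) ℝ i) = - ∫ x, u x := by
      have h := hu.integral_mul_fderiv (hx i) (EuclideanSpace.basisFun (Fin n) ℝ i)
      simp_rw [hd, mul_one] at h
      rw [h, neg_neg]
      simp_rw [mul_comm]
    rw [Finset.sum_congr rfl fun i _ => this i]
    simp
  · intro i _
    exact ((hx i).continuous.mul (hu.fderiv_apply _).continuous).integrable_of_hasCompactSupport
      (hu.fderiv_apply _).2.mul_left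

theorem euler_mul {u v : EuclideanSpace ℝ (Fin n) → ℝ} {x : EuclideanSpace ℝ (Fin n)}
    (hu : DifferentiableAt ℝ u x) (hv : DifferentiableAt ℝ v x) :
    euler (fun y => u y * v y) x = u x * euler v x + euler u x * v x := by
  simp only [euler, fderiv_fun_mul hu hv]
  simp [mul_comm]

theorem IsTest.integral_mul_euler {u v : EuclideanSpace ℝ (Fin n) → ℝ} (hu : IsTest u)
    (hv : IsTest v) :
    ∫ x, u x * euler v x = - (n : ℝ) * (∫ x, u x * v x) - ∫ x, euler u x * v x := by
  have h := (hu.mul hv.1).integral_euler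
  simp_rw [euler_mul (hu.differentiable _) (hv.differentiable _)] at h
  rw [integral_add (hu.mul hv.euler.1).integrable (hu.euler.mul hv.1).integrable] at h
  linarith

theorem IsTest.integral_mul_euler_self {u : EuclideanSpace ℝ (Fin n) → ℝ} (hu : IsTest u) :
    ∫ x, u x * euler u x = - ((n : ℝ) / 2) * ∫ x, u x ^ 2 := by
  have h := hu.integral_mul_euler hu
  simp_rw [mul_comm (euler u _), ← pow_two] at h
  linarith

protected theorem IsTest.fderiv_euler {u : EuclideanSpace ℝ (Fin n) → ℝ} (hu : IsTest u)
    (x v : EuclideanSpace ℝ (Fin n)) :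
    fderiv ℝ (euler u) x v =
      euler (fun y => fderiv ℝ u y v) x + fderiv ℝ u x v := by
  have h2 : ContDiff ℝ 2 u := hu.contDiff
  have h : DifferentiableAt ℝ (fderiv ℝ u) x :=
    ((h2.fderiv_right (m := 1) (by norm_num)).differentiable (by norm_num)) x
  have hs := (h2.contDiffAt (x := x)).isSymmSndFDerivAt (by simp)
  have e : euler u = fun y => fderiv ℝ u y y := rfl
  rw [e, euler]
  rw [fderiv_clm_apply h differentiableAt_fun_id, fderiv_clm_apply h (differentiableAt_const _)]
  simp [hs.eq v x, add_comm]

/-- The Pohozaev identity. -/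
theorem IsTest.integral_laplacian_mul_euler {u : EuclideanSpace ℝ (Fin n) → ℝ} (hu : IsTest u) :
    ∫ x, (Δ u) x * euler u x = ((n : ℝ) - 2) / 2 * ∫ x, ‖(∇ u) x‖ ^ 2 := by
  rw [hu.integral_laplacian_mul (hu.euler.contDiff (m := 1))]
  have hD : ∫ x, ‖(∇ u) x‖ ^ 2 = ∑ i, ∫ x,
      fderiv ℝ u x (EuclideanSpace.basisFun (Fin n) ℝ i) ^ 2 := by
    simp_rw [← real_inner_self_eq_norm_sq, inner_gradient_eq_sum, ← pow_two]
    rw [integral_finsetSum]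
    intro i _
    simpa [pow_two] using ((hu.fderiv_apply (EuclideanSpace.basisFun (Fin n) ℝ i)).mul
      (hu.fderiv_apply (EuclideanSpace.basisFun (Fin n) ℝ i)).1).integrable
  simp_rw [inner_gradient_eq_sum, hu.fderiv_euler]
  rw [hD, integral_finsetSum]
  · rw [← Finset.sum_neg_distrib, Finset.mul_sum]
    refine Finset.sum_congr rfl fun i _ => ?_
    have hi := hu.fderiv_apply (EuclideanSpace.basisFun (Fin n) ℝ i)
    simp_rw [mul_add, ← pow_two]
    rw [integral_add (hi.mul hi.euler.1).integrable
      (by simpa [pow_two] using (hi.mul hi.1).integrable), hi.integral_mul_euler_self]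
    ring
  · intro i _
    have hi := hu.fderiv_apply (EuclideanSpace.basisFun (Fin n) ℝ i)
    exact (hi.mul (hi.euler.add hi).1).integrable

/-- Expansion of the square of `Δu + x·∇u + b u`. -/
theorem IsTest.integral_sq_add_euler {u : EuclideanSpace ℝ (Fin n) → ℝ} (hu : IsTest u) (b : ℝ) :
    ∫ x, ((Δ u) x + euler u x + b * u x) ^ 2 =
      (∫ x, (Δ u) x ^ 2) + (∫ x, euler u x ^ 2) + (b ^ 2 - b * n) * (∫ x, u x ^ 2)
        + (n - 2 - 2 * b) * ∫ x, ‖(∇ u) x‖ ^ 2 := by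
  have h1 : ∫ x, (Δ u) x * u x = - ∫ x, ‖(∇ u) x‖ ^ 2 := by
    rw [hu.integral_laplacian_mul (hu.contDiff (m := 1))]
    simp_rw [real_inner_self_eq_norm_sq]
  have h2 := hu.integral_mul_euler_self
  have h3 := hu.integral_laplacian_mul_euler
  -- The three cross terms are given by Green's identity, the Pohozaev identity and integration by
  -- parts for x·∇.
  have e : ∀ x, ((Δ u) x + euler u x + b * u x) ^ 2 =
      (Δ u) x * (Δ u) x + euler u x * euler u x + b ^ 2 * (u x * u x) +
        2 * ((Δ u) x * euler u x) + 2 * b * ((Δ u) x * u x) + 2 * b * (u x * euler u x) :=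
    fun x => by ring
  have i1 := (hu.laplacian.mul hu.laplacian.1).integrable
  have i2 := (hu.euler.mul hu.euler.1).integrable
  have i3 := (hu.mul hu.1).integrable.const_mul (b ^ 2)
  have i4 := (hu.laplacian.mul hu.euler.1).integrable.const_mul 2
  have i5 := (hu.laplacian.mul hu.1).integrable.const_mul (2 * b)
  have i6 := (hu.mul hu.euler.1).integrable.const_mul (2 * b)
  simp_rw [e]
  rw [integral_add, integral_add, integral_add, integral_add, integral_add]
  · simp_rw [integral_const_mul, h1, h2, h3, ← pow_two]
    ring
  all_goals first | assumption | skip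
  · exact i1.add i2
  · exact (i1.add i2).add i3
  · exact ((i1.add i2).add i3).add i4
  · exact (((i1.add i2).add i3).add i4).add i5

/-! ### Radial test functions and the completed square -/

/-- The derivative of a radial function vanishes in tangential directions. -/
theorem fderiv_eq_zero_of_radial {v : EuclideanSpace ℝ (Fin n) → ℝ} (hv : Differentiable ℝ v)
    (hr : ∀ x y, ‖x‖ = ‖y‖ → v x = v y) {x w : EuclideanSpace ℝ (Fin n)} (hx : x ≠ 0)
    (hxw : inner ℝ x w = 0) : fderiv ℝ v x w = 0 := by
  have hxn : ‖x‖ ≠ 0 := norm_ne_zero_iff.2 hx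
  set a : ℝ := ‖w‖ ^ 2 / ‖x‖ ^ 2 with ha
  have ha0 : 0 ≤ a := by positivity
  -- As w ⊥ x, both points have the same norm by Pythagoras, and the factor √(1 + t²a) is stationary
  -- at t = 0.
  have e : (fun t : ℝ => v (x + t • w)) = fun t : ℝ => v (√(1 + t ^ 2 * a) • x) := by
    funext t
    apply hr
    rw [← sq_eq_sq₀ (norm_nonneg _) (norm_nonneg _), norm_smul, mul_pow, Real.norm_eq_abs, sq_abs,
      Real.sq_sqrt (by positivity), norm_add_sq_real, inner_smul_right, hxw, norm_smul, mul_pow,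
      Real.norm_eq_abs, sq_abs, ha]
    field_simp
    ring
  have h1 : HasDerivAt (fun t : ℝ => v (x + t • w)) (fderiv ℝ v x w) 0 := by
    have hl : HasDerivAt (fun t : ℝ => x + t • w) w 0 := by
      simpa using ((hasDerivAt_id (0 : ℝ)).smul_const w).const_add x
    have hf : HasFDerivAt v (fderiv ℝ v x) (x + (0 : ℝ) • w) := by
      simpa using (hv x).hasFDerivAt
    exact hf.comp_hasDerivAt 0 hl
  have h2 : HasDerivAt (fun t : ℝ => v (√(1 + t ^ 2 * a) • x)) 0 0 := by
    have hs : HasDerivAt (fun t : ℝ => √(1 + t ^ 2 * a)) 0 0 := by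
      have : HasDerivAt (fun t : ℝ => 1 + t ^ 2 * a) 0 0 := by
        simpa using (((hasDerivAt_id (0 : ℝ)).pow 2).mul_const a).const_add 1
      simpa using this.sqrt (by norm_num)
    have hl : HasDerivAt (fun t : ℝ => √(1 + t ^ 2 * a) • x) ((0 : ℝ) • x) 0 := hs.smul_const x
    have hf : HasFDerivAt v (fderiv ℝ v x) (√(1 + (0 : ℝ) ^ 2 * a) • x) := by
      simpa using (hv x).hasFDerivAt
    have := hf.comp_hasDerivAt 0 hl
    rw [zero_smul, map_zero] at this
    exact this
  rw [e] at h1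
  exact h1.unique h2

/-- The component of ∇v orthogonal to x is itself a tangential direction, so the derivative of v
along it, which is its squared norm, vanishes. This identifies the weighted gradient term with the
Euler term of the expanded square. -/
theorem euler_sq_of_radial {v : EuclideanSpace ℝ (Fin n) → ℝ} (hv : Differentiable ℝ v)
    (hr : ∀ x y, ‖x‖ = ‖y‖ → v x = v y) (x : EuclideanSpace ℝ (Fin n)) :
    euler v x ^ 2 = ‖(∇ v) x‖ ^ 2 * ‖x‖ ^ 2 := by
  by_cases hx : x = 0
  · simp [hx, euler]
  have hxn : ‖x‖ ≠ 0 := norm_ne_zero_iff.2 hx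
  have h := fderiv_eq_zero_of_radial hv hr (x := x)
    (w := (∇ v) x - (inner ℝ ((∇ v) x) x / ‖x‖ ^ 2) • x) hx (by
      rw [inner_sub_right, inner_smul_right, real_inner_self_eq_norm_sq, real_inner_comm]
      field_simp
      ring)
  rw [← inner_gradient_left, inner_sub_right, inner_smul_right, real_inner_self_eq_norm_sq] at h
  rw [euler, ← inner_gradient_left]
  field_simp at h
  linarith

theorem abs_euler_le (u : EuclideanSpace ℝ (Fin n) → ℝ) (x : EuclideanSpace ℝ (Fin n)) :
    |euler u x| ≤ ‖(∇ u) x‖ * ‖x‖ := by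
  rw [euler, ← inner_gradient_left]
  exact abs_real_inner_le_norm _ _

theorem eq_zero_of_integral_eq_zero {f : EuclideanSpace ℝ (Fin n) → ℝ} (hf : Continuous f)
    (h0 : ∀ x, 0 ≤ f x) (hi : Integrable f) (h : ∫ x, f x = 0) : f = 0 :=
  (hf.ae_eq_iff_eq volume continuous_const).1 ((integral_eq_zero_iff_of_nonneg h0 hi).1 h)

/-- A test function on a nontrivial space with `∇v = 0` in `L²` vanishes. -/
theorem IsTest.integral_norm_gradient_sq_pos {v : EuclideanSpace ℝ (Fin n) → ℝ} (hn : 0 < n)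
    (hv : IsTest v) (h0 : v ≠ 0) : 0 < ∫ x, ‖(∇ v) x‖ ^ 2 := by
  refine lt_of_le_of_ne (integral_nonneg fun x => by positivity) fun h => h0 ?_
  have hg : (fun x => ‖(∇ v) x‖ ^ 2) = 0 := by
    exact eq_zero_of_integral_eq_zero hv.norm_gradient_sq.continuous (fun x => by positivity)
      hv.norm_gradient_sq.integrable h.symm
  have he : ∀ x, euler v x = 0 := fun x => by
    have h1 : ‖(∇ v) x‖ ^ 2 = 0 := congrFun hg x
    have h2 : ‖(∇ v) x‖ = 0 := by simpa using h1
    have := abs_euler_le v x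
    rw [h2, zero_mul] at this
    simpa using this
  have h1 := hv.integral_mul_euler_self
  simp_rw [he, mul_zero, integral_zero] at h1
  have hn' : (n : ℝ) ≠ 0 := by positivity
  have h2 : ∫ x, v x ^ 2 = 0 := by
    rcases mul_eq_zero.1 h1.symm with h | h
    · exact absurd h (by simpa using hn')
    · exact h
  have hc : IsTest fun x => v x ^ 2 := by simpa [pow_two] using hv.mul hv.1
  have := eq_zero_of_integral_eq_zero hc.continuous (fun x => by positivity)
    hc.integrable h2
  funext x
  simpa using congrFun this x

/-- The condition on b makes the coefficient of ∫ v² in the expanded square equal to −2k, so the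
numerator differs from a square only by a multiple of the denominator. -/
theorem integral_radialQuotient_numerator {N k : ℕ}
    {v : EuclideanSpace ℝ (Fin (N + 2 * k)) → ℝ} (hv : IsTest v)
    (hr : ∀ x y, ‖x‖ = ‖y‖ → v x = v y) (b : ℝ)
    (hb : b ^ 2 - b * (N + 2 * k) = - (2 * k)) :
    ((∫ x, (Δ v) x ^ 2) + ∫ x, (‖(∇ v) x‖ ^ 2 * ‖x‖ ^ 2 - 2 * (k : ℝ) * v x ^ 2)) =
      (∫ x, ((Δ v) x + euler v x + b * v x) ^ 2)
        + (2 * b - (N + 2 * k) + 2) * ∫ x, ‖(∇ v) x‖ ^ 2 := by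
  rw [hv.integral_sq_add_euler b]
  simp_rw [← euler_sq_of_radial hv.differentiable hr]
  rw [integral_sub, integral_const_mul]
  · push_cast
    rw [hb]
    ring
  · simpa [pow_two] using (hv.euler.mul hv.euler.1).integrable
  · simpa [pow_two] using ((hv.mul hv.1).integrable.const_mul (2 * (k : ℝ)))

/-! ### The lower bound C(N) ≥ gap N and its consequences -/

/-- The larger root of `b² - (N + 2k) b + 2k = 0`. -/
def upperRoot (N k : ℕ) : ℝ := ((N + 2 * k) + √((N + 2 * k) ^ 2 - 8 * k)) / 2

/-- The difference of the two sides is 4(k − 1)(N + k − 1), so k = 1 is the worst case. -/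
theorem discriminant_eq {N k : ℕ} (hN : 1 ≤ N) (hk : 1 ≤ k) :
    ((N : ℝ) ^ 2 + 4 * N - 4) ≤ ((N : ℝ) + 2 * k) ^ 2 - 8 * k := by
  have h1 : (1 : ℝ) ≤ N := by exact_mod_cast hN
  have h2 : (1 : ℝ) ≤ k := by exact_mod_cast hk
  nlinarith [mul_nonneg (sub_nonneg.2 h1) (sub_nonneg.2 h2), sq_nonneg ((k : ℝ) - 1)]

theorem upperRoot_spec {N k : ℕ} (hN : 1 ≤ N) (hk : 1 ≤ k) :
    upperRoot N k ^ 2 - upperRoot N k * (N + 2 * k) = - (2 * k) := by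
  have h1 : (1 : ℝ) ≤ N := by exact_mod_cast hN
  have h := Real.sq_sqrt (x := ((N : ℝ) + 2 * k) ^ 2 - 8 * k)
    (by have := discriminant_eq hN hk; nlinarith)
  rw [upperRoot]
  linear_combination (1 / 4) * h

/-- The spectral gap `√(N² + 4N - 4) - N`. -/
def gap (N : ℕ) : ℝ := √((N : ℝ) ^ 2 + 4 * N - 4) - N

theorem gap_le_upperRoot {N k : ℕ} (hN : 1 ≤ N) (hk : 1 ≤ k) :
    gap N + (N + 2) ≤ 2 * upperRoot N k - (N + 2 * k) + 2 := by
  have := Real.sqrt_le_sqrt (discriminant_eq hN hk)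
  rw [gap, upperRoot]
  linarith

theorem gap_eq_upperRoot (N : ℕ) :
    gap N + (N + 2) = 2 * upperRoot N 1 - (N + 2 * (1 : ℕ)) + 2 := by
  rw [gap, upperRoot]
  have : ((N : ℝ) + 2 * (1 : ℕ)) ^ 2 - 8 * (1 : ℕ) = (N : ℝ) ^ 2 + 4 * N - 4 := by
    push_cast; ring
  rw [this]
  ring

/-- A rational bound with the correct limit 2; it serves both the numerical bound for N ≥ 2 and the
lower limit. -/
theorem le_gap {N : ℕ} (hN : 1 ≤ N) : 2 - 4 / ((N : ℝ) + 1) ≤ gap N := by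
  have h1 : (1 : ℝ) ≤ N := by exact_mod_cast hN
  rw [gap, le_sub_iff_add_le]
  apply Real.le_sqrt_of_sq_le
  have h2 : (2 - 4 / ((N : ℝ) + 1) + N) = N + 2 * (N - 1) / (N + 1) := by
    field_simp
    ring
  rw [h2]
  have h3 : ((N : ℝ) + 2 * (N - 1) / (N + 1)) ^ 2 = N ^ 2 + (4 * N * (N - 1) * (N + 1) + 4 * (N - 1) ^ 2) / (N + 1) ^ 2 := by
    field_simp
    ring
  have h4 : (4 * (N : ℝ) * (N - 1) * (N + 1) + 4 * (N - 1) ^ 2) / (N + 1) ^ 2 ≤ 4 * N - 4 := by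
    rw [div_le_iff₀ (by positivity)]
    nlinarith [mul_nonneg (sub_nonneg.2 h1) (by positivity : (0 : ℝ) ≤ N)]
  linarith

theorem gap_nonneg {N : ℕ} (hN : 1 ≤ N) : 0 ≤ gap N := by
  refine le_trans ?_ (le_gap hN)
  have h1 : (1 : ℝ) ≤ N := by exact_mod_cast hN
  have : 4 / ((N : ℝ) + 1) ≤ 2 := by
    rw [div_le_iff₀ (by positivity)]
    linarith
  linarith

theorem gap_le_two (N : ℕ) : gap N ≤ 2 := by
  rw [gap, sub_le_iff_le_add]
  apply Real.sqrt_le_iff.2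
  constructor
  · positivity
  · nlinarith

theorem radialQuotient_ge {N k : ℕ} (hN : 1 ≤ N) (hk : 1 ≤ k)
    {v : EuclideanSpace ℝ (Fin (N + 2 * k)) → ℝ} (hv : IsTest v)
    (hr : ∀ x y, ‖x‖ = ‖y‖ → v x = v y) (h0 : v ≠ 0) :
    gap N + (N + 2) ≤ radialQuotient N k v := by
  have hD := hv.integral_norm_gradient_sq_pos (by omega) h0
  rw [radialQuotient, integral_radialQuotient_numerator hv hr _ (upperRoot_spec hN hk),
    le_div_iff₀ hD]
  have h1 : 0 ≤ ∫ x, ((Δ v) x + euler v x + upperRoot N k * v x) ^ 2 :=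
    integral_nonneg fun x => by positivity
  have h2 := mul_le_mul_of_nonneg_right (gap_le_upperRoot hN hk) hD.le
  linarith

/-- Guarantees that the infimum defining C(N,k) is not over the empty set, where the real `sInf`
would be the junk value 0. -/
theorem exists_radial_isTest (n : ℕ) : ∃ v : EuclideanSpace ℝ (Fin n) → ℝ,
    IsTest v ∧ (∀ x y, ‖x‖ = ‖y‖ → v x = v y) ∧ v ≠ 0 := by
  obtain ⟨η, h1, h2, h3⟩ : ∃ η : ContDiffBump (0 : ℝ), η.rIn = 1 ∧ η.rOut = 2 ∧ True :=
    ⟨⟨1, 2, one_pos, one_lt_two⟩, rfl, rfl, trivial⟩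
  refine ⟨fun x => η (‖x‖ ^ 2), ⟨η.contDiff.comp (contDiff_norm_sq ℝ), ?_⟩, fun x y h => by simp [h], ?_⟩
  · refine HasCompactSupport.of_support_subset_isCompact
      (isCompact_closedBall (0 : EuclideanSpace ℝ (Fin n)) 2) fun x hx => ?_
    have h4 : ‖x‖ ^ 2 ∈ Function.support η := hx
    rw [η.support_eq, h2, Real.ball_eq_Ioo] at h4
    rw [mem_closedBall_zero_iff]
    nlinarith [h4.2, norm_nonneg x]
  · intro h
    have h5 := congrFun h 0
    have : η (‖(0 : EuclideanSpace ℝ (Fin n))‖ ^ 2) = 1 := by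
      apply η.one_of_mem_closedBall
      simp [h1]
    simp only [this, Pi.zero_apply] at h5
    exact one_ne_zero h5

theorem bddBelow_radialQuotient {N k : ℕ} (hN : 1 ≤ N) (hk : 1 ≤ k) :
    BddBelow {q : ℝ | ∃ v : EuclideanSpace ℝ (Fin (N + 2 * k)) → ℝ,
      IsTest v ∧ (∀ x y, ‖x‖ = ‖y‖ → v x = v y) ∧ v ≠ 0 ∧ q = radialQuotient N k v} := by
  refine ⟨gap N + (N + 2), ?_⟩
  rintro q ⟨v, hv, hr, h0, rfl⟩
  exact radialQuotient_ge hN hk hv hr h0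

theorem gap_le_stabilityConstAt {N k : ℕ} (hN : 1 ≤ N) (hk : 1 ≤ k) :
    gap N ≤ stabilityConstAt N k := by
  rw [stabilityConstAt, le_sub_iff_add_le]
  apply le_csInf
  · obtain ⟨v, hv, hr, h0⟩ := exists_radial_isTest (N + 2 * k)
    exact ⟨_, v, hv, hr, h0, rfl⟩
  · rintro q ⟨v, hv, hr, h0, rfl⟩
    exact radialQuotient_ge hN hk hv hr h0

theorem gap_le_stabilityConst {N : ℕ} (hN : 1 ≤ N) : gap N ≤ stabilityConst N :=
  le_ciInf fun k => gap_le_stabilityConstAt hN k.2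

/-- The uniform lower bound `gap N` is needed here: the infimum of a family unbounded below would
default to 0. -/
theorem stabilityConst_le_stabilityConstAt_one {N : ℕ} (hN : 1 ≤ N) :
    stabilityConst N ≤ stabilityConstAt N 1 :=
  ciInf_le (f := fun k : ℕ+ => stabilityConstAt N k)
    ⟨gap N, by rintro _ ⟨k, rfl⟩; exact gap_le_stabilityConstAt hN k.2⟩ 1

theorem lt_stabilityConst_div_four {N : ℕ} (hN : 2 ≤ N) : 1 / 768 < stabilityConst N / 4 := by
  have h1 : (2 : ℝ) ≤ N := by exact_mod_cast hN
  have h2 := (le_gap (by omega : 1 ≤ N)).trans (gap_le_stabilityConst (by omega))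
  have : 4 / ((N : ℝ) + 1) ≤ 4 / 3 := by
    apply div_le_div_of_nonneg_left <;> linarith
  linarith

theorem half_le_liminf_stabilityConst :
    ((1 / 2 : ℝ) : EReal) ≤ liminf (fun N : ℕ => ((stabilityConst N / 4 : ℝ) : EReal)) atTop := by
  have h : Tendsto (fun N : ℕ => (((2 - 4 / ((N : ℝ) + 1)) / 4 : ℝ) : EReal)) atTop
      (𝓝 ((1 / 2 : ℝ) : EReal)) := by
    refine (continuous_coe_real_ereal.tendsto _).comp ?_
    have := tendsto_const_div_atTop_nhds_zero_nat (4 : ℝ)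
    have h2 : Tendsto (fun N : ℕ => 4 / ((N : ℝ) + 1)) atTop (𝓝 0) := by
      have := (tendsto_add_atTop_iff_nat 1).2 this
      simpa using this
    have h3 := (h2.const_sub 2).div_const 4
    convert h3 using 2
    norm_num
  rw [← h.liminf_eq]
  refine liminf_le_liminf ?_
  filter_upwards [eventually_ge_atTop 1] with N hN
  rw [EReal.coe_le_coe_iff]
  have := (le_gap hN).trans (gap_le_stabilityConst hN)
  linarith

/-! ### Radial functions -/

section Radial

variable {f : ℝ → ℝ}

theorem fderiv_comp_norm_sq {x : EuclideanSpace ℝ (Fin n)} (hf : DifferentiableAt ℝ f (‖x‖ ^ 2))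
    (v : EuclideanSpace ℝ (Fin n)) :
    fderiv ℝ (fun y : EuclideanSpace ℝ (Fin n) => f (‖y‖ ^ 2)) x v =
      2 * deriv f (‖x‖ ^ 2) * inner ℝ x v := by
  have h1 : HasFDerivAt (fun y : EuclideanSpace ℝ (Fin n) => ‖y‖ ^ 2) (2 • innerSL ℝ x) x :=
    (hasStrictFDerivAt_norm_sq x).hasFDerivAt
  have h2 := hf.hasDerivAt.comp_hasFDerivAt x h1
  have h3 : fderiv ℝ (fun y : EuclideanSpace ℝ (Fin n) => f (‖y‖ ^ 2)) x = _ := h2.fderiv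
  rw [h3]
  simp
  ring

theorem gradient_comp_norm_sq {x : EuclideanSpace ℝ (Fin n)}
    (hf : DifferentiableAt ℝ f (‖x‖ ^ 2)) :
    (∇ fun y : EuclideanSpace ℝ (Fin n) => f (‖y‖ ^ 2)) x = (2 * deriv f (‖x‖ ^ 2)) • x := by
  refine ext_inner_right ℝ fun v => ?_
  rw [inner_gradient_left, fderiv_comp_norm_sq hf, real_inner_smul_left]

theorem euler_comp_norm_sq {x : EuclideanSpace ℝ (Fin n)}
    (hf : DifferentiableAt ℝ f (‖x‖ ^ 2)) :
    euler (fun y : EuclideanSpace ℝ (Fin n) => f (‖y‖ ^ 2)) x =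
      2 * ‖x‖ ^ 2 * deriv f (‖x‖ ^ 2) := by
  rw [euler, fderiv_comp_norm_sq hf, real_inner_self_eq_norm_sq]
  ring

theorem laplacian_comp_norm_sq (hf : ContDiff ℝ 2 f) (x : EuclideanSpace ℝ (Fin n)) :
    (Δ fun y : EuclideanSpace ℝ (Fin n) => f (‖y‖ ^ 2)) x =
      4 * ‖x‖ ^ 2 * deriv (deriv f) (‖x‖ ^ 2) + 2 * n * deriv f (‖x‖ ^ 2) := by
  have hd : Differentiable ℝ f := hf.differentiable (by norm_num)
  have hf' : ContDiff ℝ 1 (deriv f) := by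
    have : ContDiff ℝ (1 + 1) f := by simpa [one_add_one_eq_two] using hf
    exact (contDiff_succ_iff_deriv.1 this).2.2
  have hd' : Differentiable ℝ (deriv f) := hf'.differentiable (by norm_num)
  have hc : ContDiff ℝ 2 fun y : EuclideanSpace ℝ (Fin n) => f (‖y‖ ^ 2) :=
    hf.comp (contDiff_norm_sq ℝ)
  rw [laplacian_eq_sum hc]
  have key (i : Fin n) : fderiv ℝ (fun y => fderiv ℝ (fun y : EuclideanSpace ℝ (Fin n) =>
      f (‖y‖ ^ 2)) y (EuclideanSpace.basisFun (Fin n) ℝ i)) x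
        (EuclideanSpace.basisFun (Fin n) ℝ i) =
      4 * deriv (deriv f) (‖x‖ ^ 2) * x i ^ 2 + 2 * deriv f (‖x‖ ^ 2) := by
    have e : (fun y => fderiv ℝ (fun y : EuclideanSpace ℝ (Fin n) =>
        f (‖y‖ ^ 2)) y (EuclideanSpace.basisFun (Fin n) ℝ i)) =
        fun y : EuclideanSpace ℝ (Fin n) => 2 * deriv f (‖y‖ ^ 2) * y i := by
      funext y
      rw [fderiv_comp_norm_sq (hd _)]
      simp [EuclideanSpace.inner_single_right]
    have hp : HasFDerivAt (fun y : EuclideanSpace ℝ (Fin n) => y i)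
        (EuclideanSpace.proj (𝕜 := ℝ) i) x := (EuclideanSpace.proj (𝕜 := ℝ) i).hasFDerivAt
    have hq : DifferentiableAt ℝ (fun y : EuclideanSpace ℝ (Fin n) => deriv f (‖y‖ ^ 2)) x :=
      (hf'.comp (contDiff_norm_sq ℝ)).differentiable (by norm_num) x
    rw [e, fderiv_fun_mul (hq.const_mul 2) hp.differentiableAt, fderiv_const_mul hq, hp.fderiv]
    simp only [add_apply, smul_apply, smul_eq_mul]
    rw [fderiv_comp_norm_sq (hd' _)]
    simp [EuclideanSpace.inner_single_right]
    ring
  rw [Finset.sum_congr rfl fun i _ => key i, Finset.sum_add_distrib, ← Finset.mul_sum,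
    EuclideanSpace.real_norm_sq_eq]
  simp
  ring

theorem isTest_comp_norm_sq (hf : ContDiff ℝ ∞ f) {T : ℝ} (hT : ∀ t, T ≤ t → f t = 0) :
    IsTest fun x : EuclideanSpace ℝ (Fin n) => f (‖x‖ ^ 2) := by
  refine ⟨hf.comp (contDiff_norm_sq ℝ), ?_⟩
  refine HasCompactSupport.of_support_subset_isCompact
    (isCompact_closedBall (0 : EuclideanSpace ℝ (Fin n)) (|T| + 1)) fun x hx => ?_
  rw [mem_closedBall_zero_iff]
  by_contra! h
  refine hx (hT _ ?_)
  nlinarith [norm_nonneg x, le_abs_self T, abs_nonneg T]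

end Radial

/-! ### The minimizing profile -/

section Profile

open ProbabilityTheory

variable {α β : ℝ}

theorem integral_betaMeasure (f : ℝ → ℝ) (hα : 0 < α) (hβ : 0 < β) :
    ∫ τ, f τ ∂(betaMeasure α β) =
      ∫ τ in Ioo (0 : ℝ) 1, (1 / beta α β * τ ^ (α - 1) * (1 - τ) ^ (β - 1)) * f τ := by
  rw [betaMeasure, integral_withDensity_eq_integral_toReal_smul₀, ← integral_indicator measurableSet_Ioo]
  · refine integral_congr_ae (Eventually.of_forall fun τ => ?_)
    beta_reduce
    by_cases h : τ ∈ Ioo (0 : ℝ) 1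
    · rw [indicator_of_mem h, betaPDF_of_pos_lt_one h.1 h.2, ENNReal.toReal_ofReal, smul_eq_mul]
      have := betaPDFReal_pos h.1 h.2 hα hβ
      rw [betaPDFReal, if_pos (mem_Ioo.1 h)] at this
      exact this.le
    · rw [indicator_of_notMem h, betaPDF_eq, if_neg (mt mem_Ioo.2 h)]
      simp
  · exact (measurable_betaPDFReal α β).ennreal_ofReal.aemeasurable
  · exact Eventually.of_forall fun τ => ENNReal.ofReal_lt_top

theorem integrable_betaMeasure_iff {f : ℝ → ℝ} (hα : 0 < α) (hβ : 0 < β) :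
    Integrable f (betaMeasure α β) ↔
      IntegrableOn (fun τ => (1 / beta α β * τ ^ (α - 1) * (1 - τ) ^ (β - 1)) * f τ)
        (Ioo (0 : ℝ) 1) := by
  rw [betaMeasure, integrable_withDensity_iff_integrable_smul₀', ← integrable_indicator_iff measurableSet_Ioo]
  · refine integrable_congr (Eventually.of_forall fun τ => ?_)
    beta_reduce
    by_cases h : τ ∈ Ioo (0 : ℝ) 1
    · rw [indicator_of_mem h, betaPDF_of_pos_lt_one h.1 h.2, ENNReal.toReal_ofReal, smul_eq_mul]
      have := betaPDFReal_pos h.1 h.2 hα hβ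
      rw [betaPDFReal, if_pos (mem_Ioo.1 h)] at this
      exact this.le
    · rw [indicator_of_notMem h, betaPDF_eq, if_neg (mt mem_Ioo.2 h)]
      simp
  · exact (measurable_betaPDFReal α β).ennreal_ofReal.aemeasurable
  · exact Eventually.of_forall fun τ => ENNReal.ofReal_lt_top

theorem ae_mem_Ioo_betaMeasure : ∀ᵐ τ ∂(betaMeasure α β), τ ∈ Ioo (0 : ℝ) 1 := by
  rw [betaMeasure, ae_withDensity_iff (f := betaPDF α β)
    (measurable_betaPDFReal α β).ennreal_ofReal]
  refine Eventually.of_forall fun τ h => ?_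
  by_contra hc
  refine h ?_
  rw [betaPDF_eq, if_neg (mt mem_Ioo.2 hc)]
  simp

theorem integrable_exp_mul_betaMeasure (hα : 0 < α) (hβ : 0 < β) (t : ℝ) :
    Integrable (fun τ => Real.exp (t * τ)) (betaMeasure α β) := by
  have := isProbabilityMeasureBeta hα hβ
  refine Integrable.of_bound (C := Real.exp |t|) (by fun_prop) ?_
  filter_upwards [ae_mem_Ioo_betaMeasure] with τ hτ
  rw [Real.norm_eq_abs, Real.abs_exp, Real.exp_le_exp]
  calc t * τ ≤ |t * τ| := le_abs_self _
    _ = |t| * τ := by rw [abs_mul, abs_of_pos hτ.1]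
    _ ≤ |t| := by nlinarith [abs_nonneg t, hτ.2]

theorem mem_interior_integrableExpSet_betaMeasure (hα : 0 < α) (hβ : 0 < β) (t : ℝ) :
    t ∈ interior (integrableExpSet id (betaMeasure α β)) := by
  have : integrableExpSet id (betaMeasure α β) = univ :=
    eq_univ_of_forall fun t => integrable_exp_mul_betaMeasure hα hβ t
  simp [this]

/-- The Laplace transform `t ↦ ∫ exp (-tτ/2)` of the beta distribution. -/
def profile (α β t : ℝ) : ℝ := mgf id (betaMeasure α β) (-(t / 2))

theorem contDiff_profile (hα : 0 < α) (hβ : 0 < β) : ContDiff ℝ ∞ (profile α β) := by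
  have h : ContDiff ℝ ∞ (mgf id (betaMeasure α β)) :=
    contDiff_iff_contDiffAt.2 fun t =>
      (analyticAt_mgf (mem_interior_integrableExpSet_betaMeasure hα hβ t)).contDiffAt
  exact h.comp (by fun_prop)

theorem hasDerivAt_integral_pow_profile (hα : 0 < α) (hβ : 0 < β) (k : ℕ) (t : ℝ) :
    HasDerivAt (fun t => ∫ τ, τ ^ k * Real.exp (-(t / 2) * τ) ∂(betaMeasure α β))
      (-(1 / 2) * ∫ τ, τ ^ (k + 1) * Real.exp (-(t / 2) * τ) ∂(betaMeasure α β)) t := by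
  have h := hasDerivAt_integral_pow_mul_exp_real
    (mem_interior_integrableExpSet_betaMeasure hα hβ (-(t / 2))) k
  have h2 : HasDerivAt (fun t : ℝ => -(t / 2)) (-(1 / 2)) t :=
    ((hasDerivAt_id t).div_const 2).neg
  have := h.comp t h2
  rw [mul_comm] at this
  exact this

theorem profile_eq (t : ℝ) :
    profile α β t = ∫ τ, τ ^ 0 * Real.exp (-(t / 2) * τ) ∂(betaMeasure α β) := by
  simp [profile, mgf]

theorem deriv_profile (hα : 0 < α) (hβ : 0 < β) : deriv (profile α β) = fun t =>
    -(1 / 2) * ∫ τ, τ ^ 1 * Real.exp (-(t / 2) * τ) ∂(betaMeasure α β) := by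
  funext t
  have : profile α β = fun t => ∫ τ, τ ^ 0 * Real.exp (-(t / 2) * τ) ∂(betaMeasure α β) :=
    funext profile_eq
  rw [this, (hasDerivAt_integral_pow_profile hα hβ 0 t).deriv]

theorem deriv_deriv_profile (hα : 0 < α) (hβ : 0 < β) : deriv (deriv (profile α β)) = fun t =>
    1 / 4 * ∫ τ, τ ^ 2 * Real.exp (-(t / 2) * τ) ∂(betaMeasure α β) := by
  funext t
  rw [deriv_profile hα hβ, ((hasDerivAt_integral_pow_profile hα hβ 1 t).const_mul _).deriv]
  ring

theorem integrable_pow_mul_exp_betaMeasure (hα : 0 < α) (hβ : 0 < β) (k : ℕ) (t : ℝ) :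
    Integrable (fun τ => τ ^ k * Real.exp (t * τ)) (betaMeasure α β) := by
  refine (integrable_exp_mul_betaMeasure hα hβ t).mono (by fun_prop) ?_
  filter_upwards [ae_mem_Ioo_betaMeasure] with τ hτ
  rw [norm_mul, norm_pow, Real.norm_eq_abs, abs_of_pos hτ.1]
  exact mul_le_of_le_one_left (norm_nonneg _) (pow_le_one₀ hτ.1.le hτ.2.le)

/-- The equation `Δv + x·∇v + 2α v = 0` for `v = F(|x|²)` in dimension `2 (α + β)`. -/
theorem profile_ode (hα : 0 < α) (hβ : 0 < β) (t : ℝ) :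
    4 * t * deriv (deriv (profile α β)) t + 4 * (α + β) * deriv (profile α β) t
      + 2 * t * deriv (profile α β) t + 2 * α * profile α β t = 0 := by
  have i (k : ℕ) := integrable_pow_mul_exp_betaMeasure hα hβ k (-(t / 2))
  rw [deriv_deriv_profile hα hβ, deriv_profile hα hβ, profile_eq]
  -- Times the unnormalized beta density, the integrand is the exact derivative of 2 e^{−tτ/2} τ^α
  -- (1 − τ)^β, which vanishes at both ends because α, β > 0.
  have e : ∫ τ, (t * τ ^ 2 - (2 * (α + β) + t) * τ + 2 * α) * Real.exp (-(t / 2) * τ)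
      ∂(betaMeasure α β) = 0 := by
    have hint : Integrable (fun τ => (t * τ ^ 2 - (2 * (α + β) + t) * τ + 2 * α) *
        Real.exp (-(t / 2) * τ)) (betaMeasure α β) := by
      have := (((i 2).const_mul t).sub ((i 1).const_mul (2 * (α + β) + t))).add
        ((i 0).const_mul (2 * α))
      refine this.congr (Eventually.of_forall fun τ => ?_)
      simp only [Pi.add_apply, Pi.sub_apply]
      ring
    rw [integral_betaMeasure _ hα hβ, ← integral_Ioc_eq_integral_Ioo,
      ← intervalIntegral.integral_of_le zero_le_one]
    rw [intervalIntegral.integral_eq_sub_of_hasDerivAt_of_le zero_le_one (f := fun τ =>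
      1 / beta α β * (2 * Real.exp (-(t / 2) * τ) * (τ ^ α * (1 - τ) ^ β)))]
    · simp [hα.ne', hβ.ne']
    · refine continuousOn_const.mul ((by fun_prop : Continuous fun τ : ℝ =>
        2 * Real.exp (-(t / 2) * τ)).continuousOn.mul ?_)
      exact ((continuous_id.rpow_const fun _ => Or.inr hα.le).mul
        ((continuous_const.sub continuous_id).rpow_const fun _ => Or.inr hβ.le)).continuousOn
    · intro τ hτ
      have h0 : τ ≠ 0 := hτ.1.ne'
      have h1 : 1 - τ ≠ 0 := (sub_pos.2 hτ.2).ne'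
      have d1 : HasDerivAt (fun τ : ℝ => τ ^ α) (α * τ ^ (α - 1)) τ :=
        Real.hasDerivAt_rpow_const (Or.inl h0)
      have d2 : HasDerivAt (fun τ : ℝ => (1 - τ) ^ β) (-1 * β * (1 - τ) ^ (β - 1)) τ :=
        ((hasDerivAt_id τ).const_sub 1).rpow_const (Or.inl h1)
      have d3 : HasDerivAt (fun τ : ℝ => Real.exp (-(t / 2) * τ))
          (Real.exp (-(t / 2) * τ) * (-(t / 2))) τ := by
        simpa using ((hasDerivAt_id τ).const_mul (-(t / 2))).exp
      have := (((d3.const_mul 2).mul (d1.mul d2))).const_mul (1 / beta α β)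
      refine this.congr_deriv ?_
      simp only [Pi.mul_apply]
      have e1 : τ ^ α = τ * τ ^ (α - 1) := by
        rw [Real.rpow_sub_one h0]; field_simp
      have e2 : (1 - τ) ^ β = (1 - τ) * (1 - τ) ^ (β - 1) := by
        rw [Real.rpow_sub_one h1]; field_simp
      rw [e1, e2]
      ring
    · rw [intervalIntegrable_iff_integrableOn_Ioo_of_le zero_le_one]
      exact (integrable_betaMeasure_iff hα hβ).1 hint
  have e2 : ∫ τ, (t * τ ^ 2 - (2 * (α + β) + t) * τ + 2 * α) * Real.exp (-(t / 2) * τ)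
      ∂(betaMeasure α β) = t * (∫ τ, τ ^ 2 * Real.exp (-(t / 2) * τ) ∂(betaMeasure α β))
      - (2 * (α + β) + t) * (∫ τ, τ ^ 1 * Real.exp (-(t / 2) * τ) ∂(betaMeasure α β))
      + 2 * α * (∫ τ, τ ^ 0 * Real.exp (-(t / 2) * τ) ∂(betaMeasure α β)) := by
    rw [← integral_const_mul, ← integral_const_mul, ← integral_const_mul, ← integral_sub,
      ← integral_add]
    · congr 1
      funext τ
      ring
    · exact ((i 2).const_mul _).sub ((i 1).const_mul _)
    · exact (i 0).const_mul _
    · exact (i 2).const_mul _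
    · exact (i 1).const_mul _
  rw [e] at e2
  linear_combination -e2

theorem profile_nonneg (t : ℝ) : 0 ≤ profile α β t := mgf_nonneg

/-- Differentiation only inserts a factor −τ/2 with 0 < τ < 1. Hence the first-order error terms of
a truncation are controlled by the profile itself. -/
theorem abs_deriv_profile_le (hα : 0 < α) (hβ : 0 < β) (t : ℝ) :
    |deriv (profile α β) t| ≤ profile α β t := by
  rw [deriv_profile hα hβ, profile_eq, abs_mul]
  have h0 : 0 ≤ ∫ τ, τ ^ 1 * Real.exp (-(t / 2) * τ) ∂(betaMeasure α β) := by
    refine integral_nonneg_of_ae ?_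
    filter_upwards [ae_mem_Ioo_betaMeasure] with τ hτ
    have := hτ.1
    simp only [Pi.zero_apply]
    positivity
  have h1 : ∫ τ, τ ^ 1 * Real.exp (-(t / 2) * τ) ∂(betaMeasure α β) ≤
      ∫ τ, τ ^ 0 * Real.exp (-(t / 2) * τ) ∂(betaMeasure α β) := by
    refine integral_mono_ae (integrable_pow_mul_exp_betaMeasure hα hβ _ _)
      (integrable_pow_mul_exp_betaMeasure hα hβ _ _) ?_
    filter_upwards [ae_mem_Ioo_betaMeasure] with τ hτ
    have := hτ.2.le
    simp only [pow_one, pow_zero]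
    gcongr
  rw [abs_of_nonneg h0]
  rw [show |(-(1 / 2) : ℝ)| = 1 / 2 by norm_num]
  linarith

theorem deriv_profile_neg (hα : 0 < α) (hβ : 0 < β) (t : ℝ) : deriv (profile α β) t < 0 := by
  rw [deriv_profile hα hβ]
  have := isProbabilityMeasureBeta hα hβ
  have h : 0 < ∫ τ, τ ^ 1 * Real.exp (-(t / 2) * τ) ∂(betaMeasure α β) := by
    rw [integral_pos_iff_support_of_nonneg_ae]
    · have : Function.support (fun τ : ℝ => τ ^ 1 * Real.exp (-(t / 2) * τ)) =ᵐ[betaMeasure α β]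
          univ := by
        filter_upwards [ae_mem_Ioo_betaMeasure] with τ hτ
        have := hτ.1
        refine propext ⟨fun _ => trivial, fun _ => ?_⟩
        exact (by positivity : τ ^ 1 * Real.exp (-(t / 2) * τ) ≠ 0)
      rw [measure_congr this]
      simp
    · filter_upwards [ae_mem_Ioo_betaMeasure] with τ hτ
      have := hτ.1
      simp only [Pi.zero_apply]
      positivity
    · exact integrable_pow_mul_exp_betaMeasure hα hβ _ _
  linarith

/-- Raise z/κ ≤ e^{z/κ} to the power κ. -/
theorem rpow_mul_exp_neg_le {κ z : ℝ} (hκ : 0 < κ) (hz : 0 < z) :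
    Real.exp (-z) ≤ κ ^ κ * z ^ (-κ) := by
  have h1 : z / κ ≤ Real.exp (z / κ) := by linarith [Real.add_one_le_exp (z / κ)]
  have h2 : (z / κ) ^ κ ≤ Real.exp z := by
    calc (z / κ) ^ κ ≤ Real.exp (z / κ) ^ κ := Real.rpow_le_rpow (by positivity) h1 hκ.le
      _ = Real.exp z := by rw [← Real.exp_mul]; congr 1; field_simp
  rw [Real.div_rpow hz.le hκ.le, div_le_iff₀ (by positivity)] at h2
  rw [Real.exp_neg, Real.rpow_neg hz.le, ← div_eq_mul_inv, le_div_iff₀ (by positivity),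
    inv_mul_le_iff₀ (Real.exp_pos z)]
  exact h2

/-- Up to a constant, τ^{−κ} turns the density with parameters (α, β) into the one with parameters
(α − κ, β). -/
theorem integrable_rpow_neg_betaMeasure {κ : ℝ} (hκ : κ < α) (hα : 0 < α) (hβ : 0 < β) :
    Integrable (fun τ : ℝ => τ ^ (-κ)) (betaMeasure α β) := by
  have h := (integrable_betaMeasure_iff (f := fun _ => 1) (sub_pos.2 hκ) hβ).1
    (by have := isProbabilityMeasureBeta (sub_pos.2 hκ) hβ; exact integrable_const _)
  rw [integrable_betaMeasure_iff hα hβ]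
  have h' := h.const_mul (1 / beta α β * beta (α - κ) β)
  refine IntegrableOn.congr_fun h' (fun τ hτ => ?_) measurableSet_Ioo
  have hb := (beta_pos (sub_pos.2 hκ) hβ).ne'
  have : τ ^ (α - κ - 1) = τ ^ (α - 1) * τ ^ (-κ) := by
    rw [← Real.rpow_add hτ.1]; congr 1; ring
  simp only [this]
  field_simp

/-- Bound e^{−z} by a multiple of z^{−κ} at z = (1 + t)τ/2 and integrate in τ. Passing from t to 1 +
t, which avoids the singularity at t = 0, costs a factor at most e^{1/2} since τ < 1. -/
theorem exists_profile_le {κ : ℝ} (h0 : 0 < κ) (hκ : κ < α) (hα : 0 < α) (hβ : 0 < β) :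
    ∃ C, ∀ t, 0 ≤ t → profile α β t ≤ C * (1 + t) ^ (-κ) := by
  refine ⟨Real.exp (1 / 2) * κ ^ κ * (1 / 2) ^ (-κ) * ∫ τ, τ ^ (-κ) ∂(betaMeasure α β),
    fun t ht => ?_⟩
  have hi := integrable_rpow_neg_betaMeasure hκ hα hβ
  rw [profile_eq, mul_assoc, mul_comm (∫ τ, τ ^ (-κ) ∂(betaMeasure α β)), ← mul_assoc,
    ← integral_const_mul]
  refine integral_mono_ae (integrable_pow_mul_exp_betaMeasure hα hβ _ _) (hi.const_mul _) ?_
  filter_upwards [ae_mem_Ioo_betaMeasure] with τ hτ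
  have h2 := rpow_mul_exp_neg_le h0 (z := 1 / 2 * (1 + t) * τ)
    (by have := hτ.1; positivity)
  rw [Real.mul_rpow (by positivity) hτ.1.le, Real.mul_rpow (by positivity) (by positivity)] at h2
  calc τ ^ 0 * Real.exp (-(t / 2) * τ)
      = Real.exp (1 / 2 * τ) * Real.exp (-(1 / 2 * (1 + t) * τ)) := by
        rw [← Real.exp_add, pow_zero, one_mul]; congr 1; ring
    _ ≤ Real.exp (1 / 2) * (κ ^ κ * ((1 / 2) ^ (-κ) * (1 + t) ^ (-κ) * τ ^ (-κ))) := by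
        gcongr
        linarith [hτ.2]
    _ = _ := by ring

/-- The profile is O(|x|^{−2κ}) for every κ < α, and its square is integrable at infinity as soon as
4κ > n. -/
theorem integrable_profile_norm_sq (hα : 0 < α) (hβ : 0 < β) (hn : (n : ℝ) < 4 * α) :
    Integrable fun x : EuclideanSpace ℝ (Fin n) => profile α β (‖x‖ ^ 2) ^ 2 := by
  obtain ⟨κ, h1, h2⟩ := exists_between (show (n : ℝ) / 4 < α by linarith)
  have h0 : 0 < κ := lt_of_le_of_lt (by positivity) h1
  obtain ⟨C, hC⟩ := exists_profile_le h0 h2 hα hβ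
  have hi := integrable_rpow_neg_one_add_norm_sq (E := EuclideanSpace ℝ (Fin n)) (μ := volume)
    (r := 4 * κ) (by simp; linarith)
  refine (hi.const_mul (C ^ 2)).mono' ?_ (Eventually.of_forall fun x => ?_)
  · exact (((contDiff_profile hα hβ).continuous.comp (continuous_norm.pow 2)).pow
      2).aestronglyMeasurable
  · rw [Real.norm_eq_abs, abs_of_nonneg (by positivity)]
    have := hC (‖x‖ ^ 2) (by positivity)
    calc profile α β (‖x‖ ^ 2) ^ 2 ≤ (C * (1 + ‖x‖ ^ 2) ^ (-κ)) ^ 2 :=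
          pow_le_pow_left₀ (profile_nonneg _) this 2
      _ = C ^ 2 * (1 + ‖x‖ ^ 2) ^ (-(4 * κ) / 2) := by
          rw [mul_pow, ← Real.rpow_natCast ((1 + ‖x‖ ^ 2) ^ (-κ)), ← Real.rpow_mul (by positivity)]
          congr 2
          push_cast
          ring

end Profile

/-! ### Smooth cutoffs -/

/-- A smooth cutoff equal to `1` for `t ≤ 1` and to `0` for `t ≥ 2`. -/
def cutoff (t : ℝ) : ℝ := Real.smoothTransition (2 - t)

theorem contDiff_cutoff {m : ℕ∞} : ContDiff ℝ m cutoff :=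
  Real.smoothTransition.contDiff.comp (contDiff_const.sub contDiff_id)

theorem cutoff_of_le {t : ℝ} (ht : t ≤ 1) : cutoff t = 1 :=
  Real.smoothTransition.one_of_one_le (by linarith)

theorem cutoff_of_ge {t : ℝ} (ht : 2 ≤ t) : cutoff t = 0 :=
  Real.smoothTransition.zero_of_nonpos (by linarith)

theorem cutoff_nonneg (t : ℝ) : 0 ≤ cutoff t := Real.smoothTransition.nonneg _

theorem cutoff_le_one (t : ℝ) : cutoff t ≤ 1 := Real.smoothTransition.le_one _

theorem deriv_cutoff_of_le {t : ℝ} (ht : t ≤ 1) : deriv cutoff t = 0 := by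
  have hc : Continuous (deriv cutoff) := (contDiff_cutoff (m := 1)).continuous_deriv (by norm_num)
  have hs : IsClosed {t | deriv cutoff t = 0} := isClosed_eq hc continuous_const
  have : Iio (1 : ℝ) ⊆ {t | deriv cutoff t = 0} := fun s hs => by
    have : cutoff =ᶠ[𝓝 s] fun _ => 1 := by
      filter_upwards [Iio_mem_nhds hs] with r hr using cutoff_of_le (le_of_lt hr)
    simp [this.deriv_eq]
  have h2 := closure_minimal this hs
  rw [closure_Iio] at h2
  exact h2 ht

theorem deriv_cutoff_of_ge {t : ℝ} (ht : 2 ≤ t) : deriv cutoff t = 0 := by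
  have hc : Continuous (deriv cutoff) := (contDiff_cutoff (m := 1)).continuous_deriv (by norm_num)
  have hs : IsClosed {t | deriv cutoff t = 0} := isClosed_eq hc continuous_const
  have : Ioi (2 : ℝ) ⊆ {t | deriv cutoff t = 0} := fun s hs => by
    have : cutoff =ᶠ[𝓝 s] fun _ => 0 := by
      filter_upwards [Ioi_mem_nhds hs] with r hr using cutoff_of_ge (le_of_lt hr)
    simp [this.deriv_eq]
  have h2 := closure_minimal this hs
  rw [closure_Ioi] at h2
  exact h2 ht

theorem deriv_deriv_cutoff_eq_zero {t : ℝ} (ht : t < 1 ∨ 2 < t) :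
    deriv (deriv cutoff) t = 0 := by
  have : deriv cutoff =ᶠ[𝓝 t] fun _ => 0 := by
    rcases ht with ht | ht
    · filter_upwards [Iio_mem_nhds ht] with r hr using deriv_cutoff_of_le (le_of_lt hr)
    · filter_upwards [Ioi_mem_nhds ht] with r hr using deriv_cutoff_of_ge (le_of_lt hr)
  simp [this.deriv_eq]

/-- Applied to derivatives of the cutoff. The bound on t f(t) is what makes truncation estimates
uniform in the scale. -/
theorem exists_bound_of_eq_zero {f : ℝ → ℝ} (hf : Continuous f)
    (h0 : ∀ t, t < 1 ∨ 2 < t → f t = 0) : ∃ C, 0 ≤ C ∧ (∀ t, |f t| ≤ C) ∧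
      ∀ t, |t * f t| ≤ 2 * C := by
  obtain ⟨C, hC⟩ := isCompact_Icc.exists_bound_of_continuousOn (s := Icc (1 : ℝ) 2) hf.continuousOn
  have h1 : 0 ≤ C := (norm_nonneg _).trans (hC 1 (by simp))
  have h2 (t : ℝ) : |f t| ≤ C := by
    by_cases h : t ∈ Icc (1 : ℝ) 2
    · exact hC t h
    · rw [h0 t (by by_contra! h'; exact h h')]
      simpa
  refine ⟨C, h1, h2, fun t => ?_⟩
  by_cases h : t ∈ Icc (1 : ℝ) 2
  · rw [abs_mul, abs_of_pos (by linarith [h.1] : 0 < t)]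
    exact mul_le_mul h.2 (h2 t) (abs_nonneg _) (by norm_num)
  · rw [h0 t (by by_contra! h'; exact h h')]
    simpa

section Cutoff

variable {f : ℝ → ℝ}

theorem contDiff_cutoff_mul (hf : ContDiff ℝ ∞ f) (ε : ℝ) : ContDiff ℝ ∞ fun t => cutoff (ε * t) * f t :=
  ((contDiff_cutoff (m := ⊤)).comp (contDiff_const.mul contDiff_id)).mul hf

theorem deriv_cutoff_mul (hf : ContDiff ℝ ∞ f) (ε : ℝ) : deriv (fun t => cutoff (ε * t) * f t) =
    fun t => ε * deriv cutoff (ε * t) * f t + cutoff (ε * t) * deriv f t := by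
  funext t
  have h1 : HasDerivAt (fun t => cutoff (ε * t)) (deriv cutoff (ε * t) * ε) t := by
    have h2 : HasDerivAt cutoff (deriv cutoff (ε * t)) (ε * t) :=
      ((contDiff_cutoff (m := 1)).differentiable (by norm_num) _).hasDerivAt
    have h3 : HasDerivAt (fun t : ℝ => ε * t) ε t := by
      simpa using (hasDerivAt_id t).const_mul ε
    exact h2.comp t h3
  refine (HasDerivAt.deriv (h1.mul ((hf.differentiable (by simp)) t).hasDerivAt)).trans ?_
  ring

theorem deriv_deriv_cutoff_mul (hf : ContDiff ℝ ∞ f) (ε : ℝ) : deriv (deriv (fun t => cutoff (ε * t) * f t)) =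
    fun t => ε ^ 2 * deriv (deriv cutoff) (ε * t) * f t
      + 2 * ε * deriv cutoff (ε * t) * deriv f t + cutoff (ε * t) * deriv (deriv f) t := by
  rw [deriv_cutoff_mul hf]
  funext t
  have h3 : HasDerivAt (fun t : ℝ => ε * t) ε t := by
    simpa using (hasDerivAt_id t).const_mul ε
  have h1 : HasDerivAt (fun t => cutoff (ε * t)) (deriv cutoff (ε * t) * ε) t := by
    have h2 : HasDerivAt cutoff (deriv cutoff (ε * t)) (ε * t) :=
      ((contDiff_cutoff (m := 1)).differentiable (by norm_num) _).hasDerivAt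
    exact h2.comp t h3
  have h4 : HasDerivAt (fun t => deriv cutoff (ε * t)) (deriv (deriv cutoff) (ε * t) * ε) t := by
    have h5 : ContDiff ℝ (1 + 1) cutoff := contDiff_cutoff (m := 2)
    have h2 : HasDerivAt (deriv cutoff) (deriv (deriv cutoff) (ε * t)) (ε * t) :=
      ((contDiff_succ_iff_deriv.1 h5).2.2.differentiable (by norm_num) _).hasDerivAt
    exact h2.comp t h3
  have h6 : HasDerivAt f (deriv f t) t := ((hf.differentiable (by simp)) t).hasDerivAt
  have h7 : HasDerivAt (deriv f) (deriv (deriv f) t) t :=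
    (((contDiff_infty_iff_deriv.1 hf).2.differentiable (by simp)) t).hasDerivAt
  refine (HasDerivAt.deriv (((h4.const_mul ε).mul h6).add (h1.mul h7))).trans ?_
  ring

end Cutoff

/-! ### The upper bound C(N, 1) ≤ gap N by truncated minimizers -/

section UpperBound

variable {α β : ℝ}

/-- The truncations of the minimizer. -/
def truncProfile (n : ℕ) (α β ε : ℝ) (x : EuclideanSpace ℝ (Fin n)) : ℝ :=
  cutoff (ε * ‖x‖ ^ 2) * profile α β (‖x‖ ^ 2)

theorem isTest_truncProfile (hα : 0 < α) (hβ : 0 < β) {ε : ℝ} (hε : 0 < ε) :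
    IsTest (truncProfile n α β ε) := by
  refine isTest_comp_norm_sq (f := fun t => cutoff (ε * t) * profile α β t)
    (contDiff_cutoff_mul (contDiff_profile hα hβ) ε) (T := 2 / ε) fun t ht => ?_
  rw [cutoff_of_ge, zero_mul]
  rwa [div_le_iff₀' hε] at ht

/-- By the differential equation of the profile only terms containing a derivative of the cutoff
survive. They vanish where ε|x|² < 1; elsewhere they are bounded by the profile uniformly in ε,
because each derivative of the cutoff brings a factor ε which compensates a factor t = |x|². -/
theorem exists_truncProfile_bound (hα : 0 < α) (hβ : 0 < β) (hn : (n : ℝ) = 2 * (α + β)) :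
    ∃ C, ∀ ε : ℝ, 0 < ε → ε ≤ 1 → ∀ x : EuclideanSpace ℝ (Fin n),
      |(Δ (truncProfile n α β ε)) x + euler (truncProfile n α β ε) x
        + 2 * α * truncProfile n α β ε x| ≤
        if 1 ≤ ε * ‖x‖ ^ 2 then C * profile α β (‖x‖ ^ 2) else 0 := by
  have hF := contDiff_profile hα hβ
  obtain ⟨C₁, h1, h2, h3⟩ := exists_bound_of_eq_zero
    ((contDiff_cutoff (m := 1)).continuous_deriv (by norm_num))
    (fun t ht => ht.elim (fun h => deriv_cutoff_of_le h.le) fun h => deriv_cutoff_of_ge h.le)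
  obtain ⟨C₂, h4, h5, h6⟩ := exists_bound_of_eq_zero (f := deriv (deriv cutoff))
    (by
      have h5 : ContDiff ℝ (1 + 1) cutoff := contDiff_cutoff (m := 2)
      exact (contDiff_succ_iff_deriv.1 h5).2.2.continuous_deriv (by norm_num))
    (fun t ht => deriv_deriv_cutoff_eq_zero ht)
  refine ⟨8 * C₂ + 2 * n * C₁ + 4 * C₁ + 16 * C₁, fun ε hε hε1 x => ?_⟩
  have hG := contDiff_cutoff_mul hF ε
  have hG2 : ContDiff ℝ 2 fun t => cutoff (ε * t) * profile α β t :=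
    contDiff_infty.1 hG 2
  set t := ‖x‖ ^ 2 with ht
  have ht0 : 0 ≤ t := by positivity
  have e : (Δ (truncProfile n α β ε)) x + euler (truncProfile n α β ε) x
        + 2 * α * truncProfile n α β ε x =
      profile α β t * (4 * ε * ((ε * t) * deriv (deriv cutoff) (ε * t))
        + 2 * n * ε * deriv cutoff (ε * t) + 2 * ((ε * t) * deriv cutoff (ε * t)))
        + 8 * ((ε * t) * deriv cutoff (ε * t)) * deriv (profile α β) t := by
    have e1 : truncProfile n α β ε = fun x : EuclideanSpace ℝ (Fin n) =>
      (fun t => cutoff (ε * t) * profile α β t) (‖x‖ ^ 2) := rfl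
    rw [e1, laplacian_comp_norm_sq hG2, euler_comp_norm_sq (hG2.differentiable (by norm_num) _),
      deriv_deriv_cutoff_mul hF, deriv_cutoff_mul hF]
    simp only [← ht]
    have := profile_ode hα hβ t
    rw [hn]
    linear_combination cutoff (ε * t) * this
  rw [e]
  split_ifs with h
  · have hP := profile_nonneg (α := α) (β := β) t
    have hP' := abs_deriv_profile_le hα hβ t
    have b1 : |4 * ε * ((ε * t) * deriv (deriv cutoff) (ε * t))
        + 2 * n * ε * deriv cutoff (ε * t) + 2 * ((ε * t) * deriv cutoff (ε * t))| ≤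
        8 * C₂ + 2 * n * C₁ + 4 * C₁ := by
      refine (abs_add_le _ _).trans (add_le_add ((abs_add_le _ _).trans (add_le_add ?_ ?_)) ?_)
      · rw [abs_mul, abs_of_pos (by positivity)]
        nlinarith [h6 (ε * t), abs_nonneg ((ε * t) * deriv (deriv cutoff) (ε * t))]
      · rw [abs_mul, abs_of_nonneg (by positivity)]
        have : (n : ℝ) * ε ≤ n := mul_le_of_le_one_right (by positivity) hε1
        have h0 : (0 : ℝ) ≤ n * ε := by positivity
        nlinarith [h2 (ε * t), abs_nonneg (deriv cutoff (ε * t))]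
      · rw [abs_mul, abs_two]
        linarith [h3 (ε * t)]
    have b2 : |8 * ((ε * t) * deriv cutoff (ε * t))| ≤ 16 * C₁ := by
      rw [abs_mul, abs_of_pos (by norm_num : (0 : ℝ) < 8)]
      linarith [h3 (ε * t)]
    refine (abs_add_le _ _).trans ?_
    rw [abs_mul, abs_mul _ (deriv (profile α β) t), abs_of_nonneg hP]
    have := mul_le_mul_of_nonneg_left b1 hP
    have := mul_le_mul b2 hP' (abs_nonneg _) (by positivity)
    linarith
  · push Not at h
    rw [deriv_cutoff_of_le h.le, deriv_deriv_cutoff_eq_zero (Or.inl h)]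
    simp

/-- Dominated convergence: at each point the error is eventually zero, and the majorant C² F(|x|²)²
is integrable since β < α means n = 2(α + β) < 4α. -/
theorem tendsto_integral_truncProfile (hα : 0 < α) (hβ : 0 < β) (hn : (n : ℝ) = 2 * (α + β))
    (hαβ : β < α) :
    Tendsto (fun j : ℕ => ∫ x : EuclideanSpace ℝ (Fin n),
      ((Δ (truncProfile n α β (1 / ((j : ℝ) + 1)))) x
        + euler (truncProfile n α β (1 / ((j : ℝ) + 1))) x
        + 2 * α * truncProfile n α β (1 / ((j : ℝ) + 1)) x) ^ 2) atTop (𝓝 0) := by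
  obtain ⟨C, hC⟩ := exists_truncProfile_bound hα hβ hn
  have hε (j : ℕ) : 0 < 1 / ((j : ℝ) + 1) := by positivity
  have hε1 (j : ℕ) : 1 / ((j : ℝ) + 1) ≤ 1 := by
    rw [div_le_one (by positivity)]
    linarith [(Nat.cast_nonneg j : (0 : ℝ) ≤ j)]
  have hC' (j : ℕ) := hC _ (hε j) (hε1 j)
  have hint := (integrable_profile_norm_sq (n := n) hα hβ (by linarith)).const_mul (C ^ 2)
  have h0 : (0 : ℝ) = ∫ _ : EuclideanSpace ℝ (Fin n), (0 : ℝ) := by simp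
  rw [h0]
  refine tendsto_integral_of_dominated_convergence _ (fun j => ?_) hint (fun j => ?_) ?_
  · have h := isTest_truncProfile (n := n) hα hβ (hε j)
    exact (((h.laplacian.add h.euler).add (h.const_mul _)).continuous.pow 2).aestronglyMeasurable
  · refine Eventually.of_forall fun x => ?_
    rw [Real.norm_eq_abs, abs_pow, ← mul_pow]
    have h1 := hC' j x
    split_ifs at h1 with h
    · exact pow_le_pow_left₀ (abs_nonneg _) h1 2
    · have h2 := le_antisymm h1 (abs_nonneg _)
      rw [h2, zero_pow two_ne_zero]
      positivity
  · refine Eventually.of_forall fun x => ?_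
    have ht : Tendsto (fun j : ℕ => 1 / ((j : ℝ) + 1) * ‖x‖ ^ 2) atTop (𝓝 0) := by
      simpa using (tendsto_one_div_add_atTop_nhds_zero_nat (𝕜 := ℝ)).mul_const (‖x‖ ^ 2)
    refine tendsto_const_nhds.congr' ?_
    filter_upwards [ht.eventually (gt_mem_nhds one_pos)] with j hj
    have h1 := hC' j x
    rw [if_neg (not_le.2 hj)] at h1
    have h2 := abs_eq_zero.1 (le_antisymm h1 (abs_nonneg _))
    rw [h2]
    simp

/-- For ε ≤ 1 the truncations agree with the profile on the unit ball, where its gradient does not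
vanish identically. This keeps the denominators of the quotients away from zero. -/
theorem exists_le_integral_gradient_truncProfile (hn0 : 0 < n) (hα : 0 < α) (hβ : 0 < β) :
    ∃ δ, 0 < δ ∧ ∀ ε : ℝ, 0 < ε → ε ≤ 1 →
      δ ≤ ∫ x : EuclideanSpace ℝ (Fin n), ‖(∇ (truncProfile n α β ε)) x‖ ^ 2 := by
  have hF := contDiff_profile hα hβ
  have hF' : Continuous (deriv (profile α β)) := hF.continuous_deriv (by simp)
  -- The squared gradient of the untruncated profile, times a cutoff supported in the unit ball: a
  -- common minorant for all ε ≤ 1.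
  set w : EuclideanSpace ℝ (Fin n) → ℝ := fun x =>
    cutoff (2 * ‖x‖ ^ 2) * (4 * deriv (profile α β) (‖x‖ ^ 2) ^ 2 * ‖x‖ ^ 2) with hw
  have hwt : HasCompactSupport w := by
    have := (isTest_comp_norm_sq (n := n) (f := fun t => cutoff (2 * t))
      ((contDiff_cutoff (m := ⊤)).comp (contDiff_const.mul contDiff_id)) (T := 1)
      (fun t ht => cutoff_of_ge (by linarith))).2
    exact this.mul_right
  have hwc : Continuous w := by
    have hc : Continuous cutoff := (contDiff_cutoff (m := 0)).continuous
    fun_prop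
  have hw0 : ∀ x, 0 ≤ w x := fun x => by
    have := cutoff_nonneg (2 * ‖x‖ ^ 2)
    simp only [hw]
    positivity
  refine ⟨∫ x, w x, ?_, fun ε hε hε1 => ?_⟩
  · refine hwc.integral_pos_of_hasCompactSupport_nonneg_nonzero hwt hw0
      (x := EuclideanSpace.single ⟨0, hn0⟩ (1 / 2)) ?_
    simp only [hw, PiLp.norm_single]
    rw [cutoff_of_le (by norm_num)]
    have := deriv_profile_neg hα hβ (‖(1 / 2 : ℝ)‖ ^ 2)
    have : deriv (profile α β) (‖(1 / 2 : ℝ)‖ ^ 2) ^ 2 ≠ 0 := pow_ne_zero _ this.ne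
    simp only [ne_eq, mul_eq_zero, this]
    norm_num
  · have ht := isTest_truncProfile (n := n) hα hβ hε
    refine integral_mono (hwc.integrable_of_hasCompactSupport hwt)
      ht.norm_gradient_sq.integrable fun x => ?_
    simp only [hw]
    by_cases hx : 1 ≤ ‖x‖ ^ 2
    · rw [cutoff_of_ge (by linarith), zero_mul]
      positivity
    · push Not at hx
      have h1 : ε * ‖x‖ ^ 2 ≤ 1 := by nlinarith [sq_nonneg ‖x‖]
      have e1 : truncProfile n α β ε = fun x : EuclideanSpace ℝ (Fin n) =>
        (fun t => cutoff (ε * t) * profile α β t) (‖x‖ ^ 2) := rfl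
      rw [e1, gradient_comp_norm_sq ((contDiff_cutoff_mul hF ε).differentiable (by simp) _),
        deriv_cutoff_mul hF]
      simp only [deriv_cutoff_of_le h1, cutoff_of_le h1]
      rw [norm_smul, mul_pow, Real.norm_eq_abs, sq_abs]
      have h2 := cutoff_le_one (2 * ‖x‖ ^ 2)
      have h3 : 0 ≤ 4 * deriv (profile α β) (‖x‖ ^ 2) ^ 2 * ‖x‖ ^ 2 := by positivity
      nlinarith [mul_le_of_le_one_left h3 h2]

end UpperBound

theorem stabilityConstAt_one_le {N : ℕ} (hN : 1 ≤ N) : stabilityConstAt N 1 ≤ gap N := by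
  have h1 : (1 : ℝ) ≤ N := by exact_mod_cast hN
  set b := upperRoot N 1 with hb
  set s := √(((N : ℝ) + 2 * (1 : ℕ)) ^ 2 - 8 * (1 : ℕ)) with hs
  have hbs : b = ((N + 2 * (1 : ℕ)) + s) / 2 := rfl
  have hs2 : s ^ 2 = ((N : ℝ) + 2 * (1 : ℕ)) ^ 2 - 8 * (1 : ℕ) :=
    Real.sq_sqrt (by push_cast; nlinarith)
  push_cast at hs2 hbs
  have hs0 : 0 < s := Real.sqrt_pos.2 (by push_cast; nlinarith)
  have hs1 : s < N + 2 := by nlinarith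
  -- 2α = b and α + β = (N + 2)/2, half of the dimension N + 2. Taking the larger root gives β < α,
  -- and s < N + 2 gives β > 0.
  set α := b / 2 with hα
  set β := ((N + 2) - b) / 2 with hβ
  have hα0 : 0 < α := by linarith
  have hβ0 : 0 < β := by linarith
  have hβα : β < α := by linarith
  have hn : ((N + 2 * 1 : ℕ) : ℝ) = 2 * (α + β) := by
    push_cast
    linarith
  obtain ⟨δ, hδ, hD⟩ := exists_le_integral_gradient_truncProfile (n := N + 2 * 1) (by omega) hα0 hβ0
  have hlim := tendsto_integral_truncProfile hα0 hβ0 hn hβα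
  have hε (j : ℕ) : 0 < 1 / ((j : ℝ) + 1) := by positivity
  have hε1 (j : ℕ) : 1 / ((j : ℝ) + 1) ≤ 1 := by
    rw [div_le_one (by positivity)]
    linarith [(Nat.cast_nonneg j : (0 : ℝ) ≤ j)]
  have hle (j : ℕ) : stabilityConstAt N 1 + (N + 2) ≤ (∫ x : EuclideanSpace ℝ (Fin (N + 2 * 1)),
      ((Δ (truncProfile (N + 2 * 1) α β (1 / ((j : ℝ) + 1)))) x
        + euler (truncProfile (N + 2 * 1) α β (1 / ((j : ℝ) + 1))) x
        + 2 * α * truncProfile (N + 2 * 1) α β (1 / ((j : ℝ) + 1)) x) ^ 2) / δ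
      + (gap N + (N + 2)) := by
    set v := truncProfile (N + 2 * 1) α β (1 / ((j : ℝ) + 1)) with hv
    have hvt : IsTest v := isTest_truncProfile hα0 hβ0 (hε j)
    have hvr : ∀ x y, ‖x‖ = ‖y‖ → v x = v y := fun x y h => by simp [hv, truncProfile, h]
    have hDj := hD _ (hε j) (hε1 j)
    rw [← hv] at hDj
    have hv0 : v ≠ 0 := by
      intro h
      rw [h] at hDj
      have : (∇ (0 : EuclideanSpace ℝ (Fin (N + 2 * 1)) → ℝ)) = 0 := by
        funext x
        simp [gradient]
      rw [this] at hDj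
      simp at hDj
      linarith
    rw [stabilityConstAt, sub_add_cancel]
    refine (csInf_le (bddBelow_radialQuotient hN le_rfl) ⟨v, hvt, hvr, hv0, rfl⟩).trans ?_
    rw [radialQuotient, integral_radialQuotient_numerator hvt hvr b (upperRoot_spec hN le_rfl),
      gap_eq_upperRoot, add_div, mul_div_cancel_right₀ _ (hδ.trans_le hDj).ne']
    have : 2 * α = b := by rw [hα]; ring
    rw [this]
    gcongr
  have hlim2 := (hlim.div_const δ).add_const (gap N + ((N : ℝ) + 2))
  have := ge_of_tendsto' hlim2 hle
  rw [zero_div, zero_add] at this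
  linarith

theorem stabilityConst_le_gap {N : ℕ} (hN : 1 ≤ N) : stabilityConst N ≤ gap N :=
  (stabilityConst_le_stabilityConstAt_one hN).trans (stabilityConstAt_one_le hN)

section

open ProbabilityTheory

/-! ### The Gaussian Poincaré inequality -/

/-- At x₀ the expression is 0/0, which evaluates to 0, and 0 is the true limit since g² vanishes to
second order. -/
theorem sq_div_mul_continuousWithinAt {g w : ℝ → ℝ} {g' x₀ : ℝ} (hg : HasDerivAt g g' x₀)
    (h0 : g x₀ = 0) (hw : ContinuousAt w x₀) :
    ContinuousAt (fun x => g x ^ 2 / (x - x₀) * w x) x₀ := by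
  have h1 : Tendsto (fun x => g x * slope g x₀ x * w x) (𝓝[≠] x₀) (𝓝 (0 * g' * w x₀)) := by
    have h2 : Tendsto g (𝓝[≠] x₀) (𝓝 0) := by
      have := hg.continuousAt.tendsto.mono_left (nhdsWithin_le_nhds (s := {x₀}ᶜ))
      rwa [h0] at this
    exact (h2.mul (hasDerivAt_iff_tendsto_slope.1 hg)).mul
      (hw.tendsto.mono_left nhdsWithin_le_nhds)
  rw [continuousAt_iff_punctured_nhds]
  have e : g x₀ ^ 2 / (x₀ - x₀) * w x₀ = 0 * g' * w x₀ := by simp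
  rw [e]
  refine h1.congr fun x => ?_
  rw [slope_def_field, h0]
  ring

/-- With g = f − f(0) and Φ = (g²/x) e^{−x²/2}, the integrand equals Φ' + (f' − g/x)² e^{−x²/2};
moreover Φ(0) = 0 and Φ(R) ≥ 0. The square vanishes for g = x, the extremal of the Gaussian Poincaré
inequality. -/
theorem integral_Ioc_sq_deriv_sub_sq_nonneg {f f' : ℝ → ℝ} (hf : ∀ x, HasDerivAt f (f' x) x)
    (hf' : Continuous f') {R : ℝ} (hR : 0 ≤ R) :
    0 ≤ ∫ x in (0 : ℝ)..R, (f' x ^ 2 - (f x - f 0) ^ 2) * Real.exp (-x ^ 2 / 2) := by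
  have hfc : Continuous f := continuous_iff_continuousAt.2 fun x => (hf x).continuousAt
  set g : ℝ → ℝ := fun x => f x - f 0 with hg
  have hgd (x : ℝ) : HasDerivAt g (f' x) x := (hf x).sub_const _
  set Φ : ℝ → ℝ := fun x => g x ^ 2 / (x - 0) * Real.exp (-x ^ 2 / 2) with hΦ
  have hw (x : ℝ) : HasDerivAt (fun x : ℝ => Real.exp (-x ^ 2 / 2))
      (Real.exp (-x ^ 2 / 2) * (-x)) x := by
    have : HasDerivAt (fun x : ℝ => -x ^ 2 / 2) (-x) x := by
      refine (((hasDerivAt_pow 2 x).neg).div_const 2).congr_deriv ?_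
      simp
      ring
    exact this.exp
  have key := intervalIntegral.sub_le_integral_of_hasDeriv_right_of_le (g := Φ)
    (g' := fun x => 2 * g x * f' x / x * Real.exp (-x ^ 2 / 2)
      - g x ^ 2 / x ^ 2 * Real.exp (-x ^ 2 / 2) - g x ^ 2 * Real.exp (-x ^ 2 / 2))
    (φ := fun x => (f' x ^ 2 - (f x - f 0) ^ 2) * Real.exp (-x ^ 2 / 2)) hR ?_ ?_ ?_ ?_
  · refine le_trans ?_ key
    simp only [hΦ, sub_zero, div_zero, zero_mul]
    positivity
  · intro x hx
    refine ContinuousAt.continuousWithinAt ?_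
    rcases hx.1.eq_or_lt with rfl | hx0
    · exact sq_div_mul_continuousWithinAt (hgd 0) (by simp [hg]) (hw 0).continuousAt
    · refine ContinuousAt.mul (ContinuousAt.div ?_ ?_ ?_) (hw x).continuousAt
      · exact ((hgd x).continuousAt).pow 2
      · fun_prop
      · simpa using hx0.ne'
  · intro x hx
    have h1 : HasDerivAt Φ _ x := (((hgd x).pow 2).div ((hasDerivAt_id x).sub_const 0)
      (by simpa using hx.1.ne')).mul (hw x)
    refine (h1.congr_deriv ?_).hasDerivWithinAt
    have : x ≠ 0 := hx.1.ne'
    simp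
    field_simp
    ring
  · exact Continuous.integrableOn_Icc (by fun_prop)
  · intro x hx
    have : x ≠ 0 := hx.1.ne'
    have h2 : 0 ≤ (f' x - g x / x) ^ 2 * Real.exp (-x ^ 2 / 2) := by positivity
    have h3 : (f' x ^ 2 - (f x - f 0) ^ 2) * Real.exp (-x ^ 2 / 2) -
      (2 * g x * f' x / x * Real.exp (-x ^ 2 / 2)
      - g x ^ 2 / x ^ 2 * Real.exp (-x ^ 2 / 2) - g x ^ 2 * Real.exp (-x ^ 2 / 2)) =
      (f' x - g x / x) ^ 2 * Real.exp (-x ^ 2 / 2) := by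
      simp only [hg]
      field_simp
      ring
    linarith

theorem integrable_mul_exp_neg_sq {φ : ℝ → ℝ} (hφ : Continuous φ) {C : ℝ}
    (hC : ∀ x, |φ x| ≤ C) : Integrable fun x => φ x * Real.exp (-x ^ 2 / 2) := by
  have h : Integrable fun x : ℝ => Real.exp (-x ^ 2 / 2) := by
    have := integrable_exp_neg_mul_sq (b := 1 / 2) (by norm_num)
    refine this.congr (Eventually.of_forall fun x => ?_)
    ring_nf
  exact h.bdd_mul hφ.aestronglyMeasurable (Eventually.of_forall hC)

theorem integral_sq_deriv_sub_sq_nonneg {f f' : ℝ → ℝ} (hf : ∀ x, HasDerivAt f (f' x) x)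
    (hf' : Continuous f') {C : ℝ} (hC : ∀ x, |f x| ≤ C) (hC' : ∀ x, |f' x| ≤ C) :
    0 ≤ ∫ x, (f' x ^ 2 - (f x - f 0) ^ 2) * Real.exp (-x ^ 2 / 2) := by
  have hfc : Continuous f := continuous_iff_continuousAt.2 fun x => (hf x).continuousAt
  have hint : Integrable fun x => (f' x ^ 2 - (f x - f 0) ^ 2) * Real.exp (-x ^ 2 / 2) := by
    refine integrable_mul_exp_neg_sq (C := C ^ 2 + (C + C) ^ 2) (by fun_prop) fun x => ?_
    refine (abs_sub _ _).trans (add_le_add ?_ ?_)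
    · rw [abs_pow]
      exact pow_le_pow_left₀ (abs_nonneg _) (hC' x) 2
    · rw [abs_pow]
      exact pow_le_pow_left₀ (abs_nonneg _) ((abs_sub _ _).trans (add_le_add (hC x) (hC 0))) 2
  have half {φ : ℝ → ℝ} (hφ : Integrable φ) (h : ∀ R, 0 ≤ R → 0 ≤ ∫ x in (0 : ℝ)..R, φ x) :
      0 ≤ ∫ x in Ioi (0 : ℝ), φ x := by
    refine ge_of_tendsto (intervalIntegral_tendsto_integral_Ioi 0 hφ.integrableOn tendsto_id) ?_
    filter_upwards [eventually_ge_atTop 0] with R hR using h R hR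
  rw [← integral_add_compl measurableSet_Ioi hint, compl_Ioi]
  refine add_nonneg (half hint fun R hR => integral_Ioc_sq_deriv_sub_sq_nonneg hf hf' hR) ?_
  have h2 := integral_comp_neg_Ioi (0 : ℝ)
    fun x => (f' x ^ 2 - (f x - f 0) ^ 2) * Real.exp (-x ^ 2 / 2)
  rw [neg_zero] at h2
  rw [← h2]
  refine half hint.comp_neg fun R hR => ?_
  have h3 := integral_Ioc_sq_deriv_sub_sq_nonneg (f := fun x => f (-x)) (f' := fun x => -f' (-x))
    (fun x => ((hf (-x)).comp x (hasDerivAt_neg x)).congr_deriv (by ring))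
    (by fun_prop) hR
  simpa using h3

theorem integrable_of_continuous_bound {α : Type*} [TopologicalSpace α] [MeasurableSpace α]
    [OpensMeasurableSpace α] [SecondCountableTopologyEither α ℝ] {μ : Measure α}
    [IsFiniteMeasure μ] {F : α → ℝ} (hF : Continuous F) {C : ℝ} (hC : ∀ x, |F x| ≤ C) :
    Integrable F μ :=
  Integrable.of_bound hF.aestronglyMeasurable C (Eventually.of_forall hC)

theorem integral_sq_sub_const {α : Type*} [MeasurableSpace α] {μ : Measure α}
    [IsProbabilityMeasure μ] {F : α → ℝ} (h1 : Integrable F μ) (h2 : Integrable (fun x => F x ^ 2) μ)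
    (c : ℝ) : ∫ x, (F x - c) ^ 2 ∂μ = (∫ x, F x ^ 2 ∂μ) - 2 * c * (∫ x, F x ∂μ) + c ^ 2 := by
  have e : ∀ x, (F x - c) ^ 2 = F x ^ 2 - 2 * c * F x + c ^ 2 := fun x => by ring
  simp_rw [e]
  have i : Integrable (fun x => F x ^ 2 - 2 * c * F x) μ := h2.sub (h1.const_mul _)
  rw [integral_add i (integrable_const _), integral_sub h2 (h1.const_mul _),
    integral_const_mul]
  simp

theorem sq_integral_le {α : Type*} [MeasurableSpace α] {μ : Measure α}
    [IsProbabilityMeasure μ] {F : α → ℝ} (h1 : Integrable F μ)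
    (h2 : Integrable (fun x => F x ^ 2) μ) : (∫ x, F x ∂μ) ^ 2 ≤ ∫ x, F x ^ 2 ∂μ := by
  have h := integral_sq_sub_const h1 h2 (∫ x, F x ∂μ)
  have : 0 ≤ ∫ x, (F x - ∫ x, F x ∂μ) ^ 2 ∂μ := integral_nonneg fun x => by positivity
  rw [h] at this
  nlinarith

/-- The variance is at most the mean square of f − f(0), because the mean is the best constant; the
latter is bounded by treating the two half-lines separately. -/
theorem gaussianReal_poincare {f f' : ℝ → ℝ} (hf : ∀ x, HasDerivAt f (f' x) x)
    (hf' : Continuous f') {C : ℝ} (hC : ∀ x, |f x| ≤ C) (hC' : ∀ x, |f' x| ≤ C) :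
    (∫ x, f x ^ 2 ∂(gaussianReal 0 1)) - (∫ x, f x ∂(gaussianReal 0 1)) ^ 2 ≤
      ∫ x, f' x ^ 2 ∂(gaussianReal 0 1) := by
  have hfc : Continuous f := continuous_iff_continuousAt.2 fun x => (hf x).continuousAt
  have hC2 (x : ℝ) : |f x ^ 2| ≤ C ^ 2 := by
    rw [abs_pow]; exact pow_le_pow_left₀ (abs_nonneg _) (hC x) 2
  have hC2' (x : ℝ) : |f' x ^ 2| ≤ C ^ 2 := by
    rw [abs_pow]; exact pow_le_pow_left₀ (abs_nonneg _) (hC' x) 2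
  have i1 : Integrable f (gaussianReal 0 1) := integrable_of_continuous_bound hfc hC
  have i2 : Integrable (fun x => f x ^ 2) (gaussianReal 0 1) :=
    integrable_of_continuous_bound (by fun_prop) hC2
  have i3 : Integrable (fun x => f' x ^ 2) (gaussianReal 0 1) :=
    integrable_of_continuous_bound (by fun_prop) hC2'
  have i4 : Integrable (fun x => (f x - f 0) ^ 2) (gaussianReal 0 1) :=
    integrable_of_continuous_bound (C := (C + C) ^ 2) (by fun_prop) fun x => by
      rw [abs_pow]
      exact pow_le_pow_left₀ (abs_nonneg _) ((abs_sub _ _).trans (add_le_add (hC x) (hC 0))) 2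
  have h1 := integral_sq_sub_const i1 i2 (f 0)
  have h2 : 0 ≤ ∫ x, (f' x ^ 2 - (f x - f 0) ^ 2) ∂(gaussianReal 0 1) := by
    rw [integral_gaussianReal_eq_integral_smul one_ne_zero]
    have e : ∀ x, gaussianPDFReal 0 1 x • (f' x ^ 2 - (f x - f 0) ^ 2) =
        (√(2 * Real.pi))⁻¹ * ((f' x ^ 2 - (f x - f 0) ^ 2) * Real.exp (-x ^ 2 / 2)) := fun x => by
      simp [gaussianPDFReal]
      ring
    simp_rw [e]
    rw [integral_const_mul]
    exact mul_nonneg (by positivity) (integral_sq_deriv_sub_sq_nonneg hf hf' hC hC')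
  rw [integral_sub i3 i4, h1] at h2
  nlinarith [sq_nonneg (f 0 - ∫ x, f x ∂(gaussianReal 0 1))]

theorem integral_pi_succ {n : ℕ} {H : (Fin (n + 1) → ℝ) → ℝ} (hH : Continuous H) {C : ℝ}
    (hC : ∀ x, |H x| ≤ C) :
    ∫ z, H z ∂(Measure.pi fun _ : Fin (n + 1) => gaussianReal 0 1) =
      ∫ x, ∫ y, H (Fin.cons x y) ∂(Measure.pi fun _ : Fin n => gaussianReal 0 1)
        ∂(gaussianReal 0 1) := by
  rw [← ((measurePreserving_piFinSuccAbove (fun _ : Fin (n + 1) => gaussianReal 0 1)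
    0).symm).integral_comp']
  have hc : Continuous fun p : ℝ × (Fin n → ℝ) => H (Fin.cons p.1 p.2) :=
    hH.comp (Continuous.finCons continuous_fst continuous_snd)
  have e : ∀ p : ℝ × (Fin n → ℝ), H ((MeasurableEquiv.piFinSuccAbove (fun _ => ℝ) 0).symm p) =
      H (Fin.cons p.1 p.2) := fun p => by
    congr 1
    simp [MeasurableEquiv.piFinSuccAbove, Fin.insertNthEquiv]
  simp_rw [e]
  exact integral_prod _ (integrable_of_continuous_bound hc fun p => hC _)

/-- The Gaussian Poincaré inequality on `ℝⁿ`, by tensorization. -/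
theorem gaussian_pi_poincare (n : ℕ) : ∀ (F : (Fin n → ℝ) → ℝ) (G : Fin n → (Fin n → ℝ) → ℝ)
    (C : ℝ), Continuous F → (∀ i, Continuous (G i)) → (∀ x, |F x| ≤ C) → (∀ i x, |G i x| ≤ C) →
    (∀ i x, HasDerivAt (fun t => F (Function.update x i t)) (G i x) (x i)) →
    (∫ x, F x ^ 2 ∂(Measure.pi fun _ => gaussianReal 0 1))
      - (∫ x, F x ∂(Measure.pi fun _ => gaussianReal 0 1)) ^ 2 ≤
      ∑ i, ∫ x, G i x ^ 2 ∂(Measure.pi fun _ => gaussianReal 0 1) := by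
  induction n with
  | zero =>
    intro F G C _ _ _ _ _
    have e : ∀ x : Fin 0 → ℝ, F x = F default := fun x => by rw [Subsingleton.elim x default]
    simp_rw [e]
    simp
  | succ n ih =>
    intro F G C hF hG hFC hGC hd
    set P : Measure (Fin n → ℝ) := Measure.pi fun _ => gaussianReal 0 1
    have hcons : Continuous fun p : ℝ × (Fin n → ℝ) => (Fin.cons p.1 p.2 : Fin (n + 1) → ℝ) :=
      Continuous.finCons continuous_fst continuous_snd
    have hc1 (x : ℝ) : Continuous fun y : Fin n → ℝ => (Fin.cons x y : Fin (n + 1) → ℝ) :=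
      hcons.comp (by fun_prop : Continuous fun y : Fin n → ℝ => (x, y))
    have hc2 (y : Fin n → ℝ) : Continuous fun x : ℝ => (Fin.cons x y : Fin (n + 1) → ℝ) :=
      hcons.comp (by fun_prop : Continuous fun x : ℝ => (x, y))
    have bsq {a : ℝ} (h : |a| ≤ C) : |a ^ 2| ≤ C ^ 2 := by
      rw [abs_pow]; exact pow_le_pow_left₀ (abs_nonneg _) h 2
    have intY {H : (Fin (n + 1) → ℝ) → ℝ} (hH : Continuous H) {C : ℝ} (hC : ∀ z, |H z| ≤ C)
        (x : ℝ) : Integrable (fun y => H (Fin.cons x y)) P :=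
      integrable_of_continuous_bound (hH.comp (hc1 x)) fun y => hC _
    have contX {H : (Fin (n + 1) → ℝ) → ℝ} (hH : Continuous H) {C : ℝ} (hC : ∀ z, |H z| ≤ C) :
        Continuous fun x => ∫ y, H (Fin.cons x y) ∂P :=
      continuous_of_dominated (bound := fun _ => C)
        (fun x => (hH.comp (hc1 x)).aestronglyMeasurable)
        (fun x => Eventually.of_forall fun y => hC _) (integrable_const _)
        (Eventually.of_forall fun y => hH.comp (hc2 y))
    have boundX {H : (Fin (n + 1) → ℝ) → ℝ} {C : ℝ} (hC : ∀ z, |H z| ≤ C)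
        (x : ℝ) : |∫ y, H (Fin.cons x y) ∂P| ≤ C := by
      have := norm_integral_le_of_norm_le_const (μ := P) (f := fun y => H (Fin.cons x y)) (C := C)
        (Eventually.of_forall fun y => hC (Fin.cons x y))
      simpa using this
    have intX {H : (Fin (n + 1) → ℝ) → ℝ} (hH : Continuous H) {C : ℝ} (hC : ∀ z, |H z| ≤ C) :
        Integrable (fun x => ∫ y, H (Fin.cons x y) ∂P) (gaussianReal 0 1) :=
      integrable_of_continuous_bound (contX hH hC) (boundX hC)
    have hF2 : Continuous fun z => F z ^ 2 := hF.pow 2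
    have hG2 (i : Fin (n + 1)) : Continuous fun z => G i z ^ 2 := (hG i).pow 2
    rw [integral_pi_succ hF2 fun z => bsq (hFC z), integral_pi_succ hF hFC, Fin.sum_univ_succ]
    simp_rw [fun i => integral_pi_succ (hG2 i) fun z => bsq (hGC i z)]
    -- The variance is the mean of the conditional variance given the first coordinate plus the
    -- variance of the conditional mean. The induction hypothesis bounds the former; the
    -- one-dimensional inequality, followed by Jensen for the derivative, bounds the latter.
    have h1 (x : ℝ) : (∫ y, F (Fin.cons x y) ^ 2 ∂P) - (∫ y, F (Fin.cons x y) ∂P) ^ 2 ≤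
        ∑ i : Fin n, ∫ y, G i.succ (Fin.cons x y) ^ 2 ∂P := by
      refine ih (fun y => F (Fin.cons x y)) (fun i y => G i.succ (Fin.cons x y)) C
        (hF.comp (hc1 x)) (fun i => (hG i.succ).comp (hc1 x)) (fun y => hFC _)
        (fun i y => hGC _ _) fun i y => ?_
      have := hd i.succ (Fin.cons x y)
      simpa only [← Fin.cons_update, Fin.cons_succ] using this
    have hm : ∀ x, HasDerivAt (fun x => ∫ y, F (Fin.cons x y) ∂P)
        (∫ y, G 0 (Fin.cons x y) ∂P) x := fun x => by
      refine (hasDerivAt_integral_of_dominated_loc_of_deriv_le (bound := fun _ => C)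
        (F := fun x y => F (Fin.cons x y)) (F' := fun x y => G 0 (Fin.cons x y)) univ_mem
        (Eventually.of_forall fun x => (hF.comp (hc1 x)).aestronglyMeasurable)
        (intY hF hFC x) ((hG 0).comp (hc1 x)).aestronglyMeasurable
        (Eventually.of_forall fun y x _ => hGC _ _) (integrable_const _)
        (Eventually.of_forall fun y x _ => ?_)).2
      have := hd 0 (Fin.cons x y)
      simpa only [Fin.update_cons_zero, Fin.cons_zero] using this
    have h2 := gaussianReal_poincare hm (contX (hG 0) (hGC 0)) (boundX hFC) (boundX (hGC 0))
    have h3 : ∫ x, (∫ y, G 0 (Fin.cons x y) ∂P) ^ 2 ∂(gaussianReal 0 1) ≤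
        ∫ x, ∫ y, G 0 (Fin.cons x y) ^ 2 ∂P ∂(gaussianReal 0 1) := by
      refine integral_mono ?_ (intX (hG2 0) fun z => bsq (hGC 0 z)) fun x =>
        sq_integral_le (intY (hG 0) (hGC 0) x) (intY (hG2 0) (fun z => bsq (hGC 0 z)) x)
      exact integrable_of_continuous_bound ((contX (hG 0) (hGC 0)).pow 2)
        fun x => bsq (boundX (hGC 0) x)
    have i1 : Integrable (fun x => (∫ y, F (Fin.cons x y) ∂P) ^ 2) (gaussianReal 0 1) :=
      integrable_of_continuous_bound ((contX hF hFC).pow 2) fun x => bsq (boundX hFC x)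
    have i2 := intX hF2 fun z => bsq (hFC z)
    have h4 : ∫ x, ((∫ y, F (Fin.cons x y) ^ 2 ∂P) - (∫ y, F (Fin.cons x y) ∂P) ^ 2)
        ∂(gaussianReal 0 1) ≤
        ∫ x, ∑ i : Fin n, (∫ y, G i.succ (Fin.cons x y) ^ 2 ∂P) ∂(gaussianReal 0 1) := by
      refine integral_mono (i2.sub i1) (integrable_finsetSum _ fun i _ =>
        intX (hG2 i.succ) fun z => bsq (hGC i.succ z)) h1
    rw [integral_sub i2 i1, integral_finsetSum _ fun i _ =>
      intX (hG2 i.succ) fun z => bsq (hGC i.succ z)] at h4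
    linarith

end

section

open ProbabilityTheory

theorem prod_gaussianPDFReal (x : Fin n → ℝ) :
    ∏ i, gaussianPDFReal 0 1 (x i) =
      (√(2 * Real.pi))⁻¹ ^ n * Real.exp (-‖WithLp.toLp 2 x‖ ^ 2 / 2) := by
  simp only [gaussianPDFReal, Finset.prod_mul_distrib, EuclideanSpace.real_norm_sq_eq]
  rw [← Real.exp_sum]
  simp [Finset.sum_div, neg_div]

theorem pi_gaussianReal_eq_withDensity :
    (Measure.pi fun _ : Fin n => gaussianReal 0 1) =
      volume.withDensity fun x => ENNReal.ofReal (∏ i, gaussianPDFReal 0 1 (x i)) := by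
  refine Measure.pi_eq fun s hs => ?_
  have h0 (x : Fin n → ℝ) : 0 ≤ ∏ i, (s i).indicator (gaussianPDFReal 0 1) (x i) :=
    Finset.prod_nonneg fun i _ => indicator_nonneg (fun y _ => gaussianPDFReal_nonneg 0 1 y) _
  have hint (i : Fin n) : Integrable ((s i).indicator (gaussianPDFReal 0 1)) :=
    (integrable_gaussianPDFReal 0 1).indicator (hs i)
  have hprod : Integrable (fun x : Fin n → ℝ => ∏ i, (s i).indicator (gaussianPDFReal 0 1) (x i))
      volume := Integrable.fintype_prod hint
  have e : ∫⁻ x : Fin n → ℝ in univ.pi s, ENNReal.ofReal (∏ i, gaussianPDFReal 0 1 (x i)) =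
      ∫⁻ x : Fin n → ℝ, ENNReal.ofReal (∏ i, (s i).indicator (gaussianPDFReal 0 1) (x i)) := by
    rw [← lintegral_indicator (MeasurableSet.univ_pi hs)]
    refine lintegral_congr fun x => ?_
    by_cases hx : x ∈ univ.pi s
    · rw [indicator_of_mem hx]
      congr 1
      exact Finset.prod_congr rfl fun i _ => (indicator_of_mem (hx i trivial) _).symm
    · rw [indicator_of_notMem hx]
      simp only [mem_univ_pi, not_forall] at hx
      obtain ⟨i, hi⟩ := hx
      rw [Finset.prod_eq_zero (Finset.mem_univ i) (indicator_of_notMem hi _), ENNReal.ofReal_zero]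
  rw [withDensity_apply _ (MeasurableSet.univ_pi hs), e, ← ofReal_integral_eq_lintegral_ofReal
    hprod (Eventually.of_forall h0), integral_fintype_prod_volume_eq_prod,
    ENNReal.ofReal_prod_of_nonneg fun i _ => integral_nonneg fun y =>
      indicator_nonneg (fun y _ => gaussianPDFReal_nonneg 0 1 y) _]
  refine Finset.prod_congr rfl fun i _ => ?_
  rw [integral_indicator (hs i), gaussianReal_apply_eq_integral _ one_ne_zero]

theorem integral_pi_gaussianReal (H : EuclideanSpace ℝ (Fin n) → ℝ) :
    ∫ x, H (WithLp.toLp 2 x) ∂(Measure.pi fun _ : Fin n => gaussianReal 0 1) =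
      (√(2 * Real.pi))⁻¹ ^ n * ∫ x, H x * Real.exp (-‖x‖ ^ 2 / 2) := by
  have hm : Measurable fun x : Fin n → ℝ => ∏ i, gaussianPDFReal 0 1 (x i) :=
    Finset.measurable_prod _ fun i _ => (measurable_gaussianPDFReal 0 1).comp (measurable_pi_apply i)
  rw [pi_gaussianReal_eq_withDensity, integral_withDensity_eq_integral_toReal_smul₀
    hm.ennreal_ofReal.aemeasurable (Eventually.of_forall fun _ => ENNReal.ofReal_lt_top)]
  rw [← (PiLp.volume_preserving_toLp (Fin n)).integral_comp
    (MeasurableEquiv.toLp 2 (Fin n → ℝ)).measurableEmbedding, ← integral_const_mul]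
  congr 1
  funext x
  rw [ENNReal.toReal_ofReal (Finset.prod_nonneg fun i _ => gaussianPDFReal_nonneg 0 1 _),
    prod_gaussianPDFReal, smul_eq_mul]
  ring

/-- The Gaussian Poincaré inequality for functions of mean zero. -/
theorem gaussian_poincare {F : EuclideanSpace ℝ (Fin n) → ℝ} (hF : ContDiff ℝ 1 F)
    (hs : HasCompactSupport F) (h0 : ∫ x, F x * Real.exp (-‖x‖ ^ 2 / 2) = 0) :
    ∫ x, F x ^ 2 * Real.exp (-‖x‖ ^ 2 / 2) ≤ ∫ x, ‖(∇ F) x‖ ^ 2 * Real.exp (-‖x‖ ^ 2 / 2) := by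
  have hF' : Continuous (fderiv ℝ F) := hF.continuous_fderiv (by norm_num)
  obtain ⟨C₁, hC₁⟩ := hs.exists_bound_of_continuous hF.continuous
  obtain ⟨C₂, hC₂⟩ := (hs.fderiv ℝ).exists_bound_of_continuous hF'
  have hL : Continuous fun x : Fin n → ℝ => (WithLp.toLp 2 x : EuclideanSpace ℝ (Fin n)) :=
    PiLp.continuous_toLp 2 _
  have hp := gaussian_pi_poincare n (fun x => F (WithLp.toLp 2 x))
    (fun i x => fderiv ℝ F (WithLp.toLp 2 x) (EuclideanSpace.basisFun (Fin n) ℝ i)) (max C₁ C₂)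
    (hF.continuous.comp hL) (fun i => (hF'.comp hL).clm_apply continuous_const)
    (fun x => (hC₁ _).trans (le_max_left _ _))
    (fun i x => by
      rw [← Real.norm_eq_abs]
      refine (ContinuousLinearMap.le_opNorm (fderiv ℝ F _) _).trans ?_
      rw [OrthonormalBasis.norm_eq_one, mul_one]
      exact (hC₂ _).trans (le_max_right _ _))
    (fun i x => by
      have h1 : HasDerivAt (fun t => WithLp.toLp 2 (Function.update x i t) :
          ℝ → EuclideanSpace ℝ (Fin n)) (EuclideanSpace.basisFun (Fin n) ℝ i) (x i) := by
        have h2 := (hasDerivAt_update x i (x i))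
        have h3 := (((PiLp.continuousLinearEquiv 2 ℝ fun _ : Fin n => ℝ).symm :
          (Fin n → ℝ) →L[ℝ] EuclideanSpace ℝ (Fin n)).hasFDerivAt (x := Function.update x i
            (x i))).comp_hasDerivAt (x i) h2
        exact h3.congr_deriv (by simp)
      have h2 : HasFDerivAt F (fderiv ℝ F (WithLp.toLp 2 x))
          (WithLp.toLp 2 (Function.update x i (x i))) := by
        rw [Function.update_eq_self]
        exact (hF.differentiable (by norm_num) _).hasFDerivAt
      exact h2.comp_hasDerivAt (x i) h1)
  have e (i : Fin n) := integral_pi_gaussianReal fun y => fderiv ℝ F y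
    (EuclideanSpace.basisFun (Fin n) ℝ i) ^ 2
  simp_rw [e] at hp
  rw [integral_pi_gaussianReal fun y => F y ^ 2, integral_pi_gaussianReal F, h0, mul_zero,
    zero_pow two_ne_zero, sub_zero, ← Finset.mul_sum] at hp
  have hpos : 0 < (√(2 * Real.pi))⁻¹ ^ n := by positivity
  refine (le_of_mul_le_mul_left hp hpos).trans_eq ?_
  rw [← integral_finsetSum]
  · congr 1
    funext x
    rw [← Finset.sum_mul, ← real_inner_self_eq_norm_sq ((∇ F) x), inner_gradient_eq_sum]
    simp_rw [pow_two]
  · intro i _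
    have hcs : HasCompactSupport fun x => fderiv ℝ F x (EuclideanSpace.basisFun (Fin n) ℝ i) ^ 2 *
        Real.exp (-‖x‖ ^ 2 / 2) := by
      refine HasCompactSupport.mul_right ?_
      simp_rw [pow_two]
      exact (hs.fderiv_apply ℝ _).mul_right
    refine Continuous.integrable_of_hasCompactSupport ?_ hcs
    exact ((hF'.clm_apply continuous_const).pow 2).mul (by fun_prop)

/-! ### Polar coordinates -/

/-- The surface measure on the unit sphere. -/
abbrev sphereMeasure (n : ℕ) : Measure (Metric.sphere (0 : EuclideanSpace ℝ (Fin n)) 1) :=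
  (volume : Measure (EuclideanSpace ℝ (Fin n))).toSphere

theorem integral_polar [NeZero n] {f : EuclideanSpace ℝ (Fin n) → ℝ} (hf : Integrable f) :
    ∫ x, f x = ∫ r in Ioi (0 : ℝ), r ^ (n - 1) * ∫ σ, f (r • σ.1) ∂(sphereMeasure n) := by
  have : Nontrivial (EuclideanSpace ℝ (Fin n)) := by
    refine Module.nontrivial_of_finrank_pos (R := ℝ) ?_
    simp [Nat.pos_of_ne_zero (NeZero.ne n)]
  have hmp := (volume : Measure (EuclideanSpace ℝ (Fin n))).measurePreserving_homeomorphUnitSphereProd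
  have hemb := (homeomorphUnitSphereProd (EuclideanSpace ℝ (Fin n))).measurableEmbedding
  set g : Metric.sphere (0 : EuclideanSpace ℝ (Fin n)) 1 × Ioi (0 : ℝ) → ℝ :=
    fun p => f (p.2.1 • p.1.1) with hg
  have e : ∀ x : ({0}ᶜ : Set (EuclideanSpace ℝ (Fin n))),
      g (homeomorphUnitSphereProd (EuclideanSpace ℝ (Fin n)) x) = f x.1 := fun x => by
    have hx : ‖x.1‖ ≠ 0 := norm_ne_zero_iff.2 x.2
    simp [hg, smul_smul, hx]
  have hgi : Integrable g ((sphereMeasure n).prod (.volumeIoiPow (n - 1))) := by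
    have h1 := (hmp.integrable_comp_emb hemb (g := g)).1
    rw [finrank_euclideanSpace, Fintype.card_fin] at h1
    apply h1
    have h2 : g ∘ (homeomorphUnitSphereProd (EuclideanSpace ℝ (Fin n))) = f ∘ Subtype.val :=
      funext e
    rw [h2, ← integrableOn_iff_comap_subtypeVal (by measurability)]
    exact hf.integrableOn
  calc
    ∫ x, f x = ∫ x : ({0}ᶜ : Set (EuclideanSpace ℝ (Fin n))), f x.1 ∂(volume.comap Subtype.val) := by
      rw [integral_subtype_comap (measurableSet_singleton _).compl f, restrict_compl_singleton]
    _ = ∫ p, g p ∂(sphereMeasure n).prod (.volumeIoiPow (n - 1)) := by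
      simp_rw [← e]
      rw [hmp.integral_comp hemb, finrank_euclideanSpace, Fintype.card_fin]
    _ = ∫ r : Ioi (0 : ℝ), (∫ σ, f (r.1 • σ.1) ∂(sphereMeasure n)) ∂(.volumeIoiPow (n - 1)) :=
      integral_prod_symm _ hgi
    _ = _ := by
      simp only [Measure.volumeIoiPow, ENNReal.ofReal]
      rw [integral_withDensity_eq_integral_smul,
        integral_subtype_comap measurableSet_Ioi fun a : ℝ => Real.toNNReal (a ^ (n - 1)) •
          ∫ σ, f (a • σ.1) ∂(sphereMeasure n)]
      · refine setIntegral_congr_fun measurableSet_Ioi fun x hx => ?_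
        simp only [NNReal.smul_def]
        rw [Real.coe_toNNReal _ (pow_nonneg hx.out.le _), smul_eq_mul]
      · exact (measurable_subtype_coe.pow_const _).real_toNNReal

end

/-! ### The Poincaré inequality on the sphere -/

theorem hasFDerivAt_norm {x : EuclideanSpace ℝ (Fin n)} (hx : x ≠ 0) :
    HasFDerivAt (fun y : EuclideanSpace ℝ (Fin n) => ‖y‖) (‖x‖⁻¹ • innerSL ℝ x) x := by
  have h0 : ‖x‖ ≠ 0 := norm_ne_zero_iff.2 hx
  have h := (hasStrictFDerivAt_norm_sq x).hasFDerivAt.sqrt (pow_ne_zero 2 h0)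
  simp only [Real.sqrt_sq (norm_nonneg _)] at h
  refine h.congr_fderiv ?_
  ext v
  simp
  field_simp

/-- At rσ the gradient is the orthogonal sum of ρ'(r) U(σ) σ and (ρ(r)/r) t, where t is the
tangential part of ∇U at σ, of squared norm |∇U|² − (σ·∇U)². -/
theorem norm_gradient_polar_sq {ρ : ℝ → ℝ} {U : EuclideanSpace ℝ (Fin n) → ℝ}
    (hρ : Differentiable ℝ ρ) (hU : Differentiable ℝ U) {r : ℝ} (hr : 0 < r)
    {σ : EuclideanSpace ℝ (Fin n)} (hσ : ‖σ‖ = 1) :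
    ‖(∇ fun x : EuclideanSpace ℝ (Fin n) => ρ ‖x‖ * U (‖x‖⁻¹ • x)) (r • σ)‖ ^ 2 =
      deriv ρ r ^ 2 * U σ ^ 2 + ρ r ^ 2 / r ^ 2 * (‖(∇ U) σ‖ ^ 2 - euler U σ ^ 2) := by
  have hσ0 : σ ≠ 0 := by rintro rfl; simp at hσ
  have hx0 : r • σ ≠ 0 := smul_ne_zero hr.ne' hσ0
  have hxn : ‖r • σ‖ = r := by rw [norm_smul, hσ, mul_one, Real.norm_of_nonneg hr.le]
  have hN := hasFDerivAt_norm hx0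
  have hu : ‖r • σ‖⁻¹ • (r • σ) = σ := by rw [hxn, smul_smul, inv_mul_cancel₀ hr.ne', one_smul]
  have h1 : HasFDerivAt (fun x : EuclideanSpace ℝ (Fin n) => ρ ‖x‖)
      (deriv ρ r • (‖r • σ‖⁻¹ • innerSL ℝ (r • σ))) (r • σ) := by
    have hd : HasDerivAt ρ (deriv ρ r) ‖r • σ‖ := by
      rw [hxn]
      exact (hρ r).hasDerivAt
    exact hd.comp_hasFDerivAt (r • σ) hN
  have h2 := ((hasDerivAt_inv (norm_ne_zero_iff.2 hx0)).comp_hasFDerivAt (r • σ) hN).smul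
    (hasFDerivAt_id (r • σ))
  have h3 : HasFDerivAt U (fderiv ℝ U σ) (‖r • σ‖⁻¹ • (r • σ)) := by
    rw [hu]
    exact (hU σ).hasFDerivAt
  have h4 := h1.mul (HasFDerivAt.comp (g := U) (f := fun x : EuclideanSpace ℝ (Fin n) => ‖x‖⁻¹ • x)
    (r • σ) h3 h2)
  set t := (∇ U) σ - euler U σ • σ with ht
  have eσσ : inner ℝ σ σ = 1 := by rw [real_inner_self_eq_norm_sq, hσ, one_pow]
  have eU : inner ℝ ((∇ U) σ) σ = euler U σ := inner_gradient_left U σ σ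
  have hg : (∇ fun x : EuclideanSpace ℝ (Fin n) => ρ ‖x‖ * U (‖x‖⁻¹ • x)) (r • σ) =
      (deriv ρ r * U σ) • σ + (ρ r / r) • t := by
    refine ext_inner_right ℝ fun v => ?_
    rw [inner_gradient_left]
    have h5 : fderiv ℝ (fun x : EuclideanSpace ℝ (Fin n) => ρ ‖x‖ * U (‖x‖⁻¹ • x)) (r • σ) = _ :=
      h4.fderiv
    rw [h5]
    simp only [add_apply, smul_apply, Function.comp_apply, hxn, id_eq,
      ContinuousLinearMap.comp_apply, smul_eq_mul, smul_smul, inv_mul_cancel₀ hr.ne', one_smul,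
      ContinuousLinearMap.smulRight_apply, ContinuousLinearMap.id_apply, map_add, map_smul,
      innerSL_apply_apply, real_inner_smul_left, inner_add_left, ht, inner_sub_left,
      inner_gradient_left, euler]
    field_simp
    ring
  have hst : inner ℝ σ t = 0 := by
    rw [ht, inner_sub_right, inner_smul_right, eσσ, real_inner_comm, eU]
    ring
  have htt : ‖t‖ ^ 2 = ‖(∇ U) σ‖ ^ 2 - euler U σ ^ 2 := by
    rw [ht, norm_sub_sq_real, inner_smul_right, eU, norm_smul, hσ, mul_one, Real.norm_eq_abs, sq_abs]
    ring
  rw [hg, norm_add_sq_real, real_inner_smul_left, inner_smul_right, hst, norm_smul, norm_smul, hσ,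
    mul_pow, mul_pow, htt, Real.norm_eq_abs, Real.norm_eq_abs, sq_abs, sq_abs]
  ring

/-- The vanishing of ρ near 0 hides the singularity of x/|x| at the origin. -/
theorem contDiff_polar {k : WithTop ℕ∞} {ρ : ℝ → ℝ} {U : EuclideanSpace ℝ (Fin n) → ℝ}
    (hρ : ContDiff ℝ k ρ) (hU : ContDiff ℝ k U) {a : ℝ} (ha : 0 < a) (h0 : ∀ r ≤ a, ρ r = 0) :
    ContDiff ℝ k fun x : EuclideanSpace ℝ (Fin n) => ρ ‖x‖ * U (‖x‖⁻¹ • x) := by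
  refine contDiff_iff_contDiffAt.2 fun x => ?_
  by_cases hx : x = 0
  · have : (fun x : EuclideanSpace ℝ (Fin n) => ρ ‖x‖ * U (‖x‖⁻¹ • x)) =ᶠ[𝓝 x] fun _ => 0 := by
      filter_upwards [Metric.ball_mem_nhds x ha] with y hy
      rw [hx, mem_ball_zero_iff] at hy
      rw [h0 _ hy.le, zero_mul]
    exact contDiffAt_const.congr_of_eventuallyEq this
  · have hN : ContDiffAt ℝ k (fun x : EuclideanSpace ℝ (Fin n) => ‖x‖) x := contDiffAt_norm ℝ hx
    exact (hρ.contDiffAt.comp x hN).mul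
      (hU.contDiffAt.comp x ((hN.inv (norm_ne_zero_iff.2 hx)).smul contDiffAt_id))

theorem hasCompactSupport_comp_norm {ρ : ℝ → ℝ} {b : ℝ} (h1 : ∀ r, b ≤ r → ρ r = 0) :
    HasCompactSupport fun x : EuclideanSpace ℝ (Fin n) => ρ ‖x‖ := by
  refine HasCompactSupport.of_support_subset_isCompact
    (isCompact_closedBall (0 : EuclideanSpace ℝ (Fin n)) b) fun x hx => ?_
  rw [mem_closedBall_zero_iff]
  by_contra! h
  exact hx (h1 _ h.le)

theorem _root_.HasCompactSupport.sq {α : Type*} [TopologicalSpace α] {f : α → ℝ}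
    (hf : HasCompactSupport f) : HasCompactSupport fun x => f x ^ 2 :=
  hf.comp_left (g := fun x : ℝ => x ^ 2) (by simp)

/-- The Gaussian Poincaré inequality for ρ(|x|) U(x/|x|), written in polar coordinates. This
function has Gaussian mean zero because U has mean zero on the sphere. -/
theorem sphere_poincare_weighted [NeZero n] {ρ : ℝ → ℝ} {U : EuclideanSpace ℝ (Fin n) → ℝ}
    (hρ : ContDiff ℝ 1 ρ) (hU : ContDiff ℝ 1 U) {a b : ℝ} (ha : 0 < a) (h0 : ∀ r ≤ a, ρ r = 0)
    (h1 : ∀ r, b ≤ r → ρ r = 0) (hm : ∫ σ, U σ.1 ∂(sphereMeasure n) = 0) :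
    (∫ σ, U σ.1 ^ 2 ∂(sphereMeasure n)) *
        (∫ r in Ioi (0 : ℝ), ρ r ^ 2 * (r ^ (n - 1) * Real.exp (-r ^ 2 / 2))) ≤
      (∫ σ, U σ.1 ^ 2 ∂(sphereMeasure n)) *
        (∫ r in Ioi (0 : ℝ), deriv ρ r ^ 2 * (r ^ (n - 1) * Real.exp (-r ^ 2 / 2))) +
      (∫ σ, (‖(∇ U) σ.1‖ ^ 2 - euler U σ.1 ^ 2) ∂(sphereMeasure n)) *
        (∫ r in Ioi (0 : ℝ), ρ r ^ 2 / r ^ 2 * (r ^ (n - 1) * Real.exp (-r ^ 2 / 2))) := by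
  set F : EuclideanSpace ℝ (Fin n) → ℝ := fun x => ρ ‖x‖ * U (‖x‖⁻¹ • x) with hFdef
  have hF : ContDiff ℝ 1 F := contDiff_polar hρ hU ha h0
  have hFs : HasCompactSupport F := (hasCompactSupport_comp_norm h1).mul_right
  have hσn (σ : Metric.sphere (0 : EuclideanSpace ℝ (Fin n)) 1) : ‖σ.1‖ = 1 := by simp
  have hrσ {r : ℝ} (hr : 0 < r) (σ : Metric.sphere (0 : EuclideanSpace ℝ (Fin n)) 1) :
      ‖r • σ.1‖ = r := by rw [norm_smul, hσn, mul_one, Real.norm_of_nonneg hr.le]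
  have hFr {r : ℝ} (hr : 0 < r) (σ : Metric.sphere (0 : EuclideanSpace ℝ (Fin n)) 1) :
      F (r • σ.1) = ρ r * U σ.1 := by
    simp only [hFdef]
    rw [hrσ hr, smul_smul, inv_mul_cancel₀ hr.ne', one_smul]
  have hw : Continuous fun x : EuclideanSpace ℝ (Fin n) => Real.exp (-‖x‖ ^ 2 / 2) := by fun_prop
  have i1 : Integrable fun x => F x * Real.exp (-‖x‖ ^ 2 / 2) :=
    (hF.continuous.mul hw).integrable_of_hasCompactSupport hFs.mul_right
  have i2 : Integrable fun x => F x ^ 2 * Real.exp (-‖x‖ ^ 2 / 2) := by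
    exact ((hF.continuous.pow 2).mul hw).integrable_of_hasCompactSupport hFs.sq.mul_right
  have i3 : Integrable fun x => ‖(∇ F) x‖ ^ 2 * Real.exp (-‖x‖ ^ 2 / 2) := by
    simp_rw [norm_gradient]
    exact (((hF.continuous_fderiv (by norm_num)).norm.pow 2).mul
      hw).integrable_of_hasCompactSupport (hFs.fderiv ℝ).norm.sq.mul_right
  have hUc : Continuous fun σ : Metric.sphere (0 : EuclideanSpace ℝ (Fin n)) 1 => U σ.1 :=
    hU.continuous.comp continuous_subtype_val
  have hGc : Continuous fun σ : Metric.sphere (0 : EuclideanSpace ℝ (Fin n)) 1 =>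
      ‖(∇ U) σ.1‖ ^ 2 - euler U σ.1 ^ 2 := by
    refine (((continuous_gradient hU).comp continuous_subtype_val).norm.pow 2).sub
      (Continuous.pow ?_ 2)
    exact ((hU.continuous_fderiv (by norm_num)).comp continuous_subtype_val).clm_apply
      continuous_subtype_val
  have iS {f : Metric.sphere (0 : EuclideanSpace ℝ (Fin n)) 1 → ℝ} (hf : Continuous f) :
      Integrable f (sphereMeasure n) :=
    hf.integrable_of_hasCompactSupport (HasCompactSupport.of_compactSpace f)
  have hp := gaussian_poincare hF hFs (by
    rw [integral_polar i1]
    refine setIntegral_eq_zero_of_forall_eq_zero fun r hr => ?_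
    have e : ∀ σ : Metric.sphere (0 : EuclideanSpace ℝ (Fin n)) 1,
        F (r • σ.1) * Real.exp (-‖r • σ.1‖ ^ 2 / 2) = ρ r * Real.exp (-r ^ 2 / 2) * U σ.1 :=
      fun σ => by rw [hFr hr, hrσ hr]; ring
    simp_rw [e]
    rw [integral_const_mul, hm]
    ring)
  rw [integral_polar i2, integral_polar i3] at hp
  have e1 : ∀ r ∈ Ioi (0 : ℝ), r ^ (n - 1) * ∫ σ, F (r • σ.1) ^ 2 *
      Real.exp (-‖r • σ.1‖ ^ 2 / 2) ∂(sphereMeasure n) = (∫ σ, U σ.1 ^ 2 ∂(sphereMeasure n)) *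
        (ρ r ^ 2 * (r ^ (n - 1) * Real.exp (-r ^ 2 / 2))) := fun r hr => by
    have e : ∀ σ : Metric.sphere (0 : EuclideanSpace ℝ (Fin n)) 1,
        F (r • σ.1) ^ 2 * Real.exp (-‖r • σ.1‖ ^ 2 / 2) =
          ρ r ^ 2 * Real.exp (-r ^ 2 / 2) * U σ.1 ^ 2 :=
      fun σ => by rw [hFr hr, hrσ hr]; ring
    simp_rw [e]
    rw [integral_const_mul]
    ring
  have e2 : ∀ r ∈ Ioi (0 : ℝ), r ^ (n - 1) * ∫ σ, ‖(∇ F) (r • σ.1)‖ ^ 2 *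
      Real.exp (-‖r • σ.1‖ ^ 2 / 2) ∂(sphereMeasure n) = (∫ σ, U σ.1 ^ 2 ∂(sphereMeasure n)) *
        (deriv ρ r ^ 2 * (r ^ (n - 1) * Real.exp (-r ^ 2 / 2))) +
      (∫ σ, (‖(∇ U) σ.1‖ ^ 2 - euler U σ.1 ^ 2) ∂(sphereMeasure n)) *
        (ρ r ^ 2 / r ^ 2 * (r ^ (n - 1) * Real.exp (-r ^ 2 / 2))) := fun r hr => by
    have e : ∀ σ : Metric.sphere (0 : EuclideanSpace ℝ (Fin n)) 1,
        ‖(∇ F) (r • σ.1)‖ ^ 2 * Real.exp (-‖r • σ.1‖ ^ 2 / 2) =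
          deriv ρ r ^ 2 * Real.exp (-r ^ 2 / 2) * U σ.1 ^ 2 +
          ρ r ^ 2 / r ^ 2 * Real.exp (-r ^ 2 / 2) * (‖(∇ U) σ.1‖ ^ 2 - euler U σ.1 ^ 2) :=
      fun σ => by
        rw [norm_gradient_polar_sq (hρ.differentiable (by norm_num))
          (hU.differentiable (by norm_num)) hr (hσn σ), hrσ hr]
        ring
    simp_rw [e]
    have iU : Integrable (fun σ : Metric.sphere (0 : EuclideanSpace ℝ (Fin n)) 1 => U σ.1 ^ 2)
        (sphereMeasure n) := iS (hUc.pow 2)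
    rw [integral_add (iU.const_mul _) ((iS hGc).const_mul _), integral_const_mul,
      integral_const_mul]
    ring
  have hρ' : Continuous (deriv ρ) := hρ.continuous_deriv (by norm_num)
  have hρs : HasCompactSupport ρ := by
    refine HasCompactSupport.of_support_subset_isCompact (isCompact_Icc (a := a) (b := b))
      fun r hr => ?_
    by_contra h
    rw [mem_Icc, not_and_or, not_le, not_le] at h
    exact hr (h.elim (fun h => h0 r h.le) fun h => h1 r h.le)
  have hwr : Continuous fun r : ℝ => r ^ (n - 1) * Real.exp (-r ^ 2 / 2) := by fun_prop
  have j1 : Integrable fun r => deriv ρ r ^ 2 * (r ^ (n - 1) * Real.exp (-r ^ 2 / 2)) := by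
    exact ((hρ'.pow 2).mul hwr).integrable_of_hasCompactSupport hρs.deriv.sq.mul_right
  have j2 : Integrable fun r => ρ r ^ 2 / r ^ 2 * (r ^ (n - 1) * Real.exp (-r ^ 2 / 2)) := by
    refine Continuous.integrable_of_hasCompactSupport (Continuous.mul ?_ hwr)
      (HasCompactSupport.mul_right ?_)
    · refine continuous_iff_continuousAt.2 fun r => ?_
      by_cases hr : r < a
      · have : (fun r => ρ r ^ 2 / r ^ 2) =ᶠ[𝓝 r] fun _ => 0 := by
          filter_upwards [Iio_mem_nhds hr] with s hs
          rw [h0 s (le_of_lt hs)]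
          simp
        exact continuousAt_const.congr this.symm
      · have : r ≠ 0 := by push Not at hr; linarith
        exact (hρ.continuous.continuousAt.pow 2).div (continuousAt_id.pow 2) (pow_ne_zero 2 this)
    · simp_rw [div_eq_mul_inv]
      exact hρs.sq.mul_right
  rw [setIntegral_congr_fun measurableSet_Ioi e1, setIntegral_congr_fun measurableSet_Ioi e2,
    integral_const_mul, integral_add (j1.integrableOn.const_mul _) (j2.integrableOn.const_mul _),
    integral_const_mul, integral_const_mul] at hp
  exact hp

theorem integrableOn_pow_mul_exp_neg_sq (m : ℕ) {b : ℝ} (hb : 0 < b) :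
    IntegrableOn (fun r : ℝ => r ^ m * Real.exp (-b * r ^ 2)) (Ioi 0) := by
  have := integrableOn_rpow_mul_exp_neg_mul_sq hb (s := m) (by
    have : (0 : ℝ) ≤ m := by positivity
    linarith)
  simpa using this

/-- Both integrals are Gamma values, related by Γ(s + 1) = s Γ(s). -/
theorem integral_pow_mul_exp_neg_sq_half (m : ℕ) :
    ∫ r in Ioi (0 : ℝ), r ^ (m + 2) * Real.exp (-r ^ 2 / 2) =
      (m + 1) * ∫ r in Ioi (0 : ℝ), r ^ m * Real.exp (-r ^ 2 / 2) := by
  have h (k : ℕ) : ∫ r in Ioi (0 : ℝ), r ^ k * Real.exp (-r ^ 2 / 2) =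
      (1 / 2 : ℝ) ^ (-((k : ℝ) + 1) / 2) * (1 / 2) * Real.Gamma (((k : ℝ) + 1) / 2) := by
    rw [← integral_rpow_mul_exp_neg_mul_rpow two_pos
      (by have : (0 : ℝ) ≤ k := by positivity
          linarith) (by norm_num : (0 : ℝ) < 1 / 2)]
    refine setIntegral_congr_fun measurableSet_Ioi fun r hr => ?_
    simp only [Real.rpow_natCast, Real.rpow_two]
    congr 2
    ring
  rw [h, h]
  have e1 : (((m + 2 : ℕ) : ℝ) + 1) / 2 = ((m : ℝ) + 1) / 2 + 1 := by push_cast; ring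
  have e2 : -(((m + 2 : ℕ) : ℝ) + 1) / 2 = -((m : ℝ) + 1) / 2 - 1 := by push_cast; ring
  rw [e1, e2, Real.Gamma_add_one (by positivity), Real.rpow_sub_one (by norm_num)]
  ring


/-- A smooth truncation of `r ↦ r` to a compact subset of `(0, ∞)`. -/
def truncation (j : ℕ) (r : ℝ) : ℝ :=
  r * ((1 - cutoff ((j + 1) * r)) * cutoff (r / (j + 1)))

theorem contDiff_truncation (j : ℕ) : ContDiff ℝ 1 (truncation j) := by
  have h : ContDiff ℝ 1 cutoff := contDiff_cutoff (m := 1)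
  exact contDiff_id.mul ((contDiff_const.sub (h.comp (contDiff_const.mul contDiff_id))).mul
    (h.comp (contDiff_id.div_const _)))

theorem truncation_of_le {j : ℕ} {r : ℝ} (hr : r ≤ 1 / (j + 1)) : truncation j r = 0 := by
  have hj : (0 : ℝ) < j + 1 := by positivity
  rw [le_div_iff₀ hj] at hr
  rw [truncation, cutoff_of_le (by linarith)]
  ring

theorem truncation_of_ge {j : ℕ} {r : ℝ} (hr : 2 * (j + 1) ≤ r) : truncation j r = 0 := by
  have hj : (0 : ℝ) < j + 1 := by positivity
  rw [truncation, cutoff_of_ge (t := r / (j + 1)) (by rwa [le_div_iff₀ hj])]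
  ring

theorem abs_truncation_le (j : ℕ) (r : ℝ) : |truncation j r| ≤ |r| := by
  rw [truncation, abs_mul]
  refine mul_le_of_le_one_right (abs_nonneg _) ?_
  have h1 := cutoff_nonneg ((j + 1) * r)
  have h2 := cutoff_le_one ((j + 1) * r)
  have h3 := cutoff_nonneg (r / (j + 1))
  have h4 := cutoff_le_one (r / (j + 1))
  rw [abs_of_nonneg (mul_nonneg (by linarith) h3)]
  nlinarith

theorem deriv_truncation (j : ℕ) (r : ℝ) :
    deriv (truncation j) r = (1 - cutoff ((j + 1) * r)) * cutoff (r / (j + 1)) +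
      (-((j + 1) * r * deriv cutoff ((j + 1) * r)) * cutoff (r / (j + 1)) +
        (1 - cutoff ((j + 1) * r)) * (r / (j + 1) * deriv cutoff (r / (j + 1)))) := by
  have hd (t : ℝ) : HasDerivAt cutoff (deriv cutoff t) t :=
    ((contDiff_cutoff (m := 1)).differentiable (by norm_num) t).hasDerivAt
  have h1 : HasDerivAt (fun r : ℝ => cutoff ((j + 1) * r)) _ r :=
    HasDerivAt.comp (h₂ := cutoff) r (hd ((j + 1) * r))
      ((hasDerivAt_id' r).const_mul ((j : ℝ) + 1))
  have h2 : HasDerivAt (fun r : ℝ => cutoff (r / (j + 1))) _ r :=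
    HasDerivAt.comp (h₂ := cutoff) r (hd (r / (j + 1))) ((hasDerivAt_id' r).div_const ((j : ℝ) + 1))
  have h3 : HasDerivAt (truncation j) _ r := (hasDerivAt_id r).mul ((h1.const_sub 1).mul h2)
  rw [h3.deriv]
  simp only [id, mul_one]
  ring

/-- The derivative involves the cutoff η only through the values of η and of t η'(t), which are
bounded whatever the scale. -/
theorem exists_abs_deriv_truncation_le : ∃ C : ℝ, ∀ j r, |deriv (truncation j) r| ≤ C := by
  obtain ⟨C, hC⟩ : ∃ C : ℝ, ∀ t, |t * deriv cutoff t| ≤ C := by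
    obtain ⟨C, -, -, hC⟩ := exists_bound_of_eq_zero
      ((contDiff_cutoff (m := 1)).continuous_deriv (by norm_num))
      (fun t ht => ht.elim (fun h => deriv_cutoff_of_le h.le) fun h => deriv_cutoff_of_ge h.le)
    exact ⟨2 * C, hC⟩
  refine ⟨1 + (C + C), fun j r => ?_⟩
  have h1 := cutoff_nonneg ((j + 1) * r)
  have h2 := cutoff_le_one ((j + 1) * r)
  have h3 := cutoff_nonneg (r / (j + 1))
  have h4 := cutoff_le_one (r / (j + 1))
  have hη : |1 - cutoff ((j + 1) * r)| ≤ 1 := by rw [abs_of_nonneg (by linarith)]; linarith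
  have hc : |cutoff (r / (j + 1))| ≤ 1 := by rwa [abs_of_nonneg h3]
  have hC0 : 0 ≤ C := (abs_nonneg _).trans (hC 0)
  rw [deriv_truncation]
  refine (abs_add_le _ _).trans (add_le_add ?_ ((abs_add_le _ _).trans (add_le_add ?_ ?_)))
  · rw [abs_mul]
    exact mul_le_one₀ hη (abs_nonneg _) hc
  · rw [abs_mul, abs_neg]
    exact (mul_le_mul (hC _) hc (abs_nonneg _) hC0).trans_eq (mul_one C)
  · rw [abs_mul]
    exact (mul_le_mul hη (hC _) (abs_nonneg _) zero_le_one).trans_eq (one_mul C)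

theorem eventually_truncation {r : ℝ} (hr : 0 < r) :
    ∀ᶠ j in atTop, truncation j r = r ∧ deriv (truncation j) r = 1 := by
  obtain ⟨k, hk⟩ := exists_nat_gt (2 / r + r)
  filter_upwards [eventually_ge_atTop k] with j hj
  have hjk : (k : ℝ) ≤ j := by exact_mod_cast hj
  have h2r : 0 < 2 / r := by positivity
  have e1 : 2 ≤ (j + 1) * r := by
    have : 2 / r ≤ j + 1 := by linarith
    rwa [div_le_iff₀ hr] at this
  have e2 : r / (j + 1) ≤ 1 := by
    rw [div_le_one (by positivity)]
    linarith
  constructor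
  · rw [truncation, cutoff_of_ge e1, cutoff_of_le e2]
    ring
  · rw [deriv_truncation, cutoff_of_ge e1, cutoff_of_le e2, deriv_cutoff_of_ge e1,
      deriv_cutoff_of_le e2]
    ring

theorem tendsto_integral_Ioi_of_bound {f : ℕ → ℝ → ℝ} {g w : ℝ → ℝ} {C : ℝ}
    (hw : IntegrableOn w (Ioi 0)) (hf : ∀ j, AEStronglyMeasurable (f j) (volume.restrict (Ioi 0)))
    (hb : ∀ j, ∀ r > 0, |f j r| ≤ C * w r) (hl : ∀ r > 0, ∀ᶠ j in atTop, f j r = g r) :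
    Tendsto (fun j => ∫ r in Ioi (0 : ℝ), f j r) atTop (𝓝 (∫ r in Ioi (0 : ℝ), g r)) := by
  refine tendsto_integral_of_dominated_convergence (fun r => C * w r) hf (hw.const_mul C)
    (fun j => ?_) ?_
  · filter_upwards [ae_restrict_mem measurableSet_Ioi] with r hr using hb j r hr
  · filter_upwards [ae_restrict_mem measurableSet_Ioi] with r hr
    exact tendsto_const_nhds.congr' ((hl r hr).mono fun j h => h.symm)

/-- Let ρ(r) tend to r in the weighted inequality. With V = ∫ U², T the tangential energy and w =
r^{n−1} e^{−r²/2}, the moment identity ∫ r² w = n ∫ w leaves nV ≤ V + T. Nothing is lost: linear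
functions are extremal for the Gaussian inequality. -/
theorem sphere_poincare_of_integral_eq_zero [NeZero n] {U : EuclideanSpace ℝ (Fin n) → ℝ}
    (hU : ContDiff ℝ 1 U) (hm : ∫ σ, U σ.1 ∂(sphereMeasure n) = 0) :
    ((n : ℝ) - 1) * ∫ σ, U σ.1 ^ 2 ∂(sphereMeasure n) ≤
      ∫ σ, (‖(∇ U) σ.1‖ ^ 2 - euler U σ.1 ^ 2) ∂(sphereMeasure n) := by
  set V := ∫ σ, U σ.1 ^ 2 ∂(sphereMeasure n)
  set T := ∫ σ, (‖(∇ U) σ.1‖ ^ 2 - euler U σ.1 ^ 2) ∂(sphereMeasure n)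
  set w : ℝ → ℝ := fun r => r ^ (n - 1) * Real.exp (-r ^ 2 / 2) with hwdef
  have hwc : Continuous w := by fun_prop
  have hint (m : ℕ) : IntegrableOn (fun r : ℝ => r ^ m * Real.exp (-r ^ 2 / 2)) (Ioi 0) := by
    convert integrableOn_pow_mul_exp_neg_sq m (b := 1 / 2) (by norm_num) using 4
    ring
  have hw0 : ∀ r > 0, 0 < w r := fun r hr => by simp only [hwdef]; positivity
  have hn : n - 1 + 2 = n + 1 := by have := NeZero.ne n; omega
  have hw2 : ∀ r, r ^ 2 * w r = r ^ (n + 1) * Real.exp (-r ^ 2 / 2) := fun r => by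
    simp only [hwdef]
    rw [← hn, pow_add]
    ring
  obtain ⟨C, hC⟩ := exists_abs_deriv_truncation_le
  have hcont (j : ℕ) := contDiff_truncation j
  have l1 : Tendsto (fun j => ∫ r in Ioi (0 : ℝ), truncation j r ^ 2 * w r) atTop
      (𝓝 (∫ r in Ioi (0 : ℝ), r ^ 2 * w r)) := by
    refine tendsto_integral_Ioi_of_bound (w := fun r => r ^ 2 * w r) (C := 1) ?_
      (fun j => (((hcont j).continuous.pow 2).mul hwc).aestronglyMeasurable) (fun j r hr => ?_)
      fun r hr => (eventually_truncation hr).mono fun j h => by rw [h.1]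
    · simp_rw [hw2]
      exact hint _
    · rw [abs_mul, abs_of_pos (hw0 r hr), abs_pow, one_mul, ← sq_abs r]
      exact mul_le_mul_of_nonneg_right (pow_le_pow_left₀ (abs_nonneg _) (abs_truncation_le j r) 2)
        (hw0 r hr).le
  have l2 : Tendsto (fun j => ∫ r in Ioi (0 : ℝ), deriv (truncation j) r ^ 2 * w r) atTop
      (𝓝 (∫ r in Ioi (0 : ℝ), w r)) := by
    refine tendsto_integral_Ioi_of_bound (w := w) (C := C ^ 2) (hint _)
      (fun j => ((((hcont j).continuous_deriv (by norm_num)).pow 2).mul hwc).aestronglyMeasurable)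
      (fun j r hr => ?_)
      fun r hr => (eventually_truncation hr).mono fun j h => by rw [h.2]; ring
    rw [abs_mul, abs_of_pos (hw0 r hr), abs_pow]
    exact mul_le_mul_of_nonneg_right (pow_le_pow_left₀ (abs_nonneg _) (hC j r) 2) (hw0 r hr).le
  have l3 : Tendsto (fun j => ∫ r in Ioi (0 : ℝ), truncation j r ^ 2 / r ^ 2 * w r) atTop
      (𝓝 (∫ r in Ioi (0 : ℝ), w r)) := by
    refine tendsto_integral_Ioi_of_bound (w := w) (C := 1) (hint _)
      (fun j => ((((hcont j).continuous.measurable.pow_const 2).div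
        (measurable_id.pow_const 2)).mul hwc.measurable).aestronglyMeasurable)
      (fun j r hr => ?_)
      fun r hr => (eventually_truncation hr).mono fun j h => by
        rw [h.1, div_self (pow_ne_zero 2 hr.ne'), one_mul]
    rw [abs_mul, abs_of_pos (hw0 r hr), ← div_pow, abs_pow, abs_div]
    refine mul_le_mul_of_nonneg_right ?_ (hw0 r hr).le
    exact pow_le_one₀ (by positivity) (div_le_one_of_le₀ (abs_truncation_le j r) (abs_nonneg _))
  have key := le_of_tendsto_of_tendsto (l1.const_mul V) ((l2.const_mul V).add (l3.const_mul T))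
    (Eventually.of_forall fun j => sphere_poincare_weighted (hcont j) hU
      (a := 1 / (j + 1)) (b := 2 * (j + 1)) (by positivity) (fun r => truncation_of_le)
      (fun r => truncation_of_ge) hm)
  have e2 : ∫ r in Ioi (0 : ℝ), r ^ 2 * w r = n * ∫ r in Ioi (0 : ℝ), w r := by
    have h := integral_pow_mul_exp_neg_sq_half (n - 1)
    rw [hn, Nat.cast_sub (NeZero.one_le), Nat.cast_one, sub_add_cancel] at h
    simp_rw [hw2]
    exact h
  have hI : 0 < ∫ r in Ioi (0 : ℝ), w r := by
    rw [setIntegral_pos_iff_support_of_nonneg_ae]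
    · have : Ioi (0 : ℝ) ⊆ Function.support w := fun r hr => (hw0 r hr).ne'
      rw [inter_eq_right.2 this]
      simp
    · filter_upwards [ae_restrict_mem measurableSet_Ioi] with r hr using (hw0 r hr).le
    · exact hint _
  rw [e2] at key
  have : (((n : ℝ) - 1) * V) * (∫ r in Ioi (0 : ℝ), w r) ≤ T * ∫ r in Ioi (0 : ℝ), w r := by
    linarith
  exact le_of_mul_le_mul_right this hI

instance : IsFiniteMeasure (sphereMeasure n) := by
  unfold sphereMeasure
  infer_instance

theorem integrable_sphere {f : Metric.sphere (0 : EuclideanSpace ℝ (Fin n)) 1 → ℝ}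
    (hf : Continuous f) : Integrable f (sphereMeasure n) :=
  hf.integrable_of_hasCompactSupport (HasCompactSupport.of_compactSpace f)

theorem sphere_poincare [NeZero n] {U : EuclideanSpace ℝ (Fin n) → ℝ} (hU : ContDiff ℝ 1 U)
    {c : ℝ} (hc : ∫ σ, U σ.1 ∂(sphereMeasure n) = (sphereMeasure n).real univ * c) :
    ((n : ℝ) - 1) * ((∫ σ, U σ.1 ^ 2 ∂(sphereMeasure n)) - (sphereMeasure n).real univ * c ^ 2) ≤
      ∫ σ, (‖(∇ U) σ.1‖ ^ 2 - euler U σ.1 ^ 2) ∂(sphereMeasure n) := by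
  have hUc : Continuous fun σ : Metric.sphere (0 : EuclideanSpace ℝ (Fin n)) 1 => U σ.1 :=
    hU.continuous.comp continuous_subtype_val
  have iU := integrable_sphere hUc
  have iU2 : Integrable (fun σ : Metric.sphere (0 : EuclideanSpace ℝ (Fin n)) 1 => U σ.1 ^ 2)
      (sphereMeasure n) := integrable_sphere (hUc.pow 2)
  have iUc : Integrable (fun σ : Metric.sphere (0 : EuclideanSpace ℝ (Fin n)) 1 =>
      2 * c * U σ.1 - c ^ 2) (sphereMeasure n) := (iU.const_mul _).sub (integrable_const _)
  have h := sphere_poincare_of_integral_eq_zero (U := fun x => U x - c) (hU.sub contDiff_const) (by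
    rw [integral_sub iU (integrable_const c), hc]
    simp)
  have e1 : ∫ σ, (U σ.1 - c) ^ 2 ∂(sphereMeasure n) =
      (∫ σ, U σ.1 ^ 2 ∂(sphereMeasure n)) - (sphereMeasure n).real univ * c ^ 2 := by
    have e (σ : Metric.sphere (0 : EuclideanSpace ℝ (Fin n)) 1) :
        (U σ.1 - c) ^ 2 = U σ.1 ^ 2 - (2 * c * U σ.1 - c ^ 2) := by ring
    simp_rw [e]
    rw [integral_sub iU2 iUc, integral_sub (iU.const_mul _) (integrable_const _), integral_const_mul, hc]
    simp
    ring
  have e2 (x : EuclideanSpace ℝ (Fin n)) : (∇ fun x => U x - c) x = (∇ U) x := by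
    rw [gradient, fderiv_sub_const, gradient]
  have e3 (x : EuclideanSpace ℝ (Fin n)) : euler (fun x => U x - c) x = euler U x := by
    rw [euler, fderiv_sub_const, euler]
  simp_rw [e1, e2, e3] at h
  exact h

/-! ### One-dimensional inequalities for radial parts -/

/-- Functions that are continuous on `(0, ∞)` and bounded near `0`. -/
def IsRegular (f : ℝ → ℝ) : Prop :=
  ContinuousOn f (Ioi 0) ∧ ∀ R, ∃ C, ∀ r ∈ Ioc 0 R, |f r| ≤ C

namespace IsRegular

variable {f g : ℝ → ℝ}

theorem of_continuous (hf : Continuous f) : IsRegular f := by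
  refine ⟨hf.continuousOn, fun R => ?_⟩
  obtain ⟨C, hC⟩ := (isCompact_Icc (a := 0) (b := R)).exists_bound_of_continuousOn hf.continuousOn
  exact ⟨C, fun r hr => hC r (Ioc_subset_Icc_self hr)⟩

theorem add (hf : IsRegular f) (hg : IsRegular g) : IsRegular fun r => f r + g r := by
  refine ⟨hf.1.add hg.1, fun R => ?_⟩
  obtain ⟨C, hC⟩ := hf.2 R
  obtain ⟨D, hD⟩ := hg.2 R
  exact ⟨C + D, fun r hr => (abs_add_le _ _).trans (add_le_add (hC r hr) (hD r hr))⟩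

theorem mul (hf : IsRegular f) (hg : IsRegular g) : IsRegular fun r => f r * g r := by
  refine ⟨hf.1.mul hg.1, fun R => ?_⟩
  obtain ⟨C, hC⟩ := hf.2 R
  obtain ⟨D, hD⟩ := hg.2 R
  refine ⟨C * D, fun r hr => ?_⟩
  rw [abs_mul]
  exact mul_le_mul (hC r hr) (hD r hr) (abs_nonneg _) ((abs_nonneg _).trans (hC r hr))

theorem const (c : ℝ) : IsRegular fun _ => c := of_continuous continuous_const

theorem const_mul (hf : IsRegular f) (c : ℝ) : IsRegular fun r => c * f r := (const c).mul hf

theorem sub (hf : IsRegular f) (hg : IsRegular g) : IsRegular fun r => f r - g r := by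
  simpa [sub_eq_add_neg] using hf.add (hg.const_mul (-1))

theorem sq (hf : IsRegular f) : IsRegular fun r => f r ^ 2 := by
  simpa only [pow_two] using hf.mul hf

theorem congr (hf : IsRegular f) (h : ∀ r > 0, g r = f r) : IsRegular g := by
  refine ⟨hf.1.congr h, fun R => ?_⟩
  obtain ⟨C, hC⟩ := hf.2 R
  exact ⟨C, fun r hr => by rw [h r hr.1]; exact hC r hr⟩

theorem integrableOn (hf : IsRegular f) {R : ℝ} (h0 : ∀ r > 0, R ≤ r → f r = 0) :
    IntegrableOn f (Ioi 0) := by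
  obtain ⟨C, hC⟩ := hf.2 R
  have h : IntegrableOn f (Ioc 0 R) := by
    refine ⟨(hf.1.mono Ioc_subset_Ioi_self).aestronglyMeasurable measurableSet_Ioc,
      .restrict_of_bounded C (by simp) ?_⟩
    filter_upwards [ae_restrict_mem measurableSet_Ioc] with r hr using hC r hr
  refine h.of_forall_sdiff_eq_zero measurableSet_Ioi fun r hr => h0 r hr.1 ?_
  by_contra! h
  exact hr.2 ⟨hr.1, h.le⟩

/-- Primitives are written below as r times a regular function, so that their boundary term at 0
vanishes. -/
theorem continuousWithinAt_mul (hf : IsRegular f) :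
    ContinuousWithinAt (fun r => r * f r) (Ici 0) 0 := by
  obtain ⟨C, hC⟩ := hf.2 1
  have h1 : Tendsto (fun r : ℝ => r * C) (𝓝[≥] 0) (𝓝 0) := by
    have : Continuous fun r : ℝ => r * C := by fun_prop
    simpa using (this.tendsto 0).mono_left nhdsWithin_le_nhds
  rw [ContinuousWithinAt, zero_mul]
  refine squeeze_zero_norm' ?_ h1
  filter_upwards [self_mem_nhdsWithin, nhdsWithin_le_nhds (Iio_mem_nhds one_pos)] with r hr hr1
  rw [Real.norm_eq_abs, abs_mul, abs_of_nonneg hr]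
  rcases eq_or_lt_of_le (show (0 : ℝ) ≤ r from hr) with h | h
  · simp [← h]
  · exact mul_le_mul_of_nonneg_left (hC r ⟨h, hr1.le⟩) hr

end IsRegular

/-- In dimension n + 1, with d = M', the hypothesis on d' says Y = ΔM + x·∇M + (n + 1)M = (n + 1)h +
r h' with h = d/r + M. The integrand is then exactly G' plus r^n times the square of r h' − 2r d/(r²
− x₀²). That square vanishes for d = r(r² − x₀²) e^{−r²/2}, and x₀² = (n + 3)/2 is the value making
this field orthogonal to r e^{−r²/2} for the weight r^n: it is the next radial mode, responsible for
the constant 4. The condition d(x₀) = 0 makes the pole of G at x₀ removable. -/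
theorem integral_sq_sub_nonneg {M d Y : ℝ → ℝ} {x₀ b : ℝ}
    (hM : ∀ r > 0, HasDerivAt M (d r) r)
    (hd : ∀ r > 0, HasDerivAt d (Y r - (n + 1) * M r - n * (d r / r) - r * d r) r)
    (rM : IsRegular M) (rd : IsRegular fun r => d r / r)
    (d0 : ContinuousWithinAt d (Ici 0) 0) (hx₀ : 0 < x₀) (hx : x₀ ^ 2 = ((n : ℝ) + 3) / 2)
    (hdx : d x₀ = 0) (hb : x₀ < b)
    (hint : IntegrableOn (fun r => r ^ n * (Y r ^ 2 - 4 * d r ^ 2)) (Ioi 0)) :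
    0 ≤ ∫ r in (0 : ℝ)..b, r ^ n * (Y r ^ 2 - 4 * d r ^ 2) := by
  set φ : ℝ → ℝ := fun r => r ^ n * (Y r ^ 2 - 4 * d r ^ 2) with hφ
  -- This is (n + 1) r^{n+1} h² + 2 r^{n+1} d²/(r² − x₀²), factored to exhibit its continuity at 0
  -- and at x₀.
  set G : ℝ → ℝ := fun r => r * (r ^ n * ((n + 1) * (d r / r + M r) ^ 2)) +
    d r ^ 2 / (r - x₀) * (2 * r ^ (n + 1) / (r + x₀)) with hG
  have hrn : IsRegular fun r : ℝ => r ^ n := .of_continuous (by fun_prop)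
  have hG0 : ContinuousWithinAt G (Ici 0) 0 := by
    refine (hrn.mul ((rd.add rM).sq.const_mul _)).continuousWithinAt_mul.add ?_
    refine ((d0.pow 2).div (by fun_prop) (by linarith)).mul ?_
    refine ContinuousWithinAt.div (by fun_prop) (by fun_prop) (by linarith)
  have hGd (r : ℝ) (h0 : 0 < r) (hr : r - x₀ ≠ 0) : HasDerivAt G
      (φ r - r ^ n * (Y r - (n + 1) * (d r / r + M r) - 2 * r / (r ^ 2 - x₀ ^ 2) * d r) ^ 2) r := by
    have h1 : r + x₀ ≠ 0 := by positivity
    have h2 : r ^ 2 - x₀ ^ 2 ≠ 0 := by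
      rw [show r ^ 2 - x₀ ^ 2 = (r - x₀) * (r + x₀) by ring]
      exact mul_ne_zero hr h1
    have dr := (hd r h0).div (hasDerivAt_id' r) h0.ne'
    have e1 := (hasDerivAt_id' r).mul ((hasDerivAt_pow n r).mul
      (((dr.add (hM r h0)).pow 2).const_mul ((n : ℝ) + 1)))
    have e2 := (((hd r h0).pow 2).div ((hasDerivAt_id' r).sub_const x₀) hr).mul
      (((hasDerivAt_pow (n + 1) r).const_mul 2).div ((hasDerivAt_id' r).add_const x₀) h1)
    refine (e1.add e2).congr_deriv ?_
    have hn : (n : ℝ) = 2 * x₀ ^ 2 - 3 := by linarith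
    have hpn : (n : ℝ) * r ^ (n - 1) = n * r ^ n / r := by
      cases n with
      | zero => simp
      | succ k => field_simp; simp [pow_succ]
    simp only [hφ, Pi.add_apply, Pi.div_apply, Pi.mul_apply, Pi.pow_apply, hpn, pow_succ r n,
      Nat.cast_add, Nat.cast_one, Nat.cast_ofNat, Nat.add_one_sub_one, pow_one]
    rw [show r ^ 2 - x₀ ^ 2 = (r - x₀) * (r + x₀) by ring]
    rw [hn]
    field_simp
    ring
  have hGc (r : ℝ) (h0 : 0 < r) : ContinuousAt G r := by
    by_cases hr : r - x₀ = 0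
    · obtain rfl : r = x₀ := by linarith
      refine ContinuousAt.add ?_ (sq_div_mul_continuousWithinAt (hd r h0) hdx ?_)
      · have c1 := (hd r h0).continuousAt
        have c2 := (hM r h0).continuousAt
        exact continuousAt_id.mul ((continuousAt_id.pow n).mul (continuousAt_const.mul
          (((c1.div continuousAt_id h0.ne').add c2).pow 2)))
      · refine ContinuousAt.div (by fun_prop) (by fun_prop) (by positivity)
    · exact (hGd r h0 hr).continuousAt
  have hGc' : ContinuousOn G (Ici 0) := fun r hr => by
    rcases eq_or_lt_of_le (show (0 : ℝ) ≤ r from hr) with h | h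
    · rw [← h]
      exact hG0
    · exact (hGc r h).continuousWithinAt
  -- Used on [0, x₀] and [x₀, b]: G is continuous across x₀ but its derivative is known only off x₀.
  -- The result follows from G(0) = 0 and G(b) ≥ 0, the latter because b > x₀.
  have hsub {a c : ℝ} (ha : 0 ≤ a) (hac : a ≤ c) (h : ∀ r ∈ Ioo a c, r - x₀ ≠ 0) :
      G c - G a ≤ ∫ r in a..c, φ r := by
    refine intervalIntegral.sub_le_integral_of_hasDeriv_right_of_le hac
      (hGc'.mono fun r hr => ha.trans hr.1)
      (fun r hr => (hGd r (ha.trans_lt hr.1) (h r hr)).hasDerivWithinAt) ?_ fun r hr => ?_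
    · rw [integrableOn_Icc_iff_integrableOn_Ioc]
      exact hint.mono_set fun r hr => ha.trans_lt hr.1
    · have : 0 < r := ha.trans_lt hr.1
      have : 0 ≤ r ^ n * (Y r - (n + 1) * (d r / r + M r) -
        2 * r / (r ^ 2 - x₀ ^ 2) * d r) ^ 2 := by positivity
      linarith
  have h1 := hsub le_rfl hx₀.le fun r hr => by linarith [hr.2]
  have h2 := hsub hx₀.le hb.le fun r hr => by linarith [hr.1]
  have hi {a c : ℝ} (ha : 0 ≤ a) (hac : a ≤ c) : IntervalIntegrable φ volume a c := by
    rw [intervalIntegrable_iff_integrableOn_Ioc_of_le hac]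
    exact hint.mono_set fun r hr => ha.trans_lt hr.1
  rw [← intervalIntegral.integral_add_adjacent_intervals (hi le_rfl hx₀.le) (hi hx₀.le hb.le)]
  have h3 : G 0 = 0 := by simp [hG]
  have h4 : 0 ≤ G b := by
    have : 0 < b := hx₀.trans hb
    have : 0 < b - x₀ := sub_pos.2 hb
    simp only [hG]
    positivity
  linarith

/-- The radial profile `m` of a compactly supported `C²` function on `ℝⁿ`, its derivative `p` and
its radial Laplacian `L`. -/
structure IsRadialProfile (n : ℕ) (m p L : ℝ → ℝ) : Prop where
  hasDerivAt_fst : ∀ r > 0, HasDerivAt m (p r) r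
  hasDerivAt_snd : ∀ r > 0, HasDerivAt p (L r - ((n : ℝ) - 1) * (p r / r)) r
  regular_fst : IsRegular m
  regular_snd : IsRegular fun r => p r / r
  regular_laplacian : IsRegular L
  snd_zero : p 0 = 0
  exists_support : ∃ R, ∀ r > 0, R ≤ r → m r = 0 ∧ p r = 0 ∧ L r = 0

namespace IsRadialProfile

variable {m p L : ℝ → ℝ}

theorem regular_deriv (h : IsRadialProfile n m p L) : IsRegular p :=
  ((IsRegular.of_continuous continuous_id).mul h.regular_snd).congr fun r hr => by
    simp only [id]
    field_simp

/-- Integrate the derivative of r^n p m + r^{n+1} m²/2, which vanishes at 0 and for large r. -/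
theorem integral_mul (h : IsRadialProfile (n + 1) m p L) :
    ∫ r in Ioi (0 : ℝ), r ^ n * (m r * (L r + r * p r + (n + 1) * m r)) =
      -(∫ r in Ioi (0 : ℝ), r ^ n * p r ^ 2) +
        (n + 1) / 2 * ∫ r in Ioi (0 : ℝ), r ^ n * m r ^ 2 := by
  obtain ⟨R, hR⟩ := h.exists_support
  have hr : IsRegular fun r : ℝ => r := .of_continuous continuous_id
  have hrn : IsRegular fun r : ℝ => r ^ n := .of_continuous (by fun_prop)
  have hm := h.regular_fst
  have hp := h.regular_deriv
  have i1 : IntegrableOn (fun r => r ^ n * (m r * (L r + r * p r + (n + 1) * m r))) (Ioi 0) :=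
    (hrn.mul (hm.mul ((h.regular_laplacian.add (hr.mul hp)).add (hm.const_mul _)))).integrableOn (R := R)
      fun r h0 h1 => by simp [(hR r h0 h1).1]
  have i2 : IntegrableOn (fun r => r ^ n * p r ^ 2) (Ioi 0) :=
    (hrn.mul hp.sq).integrableOn (R := R) fun r h0 h1 => by simp [(hR r h0 h1).2.1]
  have i3 : IntegrableOn (fun r => r ^ n * m r ^ 2) (Ioi 0) :=
    (hrn.mul hm.sq).integrableOn (R := R) fun r h0 h1 => by simp [(hR r h0 h1).1]
  set F : ℝ → ℝ := fun r => r * (r ^ n * (p r / r * m r + m r ^ 2 / 2)) with hF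
  have hd (r : ℝ) (h0 : r ∈ Ioi (0 : ℝ)) : HasDerivAt F
      (r ^ n * (m r * (L r + r * p r + (n + 1) * m r)) +
        (r ^ n * p r ^ 2 - (n + 1) / 2 * (r ^ n * m r ^ 2))) r := by
    have h0' : r ≠ 0 := ne_of_gt h0
    have d1 := h.hasDerivAt_fst r h0
    have d2 := (h.hasDerivAt_snd r h0).div (hasDerivAt_id' r) h0'
    have d3 := (hasDerivAt_id' r).mul ((hasDerivAt_pow n r).mul
      ((d2.mul d1).add ((d1.pow 2).div_const 2)))
    refine d3.congr_deriv ?_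
    cases n with
    | zero => simp; field_simp; ring
    | succ k => simp; field_simp; ring
  have hF0 : ContinuousWithinAt F (Ici 0) 0 :=
    (hrn.mul ((h.regular_snd.mul hm).add (hm.sq.mul (.const 2⁻¹)))).continuousWithinAt_mul
  have hFt : Tendsto F atTop (𝓝 0) := by
    refine tendsto_const_nhds.congr' ?_
    filter_upwards [eventually_gt_atTop 0, eventually_ge_atTop R] with r h0 h1
    simp [hF, (hR r h0 h1).1]
  have i4 : IntegrableOn (fun r => r ^ n * p r ^ 2 - (n + 1) / 2 * (r ^ n * m r ^ 2)) (Ioi 0) :=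
    i2.sub (i3.const_mul _)
  have key := integral_Ioi_of_hasDerivAt_of_tendsto hF0 hd (i1.add i4) hFt
  rw [integral_add i1 i4, integral_sub i2 (i3.const_mul _),
    integral_const_mul] at key
  have : F 0 = 0 := by simp [hF]
  linarith

/-- The Gaussian e^{−r²/2} is annihilated by Δ + x·∇ + (n + 1), so adding a multiple of it to m
leaves the right side unchanged. The multiple is used to make the derivative vanish at x₀. -/
theorem exists_integral_sq_sub_gaussian_le (h : IsRadialProfile (n + 1) m p L) :
    ∃ t : ℝ, 4 * (∫ r in Ioi (0 : ℝ), r ^ n * (p r - t * r * Real.exp (-r ^ 2 / 2)) ^ 2) ≤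
      ∫ r in Ioi (0 : ℝ), r ^ n * (L r + r * p r + (n + 1) * m r) ^ 2 := by
  obtain ⟨R, hR⟩ := h.exists_support
  have hr : IsRegular fun r : ℝ => r := .of_continuous continuous_id
  have hrn : IsRegular fun r : ℝ => r ^ n := .of_continuous (by fun_prop)
  have he : IsRegular fun r : ℝ => Real.exp (-r ^ 2 / 2) := .of_continuous (by fun_prop)
  set x₀ := √(((n : ℝ) + 3) / 2) with hx₀
  have hx0 : 0 < x₀ := by positivity
  have hx : x₀ ^ 2 = ((n : ℝ) + 3) / 2 := Real.sq_sqrt (by positivity)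
  -- Chosen so that p − t r e^{−r²/2} vanishes at x₀; it need not be the coefficient of the L²
  -- projection.
  set t := p x₀ / (x₀ * Real.exp (-x₀ ^ 2 / 2)) with ht
  refine ⟨t, ?_⟩
  have hexp (r : ℝ) : HasDerivAt (fun r : ℝ => Real.exp (-r ^ 2 / 2))
      (-r * Real.exp (-r ^ 2 / 2)) r := by
    refine (((hasDerivAt_pow 2 r).neg.div_const 2).exp).congr_deriv ?_
    simp
    ring
  set d : ℝ → ℝ := fun r => p r - t * r * Real.exp (-r ^ 2 / 2) with hd
  set M : ℝ → ℝ := fun r => m r + t * Real.exp (-r ^ 2 / 2) with hM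
  set Y : ℝ → ℝ := fun r => L r + r * p r + (n + 1) * m r with hY
  have hp := h.regular_deriv
  have i1 : IntegrableOn (fun r => r ^ n * Y r ^ 2) (Ioi 0) :=
    (hrn.mul ((h.regular_laplacian.add (hr.mul hp)).add
      (h.regular_fst.const_mul _)).sq).integrableOn (R := R)
      fun r h0 h1 => by simp [hR r h0 h1]
  have i2 : IntegrableOn (fun r => r ^ n * d r ^ 2) (Ioi 0) := by
    have j1 : IntegrableOn (fun r => r ^ n * (p r * (p r - 2 * t * (r * Real.exp (-r ^ 2 / 2)))))
        (Ioi 0) :=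
      (hrn.mul (hp.mul (hp.sub ((hr.mul he).const_mul _)))).integrableOn (R := R)
        fun r h0 h1 => by simp [hR r h0 h1]
    have j2 := (integrableOn_pow_mul_exp_neg_sq (n + 2) one_pos).const_mul (t ^ 2)
    refine (j1.add j2).congr_fun (fun r _ => ?_) measurableSet_Ioi
    have : Real.exp (-1 * r ^ 2) = Real.exp (-r ^ 2 / 2) ^ 2 := by
      rw [← Real.exp_nat_mul]
      congr 1
      push_cast
      ring
    simp only [Pi.add_apply, this, hd]
    ring
  have i3 : IntegrableOn (fun r => r ^ n * (Y r ^ 2 - 4 * d r ^ 2)) (Ioi 0) :=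
    (i1.sub (i2.const_mul 4)).congr_fun (fun r _ => by simp; ring) measurableSet_Ioi
  have hpos (b : ℝ) (hb : x₀ < b) : 0 ≤ ∫ r in (0 : ℝ)..b, r ^ n * (Y r ^ 2 - 4 * d r ^ 2) := by
    refine integral_sq_sub_nonneg (M := M) (fun r h0 => ?_) (fun r h0 => ?_) ?_ ?_ ?_ hx0 hx ?_ hb i3
    · refine ((h.hasDerivAt_fst r h0).add ((hexp r).const_mul t)).congr_deriv ?_
      simp only [hd]
      ring
    · refine ((h.hasDerivAt_snd r h0).sub
        (((hasDerivAt_id' r).const_mul t).mul (hexp r))).congr_deriv ?_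
      simp only [hd, hM, hY]
      push_cast
      field_simp
      ring
    · exact h.regular_fst.add (he.const_mul _)
    · refine (h.regular_snd.sub (he.const_mul t)).congr fun r h0 => ?_
      simp only [hd]
      field_simp
    · refine ContinuousWithinAt.sub (h.regular_snd.continuousWithinAt_mul.congr (fun r _ => ?_) ?_)
        (by fun_prop)
      · rcases eq_or_ne r 0 with rfl | h0
        · simp [h.snd_zero]
        · field_simp
      · simp [h.snd_zero]
    · simp only [hd, ht]
      field_simp
      ring
  have hlim := intervalIntegral_tendsto_integral_Ioi 0 i3 tendsto_id
  have key := ge_of_tendsto hlim ((eventually_gt_atTop x₀).mono hpos)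
  have e : ∫ r in Ioi (0 : ℝ), r ^ n * (Y r ^ 2 - 4 * d r ^ 2) =
      (∫ r in Ioi (0 : ℝ), r ^ n * Y r ^ 2) - 4 * ∫ r in Ioi (0 : ℝ), r ^ n * d r ^ 2 := by
    rw [← integral_const_mul, ← integral_sub i1 (i2.const_mul 4)]
    congr 1
    ext r
    ring
  rw [e] at key
  linarith

end IsRadialProfile

/-! ### Spherical means -/

/-- The surface area of the unit sphere. -/
def sphereArea (n : ℕ) : ℝ := (sphereMeasure n).real univ

theorem sphereArea_pos [NeZero n] : 0 < sphereArea n := by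
  rw [sphereArea, sphereMeasure, Measure.real, Measure.toSphere_apply_univ]
  refine ENNReal.toReal_pos (mul_ne_zero ?_ (Metric.measure_ball_pos _ _ one_pos).ne')
    (ENNReal.mul_ne_top (by simp) measure_ball_lt_top.ne)
  simpa using NeZero.ne n

/-- The mean of `f` over the sphere of radius `r`. -/
def sphereMean (f : EuclideanSpace ℝ (Fin n) → ℝ) (r : ℝ) : ℝ :=
  (sphereArea n)⁻¹ * ∫ σ, f (r • σ.1) ∂(sphereMeasure n)

theorem sphereArea_mul_sphereMean [NeZero n] (f : EuclideanSpace ℝ (Fin n) → ℝ) (r : ℝ) :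
    sphereArea n * sphereMean f r = ∫ σ, f (r • σ.1) ∂(sphereMeasure n) :=
  mul_inv_cancel_left₀ sphereArea_pos.ne' _

theorem norm_smul_sphere {r : ℝ} (hr : 0 ≤ r)
    (σ : Metric.sphere (0 : EuclideanSpace ℝ (Fin n)) 1) : ‖r • σ.1‖ = r := by
  rw [norm_smul, norm_eq_of_mem_sphere, mul_one, Real.norm_of_nonneg hr]

theorem continuous_smul_sphere {f : EuclideanSpace ℝ (Fin n) → ℝ} (hf : Continuous f) (r : ℝ) :
    Continuous fun σ : Metric.sphere (0 : EuclideanSpace ℝ (Fin n)) 1 => f (r • σ.1) :=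
  hf.comp (continuous_subtype_val.const_smul r)

theorem integrable_smul_sphere {f : EuclideanSpace ℝ (Fin n) → ℝ} (hf : Continuous f) (r : ℝ) :
    Integrable (fun σ : Metric.sphere (0 : EuclideanSpace ℝ (Fin n)) 1 => f (r • σ.1))
      (sphereMeasure n) :=
  integrable_sphere (continuous_smul_sphere hf r)

theorem sphereMean_add {f g : EuclideanSpace ℝ (Fin n) → ℝ} (hf : Continuous f)
    (hg : Continuous g) (r : ℝ) :
    sphereMean (fun x => f x + g x) r = sphereMean f r + sphereMean g r := by
  rw [sphereMean, integral_add (integrable_smul_sphere hf r) (integrable_smul_sphere hg r), mul_add]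
  rfl

theorem sphereMean_sub {f g : EuclideanSpace ℝ (Fin n) → ℝ} (hf : Continuous f)
    (hg : Continuous g) (r : ℝ) :
    sphereMean (fun x => f x - g x) r = sphereMean f r - sphereMean g r := by
  rw [sphereMean, integral_sub (integrable_smul_sphere hf r) (integrable_smul_sphere hg r), mul_sub]
  rfl

theorem sphereMean_radial_mul {f : EuclideanSpace ℝ (Fin n) → ℝ} (φ : ℝ → ℝ) {r : ℝ} (hr : 0 ≤ r) :
    sphereMean (fun x => φ ‖x‖ * f x) r = φ r * sphereMean f r := by
  simp_rw [sphereMean, norm_smul_sphere hr]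
  rw [integral_const_mul]
  ring

theorem integral_eq_sphereMean [NeZero n] {f : EuclideanSpace ℝ (Fin n) → ℝ} (hf : Integrable f) :
    ∫ x, f x = sphereArea n * ∫ r in Ioi (0 : ℝ), r ^ (n - 1) * sphereMean f r := by
  rw [integral_polar hf, ← integral_const_mul]
  refine setIntegral_congr_fun measurableSet_Ioi fun r _ => ?_
  rw [mul_left_comm, sphereArea_mul_sphereMean]

theorem IsTest.exists_norm_fderiv_le {f : EuclideanSpace ℝ (Fin n) → ℝ} (hf : IsTest f) :
    ∃ C, ∀ x, ‖fderiv ℝ f x‖ ≤ C :=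
  ((hf.contDiff (m := 1)).continuous_fderiv (by norm_num)).bounded_above_of_compact_support
    (hf.2.fderiv ℝ)

theorem IsTest.hasDerivAt_sphereMean_aux {f : EuclideanSpace ℝ (Fin n) → ℝ} (hf : IsTest f)
    (r : ℝ) : HasDerivAt (sphereMean f)
      ((sphereArea n)⁻¹ * ∫ σ, fderiv ℝ f (r • σ.1) σ.1 ∂(sphereMeasure n)) r := by
  obtain ⟨C, hC⟩ := hf.exists_norm_fderiv_le
  have hc : Continuous fun σ : Metric.sphere (0 : EuclideanSpace ℝ (Fin n)) 1 =>
      fderiv ℝ f (r • σ.1) σ.1 :=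
    (((hf.contDiff (m := 1)).continuous_fderiv (by norm_num)).comp
      (continuous_subtype_val.const_smul r)).clm_apply continuous_subtype_val
  have h := hasDerivAt_integral_of_dominated_loc_of_deriv_le (μ := sphereMeasure n)
    (F := fun r σ => f (r • σ.1)) (F' := fun r σ => fderiv ℝ f (r • σ.1) σ.1) (x₀ := r)
    (s := univ) (bound := fun _ => C) univ_mem
    (Eventually.of_forall fun r => (continuous_smul_sphere hf.continuous r).aestronglyMeasurable)
    (integrable_smul_sphere hf.continuous r) hc.aestronglyMeasurable
    (Eventually.of_forall fun σ r _ => ?_) (integrable_const C)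
    (Eventually.of_forall fun σ r _ => ?_)
  · exact h.2.const_mul _
  · refine (ContinuousLinearMap.le_opNorm _ _).trans ?_
    rw [norm_eq_of_mem_sphere, mul_one]
    exact hC _
  · have h1 : HasDerivAt (fun r : ℝ => r • σ.1) σ.1 r := by
      simpa using (hasDerivAt_id r).smul_const σ.1
    exact (hf.differentiable (r • σ.1)).hasFDerivAt.comp_hasDerivAt r h1

theorem IsTest.hasDerivAt_sphereMean {f : EuclideanSpace ℝ (Fin n) → ℝ} (hf : IsTest f)
    {r : ℝ} (hr : r ≠ 0) : HasDerivAt (sphereMean f) (sphereMean (euler f) r / r) r := by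
  refine (hf.hasDerivAt_sphereMean_aux r).congr_deriv ?_
  simp_rw [sphereMean, euler, map_smul, smul_eq_mul]
  rw [integral_const_mul]
  field_simp

theorem IsTest.continuous_sphereMean {f : EuclideanSpace ℝ (Fin n) → ℝ} (hf : IsTest f) :
    Continuous (sphereMean f) :=
  continuous_iff_continuousAt.2 fun r => (hf.hasDerivAt_sphereMean_aux r).continuousAt

theorem IsTest.exists_sphereMean_eq_zero {f : EuclideanSpace ℝ (Fin n) → ℝ} (hf : IsTest f) :
    ∃ R, ∀ r > 0, R ≤ r → sphereMean f r = 0 := by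
  obtain ⟨R, hR⟩ := hf.2.isCompact.isBounded.subset_ball 0
  refine ⟨R, fun r h0 hr => ?_⟩
  have (σ : Metric.sphere (0 : EuclideanSpace ℝ (Fin n)) 1) : f (r • σ.1) = 0 := by
    refine image_eq_zero_of_notMem_tsupport fun h => ?_
    have := hR h
    rw [mem_ball_zero_iff, norm_smul_sphere h0.le] at this
    linarith
  simp [sphereMean, this]

/-- The extension cutoff(|x|)⟨a, x⟩ is odd, so its integral over ℝⁿ vanishes; in polar coordinates
that integral is a positive radial factor times the one on the sphere. -/
theorem integral_sphere_inner [NeZero n] (a : EuclideanSpace ℝ (Fin n)) :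
    ∫ σ, inner ℝ a σ.1 ∂(sphereMeasure n) = 0 := by
  set f : EuclideanSpace ℝ (Fin n) → ℝ := fun x => cutoff ‖x‖ * inner ℝ a x with hf
  have hc : Continuous cutoff := (contDiff_cutoff (m := 1)).continuous
  have hfc : Continuous f := by fun_prop
  have hfs : HasCompactSupport f :=
    (hasCompactSupport_comp_norm (b := 2) fun r hr => cutoff_of_ge hr).mul_right
  have h0 : ∫ x, f x = 0 := by
    have h := integral_neg_eq_self f volume
    have e : ∀ x, f (-x) = -f x := fun x => by simp [hf]
    simp_rw [e, integral_neg] at h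
    linarith
  rw [integral_polar (hfc.integrable_of_hasCompactSupport hfs)] at h0
  have e : ∀ r ∈ Ioi (0 : ℝ), r ^ (n - 1) * ∫ σ, f (r • σ.1) ∂(sphereMeasure n) =
      (r ^ (n - 1) * (r * cutoff r)) * ∫ σ, inner ℝ a σ.1 ∂(sphereMeasure n) := fun r hr => by
    have e' (σ : Metric.sphere (0 : EuclideanSpace ℝ (Fin n)) 1) :
        f (r • σ.1) = cutoff r * r * inner ℝ a σ.1 := by
      simp only [hf]
      rw [norm_smul_sphere (le_of_lt hr), inner_smul_right, mul_assoc]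
    simp_rw [e']
    rw [integral_const_mul]
    ring
  rw [setIntegral_congr_fun measurableSet_Ioi e, integral_mul_const] at h0
  refine (mul_eq_zero.1 h0).resolve_left (ne_of_gt ?_)
  have hw : Continuous fun r : ℝ => r ^ (n - 1) * (r * cutoff r) := by fun_prop
  rw [setIntegral_pos_iff_support_of_nonneg_ae]
  · have : Ioo (0 : ℝ) 1 ⊆ (Function.support fun r : ℝ => r ^ (n - 1) * (r * cutoff r)) ∩ Ioi 0 := by
      refine fun r hr => ⟨?_, hr.1⟩
      have h1 := hr.1
      rw [Function.mem_support, cutoff_of_le hr.2.le]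
      positivity
    refine lt_of_lt_of_le ?_ (measure_mono this)
    simp
  · filter_upwards [ae_restrict_mem measurableSet_Ioi] with r hr
    have h1 : 0 < r := hr
    have := cutoff_nonneg r
    change (0 : ℝ) ≤ _
    positivity
  · refine (IsRegular.of_continuous hw).integrableOn (R := 2) fun r _ hr => ?_
    rw [cutoff_of_ge hr, mul_zero, mul_zero]

/-- The linear term of x·∇u at the origin averages to zero over spheres, and the remainder is
quadratic because Du is Lipschitz. This keeps m'(r)/r bounded near 0. -/
theorem IsTest.exists_abs_sphereMean_euler_le [NeZero n] {u : EuclideanSpace ℝ (Fin n) → ℝ}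
    (hu : IsTest u) : ∃ K, ∀ r > 0, |sphereMean (euler u) r| ≤ K * r ^ 2 := by
  have hd : ContDiff ℝ 1 (fderiv ℝ u) := 
    (hu.contDiff (m := 2)).fderiv_right (m := 1) one_add_one_eq_two.le
  obtain ⟨K, hK⟩ := hd.lipschitzWith_of_hasCompactSupport (hu.2.fderiv ℝ) (by norm_num)
  refine ⟨K, fun r hr => ?_⟩
  have hS := sphereArea_pos (n := n)
  have h0 : ∫ σ, fderiv ℝ u 0 σ.1 ∂(sphereMeasure n) = 0 := by
    simp_rw [← inner_gradient_left]
    exact integral_sphere_inner _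
  have ic : Continuous fun σ : Metric.sphere (0 : EuclideanSpace ℝ (Fin n)) 1 =>
      r * fderiv ℝ u 0 σ.1 :=
    continuous_const.mul ((fderiv ℝ u 0).continuous.comp continuous_subtype_val)
  have h1 : sphereMean (euler u) r = (sphereArea n)⁻¹ *
      ∫ σ, (euler u (r • σ.1) - r * fderiv ℝ u 0 σ.1) ∂(sphereMeasure n) := by
    rw [integral_sub (integrable_smul_sphere hu.euler.continuous r) (integrable_sphere ic),
      integral_const_mul, h0, mul_zero, sub_zero, sphereMean]
  have h2 : ‖∫ σ, (euler u (r • σ.1) - r * fderiv ℝ u 0 σ.1) ∂(sphereMeasure n)‖ ≤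
      K * r ^ 2 * sphereArea n := by
    refine norm_integral_le_of_norm_le_const (Eventually.of_forall fun σ => ?_)
    have e : euler u (r • σ.1) - r * fderiv ℝ u 0 σ.1 =
        (fderiv ℝ u (r • σ.1) - fderiv ℝ u 0) (r • σ.1) := by
      simp only [euler, map_smul, sub_apply, smul_eq_mul]
      ring
    rw [e]
    refine (ContinuousLinearMap.le_opNorm _ _).trans ?_
    have := hK.dist_le_mul (r • σ.1) 0
    rw [dist_eq_norm, dist_zero_right] at this
    rw [norm_smul_sphere hr.le] at this ⊢
    nlinarith
  rw [h1, abs_mul, abs_of_pos (inv_pos.2 hS), inv_mul_le_iff₀ hS, mul_comm (sphereArea n)]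
  exact h2

theorem isTest_comp_norm {φ : ℝ → ℝ} (hφ : ContDiff ℝ ∞ φ) (hφs : HasCompactSupport φ)
    (hφ0 : tsupport φ ⊆ Ioi 0) : IsTest fun x : EuclideanSpace ℝ (Fin n) => φ ‖x‖ := by
  have h0 : φ =ᶠ[𝓝 0] 0 := notMem_tsupport_iff_eventuallyEq.1 fun h => lt_irrefl (0 : ℝ) (hφ0 h)
  obtain ⟨a, ha, hφa⟩ := Metric.eventually_nhds_iff_ball.1 h0
  obtain ⟨b, hb⟩ := hφs.isCompact.isBounded.subset_ball 0
  have h1 : ∀ r, b ≤ r → φ r = 0 := fun r hr => image_eq_zero_of_notMem_tsupport fun h => by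
    have := hb h
    rw [mem_ball_zero_iff, Real.norm_eq_abs] at this
    linarith [le_abs_self r]
  refine ⟨?_, hasCompactSupport_comp_norm h1⟩
  have h2 : ∀ r ≤ a / 2, φ r = 0 := fun r hr => by
    rcases le_or_gt r 0 with h | h
    · exact image_eq_zero_of_notMem_tsupport fun h' => absurd (hφ0 h') (not_lt.2 h)
    · exact hφa r (by rw [mem_ball_zero_iff, Real.norm_of_nonneg h.le]; linarith)
  simpa using contDiff_polar (n := n) (U := fun _ => 1) hφ contDiff_const (half_pos ha) h2

/-- The gradient of a radial function is parallel to x; the factor |x|² makes the identity valid at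
the origin too. -/
theorem norm_sq_mul_inner_gradient_comp_norm {φ : ℝ → ℝ} (hφ : Differentiable ℝ φ)
    (x v : EuclideanSpace ℝ (Fin n)) :
    ‖x‖ ^ 2 * fderiv ℝ (fun y : EuclideanSpace ℝ (Fin n) => φ ‖y‖) x v =
      euler (fun y => φ ‖y‖) x * inner ℝ x v := by
  rcases eq_or_ne x 0 with rfl | hx
  · simp [euler]
  have h : HasFDerivAt (fun y : EuclideanSpace ℝ (Fin n) => φ ‖y‖)
      (deriv φ ‖x‖ • (‖x‖⁻¹ • innerSL ℝ x)) x :=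
    (hφ ‖x‖).hasDerivAt.comp_hasFDerivAt x (hasFDerivAt_norm hx)
  have hx0 := norm_ne_zero_iff.2 hx
  rw [euler, h.fderiv]
  simp only [smul_apply, innerSL_apply_apply, smul_eq_mul, real_inner_self_eq_norm_sq]
  field_simp

/-- Green's identity against g|x|²: as ∇g is parallel to x, only the Euler derivative of u appears,
and a second integration by parts for x·∇ finishes. This is the weak form of the radial part of the
Laplacian. -/
theorem IsTest.integral_radial_mul_laplacian {u g : EuclideanSpace ℝ (Fin n) → ℝ} (hu : IsTest u)
    (hg : IsTest g) (h : ∀ x v, ‖x‖ ^ 2 * fderiv ℝ g x v = euler g x * inner ℝ x v) :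
    ∫ x, g x * (euler (euler u) x + (n - 2) * euler u x - ‖x‖ ^ 2 * (Δ u) x) = 0 := by
  have hq : ContDiff ℝ ∞ fun x : EuclideanSpace ℝ (Fin n) => ‖x‖ ^ 2 := contDiff_norm_sq ℝ
  have hgq : IsTest fun x => g x * ‖x‖ ^ 2 := hg.mul hq
  have h1 := hg.integral_mul_euler hu.euler
  have h2 := hu.integral_laplacian_mul (hgq.contDiff (m := 1))
  have e : ∀ x, inner ℝ ((∇ u) x) ((∇ fun x => g x * ‖x‖ ^ 2) x) =
      2 * (g x * euler u x) + euler g x * euler u x := fun x => by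
    have hf : HasFDerivAt (fun x => g x * ‖x‖ ^ 2) _ x :=
      (hg.differentiable x).hasFDerivAt.mul (hasStrictFDerivAt_norm_sq x).hasFDerivAt
    have hi : inner ℝ x ((∇ u) x) = euler u x := by
      rw [real_inner_comm, inner_gradient_left]
      rfl
    have := h x ((∇ u) x)
    rw [real_inner_comm, inner_gradient_left, hf.fderiv]
    simp only [add_apply, smul_apply, smul_eq_mul, innerSL_apply_apply, hi] at this ⊢
    rw [this]
    simp
    ring
  simp_rw [e] at h2
  have i1 := (hg.mul hu.euler.1).integrable
  have i2 := (hg.euler.mul hu.euler.1).integrable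
  have i3 := (hg.mul hu.euler.euler.1).integrable
  have i4 := (hgq.mul hu.laplacian.1).integrable
  rw [integral_add (i1.const_mul 2) i2, integral_const_mul] at h2
  have e2 : ∀ x, g x * (euler (euler u) x + (n - 2) * euler u x - ‖x‖ ^ 2 * (Δ u) x) =
      g x * euler (euler u) x + (n - 2) * (g x * euler u x) - g x * ‖x‖ ^ 2 * (Δ u) x :=
    fun x => by ring
  simp_rw [e2]
  have i5 : Integrable fun x => g x * euler (euler u) x + (n - 2) * (g x * euler u x) :=
    i3.add (i1.const_mul _)
  rw [integral_sub i5 i4, integral_add i3 (i1.const_mul _), integral_const_mul, h1]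
  have e3 : ∫ x, (Δ u) x * (g x * ‖x‖ ^ 2) = ∫ x, g x * ‖x‖ ^ 2 * (Δ u) x := by
    simp_rw [mul_comm]
  rw [e3] at h2
  rw [h2]
  ring

/-- The discrepancy W has zero integral against every radial test function supported away from 0. In
polar coordinates r^{n−1} times its spherical mean is therefore zero almost everywhere on (0, ∞),
hence everywhere by continuity. -/
theorem IsTest.sphereMean_laplacian [NeZero n] {u : EuclideanSpace ℝ (Fin n) → ℝ} (hu : IsTest u)
    {r : ℝ} (hr : 0 < r) :
    r ^ 2 * sphereMean (Δ u) r = sphereMean (euler (euler u)) r + (n - 2) * sphereMean (euler u) r := by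
  set W : EuclideanSpace ℝ (Fin n) → ℝ := fun x =>
    euler (euler u) x + (n - 2) * euler u x - ‖x‖ ^ 2 * (Δ u) x with hW
  have hq : ContDiff ℝ ∞ fun x : EuclideanSpace ℝ (Fin n) => ‖x‖ ^ 2 := contDiff_norm_sq ℝ
  have hl : IsTest fun x => ‖x‖ ^ 2 * (Δ u) x := by
    simp_rw [mul_comm (‖_‖ ^ 2)]
    exact hu.laplacian.mul hq
  have hE := hu.euler.const_mul ((n : ℝ) - 2)
  have hWt : IsTest W := (hu.euler.euler.add hE).sub hl
  have hc : Continuous fun r : ℝ => r ^ (n - 1) * sphereMean W r :=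
    (continuous_id.pow _).mul hWt.continuous_sphereMean
  have hae := isOpen_Ioi.ae_eq_zero_of_integral_contDiff_smul_eq_zero (U := Ioi (0 : ℝ))
    (μ := volume) (hc.locallyIntegrable.locallyIntegrableOn _) fun φ h1 h2 h3 => by
      have hg := isTest_comp_norm (n := n) h1 h2 h3
      have h := hu.integral_radial_mul_laplacian hg
        (norm_sq_mul_inner_gradient_comp_norm (h1.differentiable (by simp)))
      rw [integral_eq_sphereMean (hg.mul hWt.1).integrable] at h
      have h4 := (mul_eq_zero.1 h).resolve_left sphereArea_pos.ne'
      have h5 : ∀ r ∉ Ioi (0 : ℝ), φ r • (r ^ (n - 1) * sphereMean W r) = 0 := fun r hr => by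
        rw [image_eq_zero_of_notMem_tsupport (f := φ) fun h => hr (h3 h), zero_smul]
      rw [← setIntegral_eq_integral_of_forall_compl_eq_zero h5]
      refine (setIntegral_congr_fun measurableSet_Ioi fun r hr => ?_).trans h4
      simp only [smul_eq_mul]
      rw [sphereMean_radial_mul φ (le_of_lt hr)]
      ring
  have h0 : EqOn (fun r : ℝ => r ^ (n - 1) * sphereMean W r) 0 (Ioi 0) := by
    refine Measure.eqOn_open_of_ae_eq (μ := volume) ?_ isOpen_Ioi hc.continuousOn
      continuousOn_const
    exact (ae_restrict_iff' measurableSet_Ioi).2 hae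
  have h5 : sphereMean W r = 0 :=
    (mul_eq_zero.1 (h0 hr)).resolve_left (pow_ne_zero _ hr.ne')
  rw [hW, sphereMean_sub (hu.euler.euler.add hE).continuous hl.continuous,
    sphereMean_add hu.euler.euler.continuous hE.continuous,
    sphereMean_radial_mul (fun r => r ^ 2) hr.le,
    sphereMean_radial_mul (fun _ => (n : ℝ) - 2) hr.le] at h5
  linarith

theorem IsTest.isRadialProfile [NeZero n] {u : EuclideanSpace ℝ (Fin n) → ℝ} (hu : IsTest u) :
    IsRadialProfile n (sphereMean u) (fun r => sphereMean (euler u) r / r) (sphereMean (Δ u)) where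
  hasDerivAt_fst r hr := hu.hasDerivAt_sphereMean hr.ne'
  hasDerivAt_snd r hr := by
    refine ((hu.euler.hasDerivAt_sphereMean hr.ne').div (hasDerivAt_id' r) hr.ne').congr_deriv ?_
    have h := hu.sphereMean_laplacian hr
    have h' : sphereMean (euler (euler u)) r =
      r ^ 2 * sphereMean (Δ u) r - (n - 2) * sphereMean (euler u) r := by linarith
    rw [h']
    field_simp
    ring
  regular_fst := .of_continuous hu.continuous_sphereMean
  regular_snd := by
    obtain ⟨K, hK⟩ := hu.exists_abs_sphereMean_euler_le
    refine ⟨(hu.euler.continuous_sphereMean.continuousOn.div continuousOn_id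
      fun r hr => ne_of_gt hr).div continuousOn_id fun r hr => ne_of_gt hr,
      fun R => ⟨K, fun r hr => ?_⟩⟩
    have h0 := hr.1
    simp only
    rw [div_div, abs_div, abs_of_pos (mul_pos h0 h0), div_le_iff₀ (mul_pos h0 h0), ← pow_two]
    exact hK r h0
  regular_laplacian := .of_continuous hu.laplacian.continuous_sphereMean
  snd_zero := by simp
  exists_support := by
    obtain ⟨R₁, h1⟩ := hu.exists_sphereMean_eq_zero
    obtain ⟨R₂, h2⟩ := hu.euler.exists_sphereMean_eq_zero
    obtain ⟨R₃, h3⟩ := hu.laplacian.exists_sphereMean_eq_zero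
    refine ⟨max R₁ (max R₂ R₃), fun r h0 hr => ⟨h1 r h0 ?_, ?_, h3 r h0 ?_⟩⟩
    · exact (le_max_left _ _).trans hr
    · rw [h2 r h0 (((le_max_left _ _).trans (le_max_right _ _)).trans hr), zero_div]
    · exact ((le_max_right _ _).trans (le_max_right _ _)).trans hr

/-! ### The additive stability inequality for test functions -/

theorem sphereMean_one [NeZero n] (r : ℝ) :
    sphereMean (fun _ : EuclideanSpace ℝ (Fin n) => 1) r = 1 := by
  rw [sphereMean, integral_const, smul_eq_mul, mul_one]
  exact inv_mul_cancel₀ sphereArea_pos.ne'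

theorem sq_sphereMean_le [NeZero n] {f : EuclideanSpace ℝ (Fin n) → ℝ} (hf : Continuous f) (r : ℝ) :
    sphereMean f r ^ 2 ≤ sphereMean (fun x => f x ^ 2) r := by
  have hS := sphereArea_pos (n := n)
  set c := sphereMean f r with hc
  have h : 0 ≤ ∫ σ, (f (r • σ.1) - c) ^ 2 ∂(sphereMeasure n) :=
    integral_nonneg fun σ => sq_nonneg _
  have i1 := integrable_smul_sphere hf r
  have i2 : Integrable (fun σ : Metric.sphere (0 : EuclideanSpace ℝ (Fin n)) 1 =>
      f (r • σ.1) ^ 2) (sphereMeasure n) := integrable_smul_sphere (hf.pow 2) r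
  have i3 : Integrable (fun σ : Metric.sphere (0 : EuclideanSpace ℝ (Fin n)) 1 =>
      2 * c * f (r • σ.1) - c ^ 2) (sphereMeasure n) := (i1.const_mul _).sub (integrable_const _)
  have e (σ : Metric.sphere (0 : EuclideanSpace ℝ (Fin n)) 1) :
      (f (r • σ.1) - c) ^ 2 = f (r • σ.1) ^ 2 - (2 * c * f (r • σ.1) - c ^ 2) := by ring
  simp_rw [e] at h
  rw [integral_sub i2 i3, integral_sub (i1.const_mul _) (integrable_const _), integral_const_mul,
    ← sphereArea_mul_sphereMean, ← sphereArea_mul_sphereMean (fun x => f x ^ 2), ← hc,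
    integral_const, smul_eq_mul, ← sphereArea] at h
  refine le_of_mul_le_mul_left ?_ hS
  linarith

theorem IsTest.integrableOn_sphereMean [NeZero n] {f : EuclideanSpace ℝ (Fin n) → ℝ} (hf : IsTest f)
    (k : ℕ) : IntegrableOn (fun r => r ^ k * sphereMean f r) (Ioi 0) := by
  obtain ⟨R, hR⟩ := hf.exists_sphereMean_eq_zero
  refine ((IsRegular.of_continuous (continuous_id.pow k)).mul
    (.of_continuous hf.continuous_sphereMean)).integrableOn (R := R) fun r h0 h1 => ?_
  simp [hR r h0 h1]

/-- On the sphere of radius r, |x|²|∇u|² − (x·∇u)² is the tangential energy of x ↦ u(rx) on the unit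
sphere. Apply the spherical inequality with its constant (n + 1) − 1 and integrate in r. -/
theorem IsTest.poincare_sphereMean {u : EuclideanSpace ℝ (Fin (n + 1)) → ℝ} (hu : IsTest u) :
    (n : ℝ) * ((∫ x, u x ^ 2) - sphereArea (n + 1) *
        ∫ r in Ioi (0 : ℝ), r ^ n * sphereMean u r ^ 2) ≤
      (∫ x, ‖x‖ ^ 2 * ‖(∇ u) x‖ ^ 2) - ∫ x, euler u x ^ 2 := by
  have hS := sphereArea_pos (n := n + 1)
  have hq : ContDiff ℝ ∞ fun x : EuclideanSpace ℝ (Fin (n + 1)) => ‖x‖ ^ 2 := contDiff_norm_sq ℝ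
  have t1 : IsTest fun x => ‖x‖ ^ 2 * ‖(∇ u) x‖ ^ 2 := by
    have := hu.norm_gradient_sq.mul hq
    simpa only [mul_comm] using this
  have t2 : IsTest fun x => euler u x ^ 2 := by
    simpa only [pow_two] using hu.euler.mul hu.euler.1
  have t3 : IsTest fun x => u x ^ 2 := by simpa only [pow_two] using hu.mul hu.1
  obtain ⟨R, hR⟩ := hu.exists_sphereMean_eq_zero
  have i1 : IntegrableOn (fun r => r ^ n * sphereMean u r ^ 2) (Ioi 0) :=
    ((IsRegular.of_continuous (continuous_id.pow n)).mul
      (IsRegular.of_continuous hu.continuous_sphereMean).sq).integrableOn (R := R)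
      fun r h0 h1 => by simp [hR r h0 h1]
  have i2 := t3.integrableOn_sphereMean n
  have i3 := (t1.sub t2).integrableOn_sphereMean n
  rw [← integral_sub t1.integrable t2.integrable, integral_eq_sphereMean t3.integrable,
    integral_eq_sphereMean (t1.sub t2).integrable, Nat.add_sub_cancel, ← mul_sub, ← mul_assoc,
    mul_comm (n : ℝ), mul_assoc, ← integral_sub i2 i1, ← integral_const_mul]
  refine mul_le_mul_of_nonneg_left ?_ hS.le
  refine setIntegral_mono_on ((i2.sub i1).const_mul _) i3 measurableSet_Ioi fun r hr => ?_
  have hr0 : (0 : ℝ) < r := hr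
  set U : EuclideanSpace ℝ (Fin (n + 1)) → ℝ := fun x => u (r • x) with hU
  have hUc : ContDiff ℝ 1 U := (hu.contDiff (m := 1)).comp (contDiff_const_smul r)
  have hd (x : EuclideanSpace ℝ (Fin (n + 1))) : fderiv ℝ U x = r • fderiv ℝ u (r • x) :=
    fderiv_comp_smul r
  have hg (x : EuclideanSpace ℝ (Fin (n + 1))) : ‖(∇ U) x‖ ^ 2 = r ^ 2 * ‖(∇ u) (r • x)‖ ^ 2 := by
    rw [norm_gradient, norm_gradient, hd, norm_smul, mul_pow, Real.norm_eq_abs, sq_abs]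
  have he (x : EuclideanSpace ℝ (Fin (n + 1))) : euler U x = euler u (r • x) := by
    simp [euler, hd]
  have h := sphere_poincare hUc (c := sphereMean u r) (sphereArea_mul_sphereMean u r).symm
  simp_rw [hg, he] at h
  have e : ∫ σ, (r ^ 2 * ‖(∇ u) (r • σ.1)‖ ^ 2 - euler u (r • σ.1) ^ 2)
      ∂(sphereMeasure (n + 1)) = sphereArea (n + 1) *
        sphereMean (fun x => ‖x‖ ^ 2 * ‖(∇ u) x‖ ^ 2 - euler u x ^ 2) r := by
    rw [sphereArea_mul_sphereMean]
    simp_rw [norm_smul_sphere hr0.le]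
  rw [e, ← sphereArea_mul_sphereMean (fun x => u x ^ 2), ← sphereArea, ← mul_sub, Nat.cast_add,
    Nat.cast_one, add_sub_cancel_right, ← mul_assoc, mul_comm (n : ℝ), mul_assoc] at h
  have h' := mul_le_mul_of_nonneg_left (le_of_mul_le_mul_left h hS) (pow_nonneg hr0.le n)
  linarith

/-- The right side is the Poincaré constant of the sphere in ℝᴺ; this is the balance that makes `gap
N` the constant obtained for the nonradial part. -/
theorem gap_equation {N : ℕ} (hN : 1 ≤ N) : (gap N / 2) ^ 2 + gap N / 2 * N = N - 1 := by
  have h1 : (1 : ℝ) ≤ N := by exact_mod_cast hN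
  have h : √((N : ℝ) ^ 2 + 4 * N - 4) ^ 2 = (N : ℝ) ^ 2 + 4 * N - 4 := Real.sq_sqrt (by nlinarith)
  simp only [gap]
  nlinarith

/-- Write N = n + 1, κ = gap N / 2, Y = Δm + x·∇m + N m, and f = Δu + x·∇u + (N + κ)u, whose
spherical mean is Y + κm. Jensen gives ∫ f² ≥ ∫ (Y + κm)². Expanding both sides yields zero-order
terms (N − 1) ∫ u² and (N − 1) ∫ m², whose difference the spherical Poincaré inequality replaces by
∫ |x|²|∇u|² − ∫ (x·∇u)². The gradient terms leave 2κ (∫ |∇u|² − ∫ |∇m|²). -/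
theorem IsTest.stability_sphereMean {u : EuclideanSpace ℝ (Fin (n + 1)) → ℝ} (hu : IsTest u) :
    sphereArea (n + 1) * (∫ r in Ioi (0 : ℝ), r ^ n * (sphereMean (Δ u) r +
        r * (sphereMean (euler u) r / r) + (n + 1) * sphereMean u r) ^ 2) +
      gap (n + 1) * ((∫ x, ‖(∇ u) x‖ ^ 2) - sphereArea (n + 1) *
        ∫ r in Ioi (0 : ℝ), r ^ n * (sphereMean (euler u) r / r) ^ 2) ≤
      (∫ x, (Δ u) x ^ 2) + (∫ x, ‖x‖ ^ 2 * ‖(∇ u) x‖ ^ 2) -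
        (n + 3) * ∫ x, ‖(∇ u) x‖ ^ 2 := by
  have hS := sphereArea_pos (n := n + 1)
  have hprof := hu.isRadialProfile
  have hIm := hprof.integral_mul
  have hpoin := hu.poincare_sphereMean
  set m := sphereMean u with hm
  set L := sphereMean (Δ u) with hL
  set p : ℝ → ℝ := fun r => sphereMean (euler u) r / r with hp
  obtain ⟨R, hR⟩ : ∃ R, ∀ r > 0, R ≤ r → m r = 0 ∧ p r = 0 ∧ L r = 0 := hprof.exists_support
  set κ := gap (n + 1) / 2 with hκ
  have hκe : κ ^ 2 + κ * (n + 1) = n := by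
    have := gap_equation (N := n + 1) (by omega)
    push_cast at this
    rw [← hκ] at this
    linarith
  set f : EuclideanSpace ℝ (Fin (n + 1)) → ℝ := fun x =>
    (Δ u) x + euler u x + ((n : ℝ) + 1 + κ) * u x with hf
  have tf : IsTest f := (hu.laplacian.add hu.euler).add (hu.const_mul _)
  have tf2 : IsTest fun x => f x ^ 2 := by simpa only [pow_two] using tf.mul tf.1
  have hfm (r : ℝ) (hr : 0 < r) :
      sphereMean f r = (L r + r * p r + (n + 1) * m r) + κ * m r := by
    rw [hf, sphereMean_add (hu.laplacian.add hu.euler).continuous (hu.const_mul _).continuous,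
      sphereMean_add hu.laplacian.continuous hu.euler.continuous,
      sphereMean_radial_mul (fun _ => (n : ℝ) + 1 + κ) hr.le]
    simp only [hp]
    field_simp
    ring
  have hr : IsRegular fun r : ℝ => r := .of_continuous continuous_id
  have hrn : IsRegular fun r : ℝ => r ^ n := .of_continuous (by fun_prop)
  have hY : IsRegular fun r => L r + r * p r + (n + 1) * m r :=
    (hprof.regular_laplacian.add (hr.mul hprof.regular_deriv)).add (hprof.regular_fst.const_mul _)
  have i1 : IntegrableOn (fun r => r ^ n * (L r + r * p r + (n + 1) * m r) ^ 2) (Ioi 0) :=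
    (hrn.mul hY.sq).integrableOn (R := R) fun r h0 h1 => by simp [hR r h0 h1]
  have i2 : IntegrableOn (fun r => r ^ n * (m r * (L r + r * p r + (n + 1) * m r))) (Ioi 0) :=
    (hrn.mul (hprof.regular_fst.mul hY)).integrableOn (R := R) fun r h0 h1 => by simp [hR r h0 h1]
  have i3 : IntegrableOn (fun r => r ^ n * m r ^ 2) (Ioi 0) :=
    (hrn.mul hprof.regular_fst.sq).integrableOn (R := R) fun r h0 h1 => by simp [hR r h0 h1]
  have hjensen : (∫ r in Ioi (0 : ℝ), r ^ n * (L r + r * p r + (n + 1) * m r) ^ 2) +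
      2 * κ * (∫ r in Ioi (0 : ℝ), r ^ n * (m r * (L r + r * p r + (n + 1) * m r))) +
      κ ^ 2 * (∫ r in Ioi (0 : ℝ), r ^ n * m r ^ 2) ≤
      ∫ r in Ioi (0 : ℝ), r ^ n * sphereMean (fun x => f x ^ 2) r := by
    have i12 : IntegrableOn (fun r => r ^ n * (L r + r * p r + (n + 1) * m r) ^ 2 +
      2 * κ * (r ^ n * (m r * (L r + r * p r + (n + 1) * m r)))) (Ioi 0) := i1.add (i2.const_mul _)
    rw [← integral_const_mul, ← integral_const_mul, ← integral_add i1 (i2.const_mul _),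
      ← integral_add i12 (i3.const_mul _)]
    refine setIntegral_mono_on (i12.add (i3.const_mul _)) (tf2.integrableOn_sphereMean n)
      measurableSet_Ioi fun r hr => ?_
    have h1 := sq_sphereMean_le tf.continuous r
    rw [hfm r hr] at h1
    have h2 := mul_le_mul_of_nonneg_left h1 (pow_nonneg (le_of_lt hr) n)
    linarith
  have hexp := hu.integral_sq_add_euler ((n : ℝ) + 1 + κ)
  rw [integral_eq_sphereMean tf2.integrable, Nat.add_sub_cancel] at hexp
  have hj := mul_le_mul_of_nonneg_left hjensen hS.le
  rw [hexp, hIm] at hj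
  push_cast at hj
  have hb : ((n : ℝ) + 1 + κ) ^ 2 - (n + 1 + κ) * (n + 1) = n := by linarith
  rw [hb] at hj
  have hg : gap (n + 1) = 2 * κ := by rw [hκ]; ring
  rw [hg]
  set S := sphereArea (n + 1)
  set I3 := ∫ r in Ioi (0 : ℝ), r ^ n * m r ^ 2
  have e4 : (κ ^ 2 + κ * (n + 1)) * (S * I3) = n * (S * I3) := by rw [hκe]
  linarith

theorem integrable_norm_pow_mul_exp_neg_sq (k : ℕ) {b : ℝ} (hb : 0 < b) :
    Integrable fun x : EuclideanSpace ℝ (Fin n) => ‖x‖ ^ k * Real.exp (-b * ‖x‖ ^ 2) := by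
  rcases n.eq_zero_or_pos with rfl | hn
  · have : IsFiniteMeasure (volume : Measure (EuclideanSpace ℝ (Fin 0))) :=
      ⟨isCompact_univ.measure_lt_top⟩
    have h : (fun x : EuclideanSpace ℝ (Fin 0) => ‖x‖ ^ k * Real.exp (-b * ‖x‖ ^ 2)) =
        fun _ => ‖(0 : EuclideanSpace ℝ (Fin 0))‖ ^ k *
          Real.exp (-b * ‖(0 : EuclideanSpace ℝ (Fin 0))‖ ^ 2) :=
      funext fun x => by rw [Subsingleton.elim x 0]
    rw [h]
    exact integrable_const _
  · have : NeZero n := ⟨hn.ne'⟩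
    refine (integrable_fun_norm_addHaar (volume : Measure (EuclideanSpace ℝ (Fin n)))
      (f := fun r => r ^ k * Real.exp (-b * r ^ 2))).2 ?_
    refine (integrableOn_pow_mul_exp_neg_sq (n - 1 + k) hb).congr_fun (fun r _ => ?_)
      measurableSet_Ioi
    simp only [finrank_euclideanSpace, Fintype.card_fin, smul_eq_mul, pow_add]
    ring

theorem sphereMean_comp_norm [NeZero n] (φ : ℝ → ℝ) {r : ℝ} (hr : 0 ≤ r) :
    sphereMean (fun x : EuclideanSpace ℝ (Fin n) => φ ‖x‖) r = φ r := by
  have := sphereMean_radial_mul (n := n) (f := fun _ => 1) φ hr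
  simpa [sphereMean_one] using this

theorem integral_norm_sq_mul_exp :
    ∫ x : EuclideanSpace ℝ (Fin (n + 1)), ‖x‖ ^ 2 * Real.exp (-‖x‖ ^ 2) =
      sphereArea (n + 1) * ∫ r in Ioi (0 : ℝ), r ^ n * (r ^ 2 * Real.exp (-r ^ 2)) := by
  have hi : Integrable fun x : EuclideanSpace ℝ (Fin (n + 1)) => ‖x‖ ^ 2 * Real.exp (-‖x‖ ^ 2) := by
    simpa using integrable_norm_pow_mul_exp_neg_sq (n := n + 1) 2 one_pos
  rw [integral_eq_sphereMean hi, Nat.add_sub_cancel]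
  congr 1
  refine setIntegral_congr_fun measurableSet_Ioi fun r hr => ?_
  rw [sphereMean_comp_norm (fun r => r ^ 2 * Real.exp (-r ^ 2)) (le_of_lt hr)]

theorem integral_norm_sq_mul_exp_pos :
    0 < ∫ x : EuclideanSpace ℝ (Fin (n + 1)), ‖x‖ ^ 2 * Real.exp (-‖x‖ ^ 2) := by
  rw [integral_norm_sq_mul_exp]
  refine mul_pos sphereArea_pos ?_
  have hpos : ∀ r : ℝ, 0 < r → 0 < r ^ n * (r ^ 2 * Real.exp (-r ^ 2)) := fun r hr => by positivity
  rw [setIntegral_pos_iff_support_of_nonneg_ae]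
  · have : Ioi (0 : ℝ) ⊆ Function.support fun r : ℝ => r ^ n * (r ^ 2 * Real.exp (-r ^ 2)) :=
      fun r hr => (hpos r hr).ne'
    rw [inter_eq_right.2 this]
    simp
  · filter_upwards [ae_restrict_mem measurableSet_Ioi] with r hr using (hpos r hr).le
  · refine (integrableOn_pow_mul_exp_neg_sq (n + 2) one_pos).congr_fun (fun r _ => ?_)
      measurableSet_Ioi
    simp only [pow_add, neg_mul, one_mul]
    ring

/-- The additive form of the stability inequality, at scale one. -/
theorem IsTest.gap_mul_le {N : ℕ} (hN : 1 ≤ N) {u : EuclideanSpace ℝ (Fin N) → ℝ} (hu : IsTest u) :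
    gap N * ((∫ x, ‖(∇ u) x‖ ^ 2) - (∫ x, euler u x * Real.exp (-‖x‖ ^ 2 / 2)) ^ 2 /
        ∫ x : EuclideanSpace ℝ (Fin N), ‖x‖ ^ 2 * Real.exp (-‖x‖ ^ 2)) ≤
      (∫ x, (Δ u) x ^ 2) + (∫ x, ‖x‖ ^ 2 * ‖(∇ u) x‖ ^ 2) -
        (N + 2) * ∫ x, ‖(∇ u) x‖ ^ 2 := by
  obtain ⟨n, rfl⟩ : ∃ n, N = n + 1 := ⟨N - 1, by omega⟩
  have hS := sphereArea_pos (n := n + 1)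
  have hQ := integral_norm_sq_mul_exp_pos (n := n)
  have hQe := integral_norm_sq_mul_exp (n := n)
  obtain ⟨t, ht⟩ := hu.isRadialProfile.exists_integral_sq_sub_gaussian_le
  have hst := hu.stability_sphereMean
  obtain ⟨R, hR⟩ := hu.euler.exists_sphereMean_eq_zero
  set p : ℝ → ℝ := fun r => sphereMean (euler u) r / r with hp
  have hpR : ∀ r > 0, R ≤ r → p r = 0 := fun r h0 h1 => by simp [hp, hR r h0 h1]
  have hr : IsRegular fun r : ℝ => r := .of_continuous continuous_id
  have hrn : IsRegular fun r : ℝ => r ^ n := .of_continuous (by fun_prop)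
  have he : IsRegular fun r : ℝ => Real.exp (-r ^ 2 / 2) := .of_continuous (by fun_prop)
  have rp : IsRegular p := hu.isRadialProfile.regular_deriv
  have i1 : IntegrableOn (fun r => r ^ n * p r ^ 2) (Ioi 0) :=
    (hrn.mul rp.sq).integrableOn (R := R) fun r h0 h1 => by rw [hpR r h0 h1]; simp
  have i2 : IntegrableOn (fun r => r ^ n * (r * p r * Real.exp (-r ^ 2 / 2))) (Ioi 0) :=
    (hrn.mul ((hr.mul rp).mul he)).integrableOn (R := R)
      fun r h0 h1 => by rw [hpR r h0 h1]; simp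
  have i3 : IntegrableOn (fun r : ℝ => r ^ n * (r ^ 2 * Real.exp (-r ^ 2))) (Ioi 0) := by
    refine (integrableOn_pow_mul_exp_neg_sq (n + 2) one_pos).congr_fun (fun r _ => ?_)
      measurableSet_Ioi
    simp only [pow_add, neg_mul, one_mul]
    ring
  have i4 : IntegrableOn (fun r => r ^ n * p r ^ 2 -
      2 * t * (r ^ n * (r * p r * Real.exp (-r ^ 2 / 2)))) (Ioi 0) := i1.sub (i2.const_mul _)
  have hd : ∫ r in Ioi (0 : ℝ), r ^ n * (p r - t * r * Real.exp (-r ^ 2 / 2)) ^ 2 =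
      (∫ r in Ioi (0 : ℝ), r ^ n * p r ^ 2) -
        2 * t * (∫ r in Ioi (0 : ℝ), r ^ n * (r * p r * Real.exp (-r ^ 2 / 2))) +
        t ^ 2 * ∫ r in Ioi (0 : ℝ), r ^ n * (r ^ 2 * Real.exp (-r ^ 2)) := by
    rw [← integral_const_mul, ← integral_const_mul, ← integral_sub i1 (i2.const_mul _),
      ← integral_add i4 (i3.const_mul _)]
    refine setIntegral_congr_fun measurableSet_Ioi fun r _ => ?_
    have : Real.exp (-r ^ 2) = Real.exp (-r ^ 2 / 2) ^ 2 := by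
      rw [← Real.exp_nat_mul]
      congr 1
      push_cast
      ring
    simp only [this]
    ring
  have hP : ∫ x, euler u x * Real.exp (-‖x‖ ^ 2 / 2) = sphereArea (n + 1) *
      ∫ r in Ioi (0 : ℝ), r ^ n * (r * p r * Real.exp (-r ^ 2 / 2)) := by
    have hw : ContDiff ℝ ∞ fun x : EuclideanSpace ℝ (Fin (n + 1)) => Real.exp (-‖x‖ ^ 2 / 2) :=
      (((contDiff_norm_sq ℝ).neg).div_const _).exp
    rw [integral_eq_sphereMean (hu.euler.mul hw).integrable, Nat.add_sub_cancel]
    congr 1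
    refine setIntegral_congr_fun measurableSet_Ioi fun r hr => ?_
    have h0 : (0 : ℝ) < r := hr
    simp_rw [mul_comm (euler u _)]
    rw [sphereMean_radial_mul (fun r => Real.exp (-r ^ 2 / 2)) h0.le]
    simp only [hp]
    field_simp
  set P := ∫ x, euler u x * Real.exp (-‖x‖ ^ 2 / 2)
  set Q := ∫ x : EuclideanSpace ℝ (Fin (n + 1)), ‖x‖ ^ 2 * Real.exp (-‖x‖ ^ 2)
  set D := ∫ x, ‖(∇ u) x‖ ^ 2
  set S := sphereArea (n + 1)
  set I := ∫ r in Ioi (0 : ℝ), r ^ n * (p r - t * r * Real.exp (-r ^ 2 / 2)) ^ 2 with hI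
  have hI0 : 0 ≤ I := setIntegral_nonneg measurableSet_Ioi fun r hr =>
    mul_nonneg (pow_nonneg (le_of_lt hr) n) (sq_nonneg _)
  have hg0 : 0 ≤ gap (n + 1) := gap_nonneg (by omega)
  have hg2 := gap_le_two (n + 1)
  -- The left side is the minimum over t of the squared distance from ∇u to t x e^{−|x|²/2}. The
  -- latter splits into the nonradial energy and the radial distance I, which are weighted by gap
  -- and by 4 ≥ gap respectively.
  have h1 : D - P ^ 2 / Q ≤ D - 2 * t * P + t ^ 2 * Q := by
    have : (P - t * Q) ^ 2 / Q = P ^ 2 / Q - 2 * t * P + t ^ 2 * Q := by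
      field_simp
      ring
    have h2 : 0 ≤ (P - t * Q) ^ 2 / Q := by positivity
    linarith
  have h3 := mul_le_mul_of_nonneg_left h1 hg0
  have h4 := mul_le_mul_of_nonneg_left ht hS.le
  have h5 : gap (n + 1) * (S * I) ≤ 4 * (S * I) :=
    mul_le_mul_of_nonneg_right (by linarith) (mul_nonneg hS.le hI0)
  have h6 : gap (n + 1) * (D - 2 * t * P + t ^ 2 * Q) = gap (n + 1) *
      (D - S * ∫ r in Ioi (0 : ℝ), r ^ n * p r ^ 2) + gap (n + 1) * (S * I) := by
    rw [hd, hP, hQe]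
    ring
  push_cast
  linarith

/-! ### Dilations -/

theorem IsTest.comp_smul {u : EuclideanSpace ℝ (Fin n) → ℝ} (hu : IsTest u) {s : ℝ} (hs : 0 < s) :
    IsTest fun x => u (s • x) :=
  ⟨hu.1.comp (contDiff_const_smul s), hu.2.comp_homeomorph (Homeomorph.smulOfNeZero s hs.ne')⟩

theorem fderiv_dilation (u : EuclideanSpace ℝ (Fin n) → ℝ) (s : ℝ)
    (x : EuclideanSpace ℝ (Fin n)) :
    fderiv ℝ (fun x => u (s • x)) x = s • fderiv ℝ u (s • x) :=
  fderiv_comp_smul s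

theorem IsTest.laplacian_comp_smul {u : EuclideanSpace ℝ (Fin n) → ℝ} (hu : IsTest u) {s : ℝ}
    (hs : 0 < s) (x : EuclideanSpace ℝ (Fin n)) :
    (Δ fun x => u (s • x)) x = s ^ 2 * (Δ u) (s • x) := by
  rw [laplacian_eq_sum (hu.comp_smul hs).contDiff, laplacian_eq_sum hu.contDiff, Finset.mul_sum]
  refine Finset.sum_congr rfl fun i _ => ?_
  simp_rw [fderiv_dilation, smul_apply, smul_eq_mul]
  rw [fderiv_const_mul (((hu.fderiv_apply _).comp_smul hs).differentiable x),
    fderiv_dilation (fun y => fderiv ℝ u y (EuclideanSpace.basisFun (Fin n) ℝ i))]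
  simp only [smul_apply, smul_eq_mul]
  ring

theorem integral_dilation (f : EuclideanSpace ℝ (Fin n) → ℝ) {s : ℝ} (hs : 0 < s) :
    ∫ x, f (s • x) = (s ^ n)⁻¹ * ∫ x, f x := by
  rw [Measure.integral_comp_smul, finrank_euclideanSpace_fin, abs_of_pos (by positivity),
    smul_eq_mul]

/-- The squared norm of `x ↦ e^{-|x|²/(2s²)} x` in `L²`. -/
def gaussianGradNormSq (n : ℕ) (s : ℝ) : ℝ :=
  ∫ x : EuclideanSpace ℝ (Fin n), ‖x‖ ^ 2 * Real.exp (-‖x‖ ^ 2 / s ^ 2)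

theorem gaussianGradNormSq_eq (n : ℕ) {s : ℝ} (hs : 0 < s) :
    gaussianGradNormSq n s = s ^ n * s ^ 2 *
      ∫ x : EuclideanSpace ℝ (Fin n), ‖x‖ ^ 2 * Real.exp (-‖x‖ ^ 2) := by
  have h := integral_dilation
    (fun x : EuclideanSpace ℝ (Fin n) => ‖x‖ ^ 2 * Real.exp (-‖x‖ ^ 2 / s ^ 2)) hs
  have e : ∀ x : EuclideanSpace ℝ (Fin n), ‖s • x‖ ^ 2 * Real.exp (-‖s • x‖ ^ 2 / s ^ 2) =
      s ^ 2 * (‖x‖ ^ 2 * Real.exp (-‖x‖ ^ 2)) := fun x => by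
    rw [norm_smul, Real.norm_of_nonneg hs.le, mul_pow, mul_assoc]
    congr 3
    field_simp
  simp_rw [e] at h
  rw [integral_const_mul] at h
  rw [gaussianGradNormSq, mul_assoc, h]
  field_simp

theorem gaussianGradNormSq_pos {s : ℝ} (hs : 0 < s) : 0 < gaussianGradNormSq (n + 1) s := by
  rw [gaussianGradNormSq_eq _ hs]
  have := integral_norm_sq_mul_exp_pos (n := n)
  positivity

/-- The additive form of the stability inequality, at scale `s`. -/
theorem IsTest.gap_mul_le_of_scale {N : ℕ} (hN : 1 ≤ N) {u : EuclideanSpace ℝ (Fin N) → ℝ}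
    (hu : IsTest u) {s : ℝ} (hs : 0 < s) :
    gap N * ((∫ x, ‖(∇ u) x‖ ^ 2) -
        (∫ x, euler u x * Real.exp (-‖x‖ ^ 2 / (2 * s ^ 2))) ^ 2 / gaussianGradNormSq N s) ≤
      s ^ 2 * (∫ x, (Δ u) x ^ 2) + (∫ x, ‖x‖ ^ 2 * ‖(∇ u) x‖ ^ 2) / s ^ 2 -
        (N + 2) * ∫ x, ‖(∇ u) x‖ ^ 2 := by
  have h := (hu.comp_smul hs).gap_mul_le hN
  have hg (x : EuclideanSpace ℝ (Fin N)) :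
      ‖(∇ fun x => u (s • x)) x‖ ^ 2 = s ^ 2 * ‖(∇ u) (s • x)‖ ^ 2 := by
    rw [norm_gradient, norm_gradient, fderiv_dilation, norm_smul, mul_pow, Real.norm_eq_abs, sq_abs]
  have e1 : ∫ x, ‖(∇ fun x => u (s • x)) x‖ ^ 2 = s ^ 2 * ((s ^ N)⁻¹ * ∫ x, ‖(∇ u) x‖ ^ 2) := by
    simp_rw [hg]
    rw [integral_const_mul, integral_dilation (fun x => ‖(∇ u) x‖ ^ 2) hs]
  have e2 : ∫ x, (Δ fun x => u (s • x)) x ^ 2 = s ^ 4 * ((s ^ N)⁻¹ * ∫ x, (Δ u) x ^ 2) := by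
    simp_rw [hu.laplacian_comp_smul hs, mul_pow]
    have := integral_dilation (fun x : EuclideanSpace ℝ (Fin N) => (Δ u) x ^ 2) hs
    rw [integral_const_mul, this, ← pow_mul]
  have e3 : ∫ x, ‖x‖ ^ 2 * ‖(∇ fun x => u (s • x)) x‖ ^ 2 =
      (s ^ N)⁻¹ * ∫ x, ‖x‖ ^ 2 * ‖(∇ u) x‖ ^ 2 := by
    rw [← integral_dilation (fun x => ‖x‖ ^ 2 * ‖(∇ u) x‖ ^ 2) hs]
    congr 1
    ext x
    rw [hg, norm_smul, Real.norm_of_nonneg hs.le]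
    ring
  have e4 : ∫ x, euler (fun x => u (s • x)) x * Real.exp (-‖x‖ ^ 2 / 2) =
      (s ^ N)⁻¹ * ∫ x, euler u x * Real.exp (-‖x‖ ^ 2 / (2 * s ^ 2)) := by
    rw [← integral_dilation (fun x => euler u x * Real.exp (-‖x‖ ^ 2 / (2 * s ^ 2))) hs]
    congr 1
    ext x
    rw [euler, euler, fderiv_dilation, norm_smul, Real.norm_of_nonneg hs.le, smul_apply, map_smul]
    congr 2
    field_simp
  rw [e1, e2, e3, e4] at h
  rw [gaussianGradNormSq_eq _ hs]
  set Q := ∫ x : EuclideanSpace ℝ (Fin N), ‖x‖ ^ 2 * Real.exp (-‖x‖ ^ 2)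
  set P := ∫ x, euler u x * Real.exp (-‖x‖ ^ 2 / (2 * s ^ 2))
  have hsN : 0 < s ^ N := pow_pos hs N
  -- The factor undoes the Jacobian s^{−N} and the factor s² by which the Dirichlet integral scales.
  have h' := mul_le_mul_of_nonneg_left h (show 0 ≤ s ^ N / s ^ 2 by positivity)
  refine le_trans (le_of_eq ?_) (h'.trans (le_of_eq ?_))
  · rcases eq_or_ne Q 0 with hQ | hQ
    · rw [hQ]
      field_simp
    · field_simp
  · field_simp

/-- The choice b = n removes the term in ∫ u² and leaves (n + 2) ∫ |∇u|² ≤ ∫ |Δu|² + ∫ (x·∇u)². It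
shows that the seminorm defining X controls ∇u in L². -/
theorem IsTest.integral_norm_gradient_sq_le {u : EuclideanSpace ℝ (Fin n) → ℝ} (hu : IsTest u) :
    ∫ x, ‖(∇ u) x‖ ^ 2 ≤ (∫ x, (Δ u) x ^ 2) + ∫ x, ‖x‖ ^ 2 * ‖(∇ u) x‖ ^ 2 := by
  have h := hu.integral_sq_add_euler n
  have h0 : 0 ≤ ∫ x, ((Δ u) x + euler u x + n * u x) ^ 2 := integral_nonneg fun x => sq_nonneg _
  have hD : 0 ≤ ∫ x, ‖(∇ u) x‖ ^ 2 := integral_nonneg fun x => sq_nonneg _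
  have t1 : IsTest fun x => ‖x‖ ^ 2 * ‖(∇ u) x‖ ^ 2 := by
    have := hu.norm_gradient_sq.mul (contDiff_norm_sq ℝ)
    simpa only [mul_comm] using this
  have t2 : IsTest fun x => euler u x ^ 2 := by
    simpa only [pow_two] using hu.euler.mul hu.euler.1
  have h1 : ∫ x, euler u x ^ 2 ≤ ∫ x, ‖x‖ ^ 2 * ‖(∇ u) x‖ ^ 2 := by
    refine integral_mono t2.integrable t1.integrable fun x => ?_
    rw [← mul_pow, ← sq_abs (euler u x), mul_comm ‖x‖]
    exact pow_le_pow_left₀ (abs_nonneg _) (abs_euler_le u x) 2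
  have hn : (0 : ℝ) ≤ n := n.cast_nonneg
  nlinarith

/-! ### Passage to the completion -/

section L2

variable {α F : Type*} [MeasurableSpace α] {μ : Measure α} [NormedAddCommGroup F]

theorem eLpNorm_two_eq (f : α → F) : eLpNorm f 2 μ = (∫⁻ x, ‖f x‖ₑ ^ 2 ∂μ) ^ (1 / 2 : ℝ) := by
  rw [eLpNorm_eq_lintegral_rpow_enorm_toReal (by norm_num) (by norm_num)]
  simp

/-- Convergence in `L²`. -/
structure TendstoL2 (f : ℕ → α → F) (f₀ : α → F) (μ : Measure α) : Prop where
  memLp : ∀ j, MemLp (f j) 2 μ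
  memLp_lim : MemLp f₀ 2 μ
  tendsto : Tendsto (fun j => eLpNorm (f j - f₀) 2 μ) atTop (𝓝 0)

namespace TendstoL2

variable {f g : ℕ → α → F} {f₀ g₀ : α → F}

theorem of_lintegral (hf : ∀ j, MemLp (f j) 2 μ) (h0 : AEStronglyMeasurable f₀ μ)
    (h : Tendsto (fun j => ∫⁻ x, ‖f j x - f₀ x‖ₑ ^ 2 ∂μ) atTop (𝓝 0)) : TendstoL2 f f₀ μ := by
  have ht : Tendsto (fun j => eLpNorm (f j - f₀) 2 μ) atTop (𝓝 0) := by
    simp_rw [eLpNorm_two_eq]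
    have := (ENNReal.continuous_rpow_const (y := (1 / 2 : ℝ))).tendsto 0
    rw [ENNReal.zero_rpow_of_pos (by norm_num)] at this
    exact this.comp h
  refine ⟨hf, ?_, ht⟩
  obtain ⟨j, hj⟩ := (ht.eventually_lt_const (show (0 : ℝ≥0∞) < ⊤ by simp)).exists
  have : MemLp (f j - f₀) 2 μ := ⟨(hf j).1.sub h0, hj⟩
  simpa using (hf j).sub this

theorem const (hf : MemLp f₀ 2 μ) : TendstoL2 (fun _ => f₀) f₀ μ := ⟨fun _ => hf, hf, by simp⟩

theorem tendsto_toLp (h : TendstoL2 f f₀ μ) :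
    Tendsto (fun j => (h.memLp j).toLp (f j)) atTop (𝓝 (h.memLp_lim.toLp f₀)) :=
  (Lp.tendsto_Lp_iff_tendsto_eLpNorm'' f h.memLp f₀ h.memLp_lim).2 h.tendsto

theorem tendsto_integral_inner [InnerProductSpace ℝ F] (hf : TendstoL2 f f₀ μ)
    (hg : TendstoL2 g g₀ μ) :
    Tendsto (fun j => ∫ x, inner ℝ (f j x) (g j x) ∂μ) atTop
      (𝓝 (∫ x, inner ℝ (f₀ x) (g₀ x) ∂μ)) := by
  have e {a b : α → F} (ha : MemLp a 2 μ) (hb : MemLp b 2 μ) :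
      inner ℝ (ha.toLp a) (hb.toLp b) = ∫ x, inner ℝ (a x) (b x) ∂μ := by
    rw [L2.inner_def]
    refine integral_congr_ae ?_
    filter_upwards [ha.coeFn_toLp, hb.coeFn_toLp] with x h1 h2
    rw [h1, h2]
  have h := hf.tendsto_toLp.inner hg.tendsto_toLp (𝕜 := ℝ)
  simpa only [e] using h

theorem tendsto_integral_norm_sq [InnerProductSpace ℝ F] (hf : TendstoL2 f f₀ μ) :
    Tendsto (fun j => ∫ x, ‖f j x‖ ^ 2 ∂μ) atTop (𝓝 (∫ x, ‖f₀ x‖ ^ 2 ∂μ)) := by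
  simpa only [real_inner_self_eq_norm_sq] using hf.tendsto_integral_inner hf

theorem exists_subseq_tendsto_ae (h : TendstoL2 f f₀ μ) :
    ∃ ns : ℕ → ℕ, StrictMono ns ∧ ∀ᵐ x ∂μ, Tendsto (fun i => f (ns i) x) atTop (𝓝 (f₀ x)) :=
  (tendstoInMeasure_of_tendsto_eLpNorm (by norm_num) (fun j => (h.memLp j).1) h.memLp_lim.1
    h.tendsto).exists_seq_tendsto_ae

end TendstoL2

theorem enorm_sub_sq_le (a b c : F) :
    ‖a - b‖ₑ ^ 2 ≤ 2 * ‖a - c‖ₑ ^ 2 + 2 * ‖b - c‖ₑ ^ 2 := by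
  have h : ‖a - b‖ ^ 2 ≤ 2 * ‖a - c‖ ^ 2 + 2 * ‖b - c‖ ^ 2 := by
    have h1 : ‖a - b‖ ≤ ‖a - c‖ + ‖b - c‖ := by
      rw [← sub_sub_sub_cancel_right a b c]
      exact norm_sub_le _ _
    have h2 := pow_le_pow_left₀ (norm_nonneg _) h1 2
    nlinarith [sq_nonneg (‖a - c‖ - ‖b - c‖)]
  have h' := ENNReal.ofReal_le_ofReal h
  rw [ENNReal.ofReal_add (by positivity) (by positivity), ENNReal.ofReal_mul (by norm_num),
    ENNReal.ofReal_mul (by norm_num)] at h'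
  simpa only [ENNReal.ofReal_pow (norm_nonneg _), ofReal_norm, ENNReal.ofReal_ofNat] using h'

end L2

theorem isWeakGradient_weakGradient {u : EuclideanSpace ℝ (Fin n) → ℝ}
    (h : ∃ G, IsWeakGradient u G) : IsWeakGradient u (weakGradient u) := by
  rw [weakGradient, dif_pos h]
  exact h.choose_spec

theorem isWeakLaplacian_weakLaplacian {u : EuclideanSpace ℝ (Fin n) → ℝ}
    (h : ∃ L, IsWeakLaplacian u L) : IsWeakLaplacian u (weakLaplacian u) := by
  rw [weakLaplacian, dif_pos h]
  exact h.choose_spec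

theorem IsTest.gradient_sub {u v : EuclideanSpace ℝ (Fin n) → ℝ} (hu : IsTest u) (hv : IsTest v)
    (x : EuclideanSpace ℝ (Fin n)) : (∇ fun x => u x - v x) x = (∇ u) x - (∇ v) x := by
  rw [gradient, fderiv_fun_sub (hu.differentiable x) (hv.differentiable x), map_sub]
  rfl

theorem IsTest.laplacian_sub {u v : EuclideanSpace ℝ (Fin n) → ℝ} (hu : IsTest u) (hv : IsTest v)
    (x : EuclideanSpace ℝ (Fin n)) : (Δ fun x => u x - v x) x = (Δ u) x - (Δ v) x := by
  rw [laplacian_eq_sum (hu.sub hv).contDiff, laplacian_eq_sum hu.contDiff,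
    laplacian_eq_sum hv.contDiff, ← Finset.sum_sub_distrib]
  refine Finset.sum_congr rfl fun i _ => ?_
  have e (y : EuclideanSpace ℝ (Fin n)) : fderiv ℝ (fun x => u x - v x) y =
      fderiv ℝ u y - fderiv ℝ v y := fderiv_fun_sub (hu.differentiable y) (hv.differentiable y)
  simp_rw [e, sub_apply]
  rw [fderiv_fun_sub ((hu.fderiv_apply _).differentiable x) ((hv.fderiv_apply _).differentiable x),
    sub_apply]

theorem IsTest.lintegral_norm_gradient_sq_le {u : EuclideanSpace ℝ (Fin n) → ℝ} (hu : IsTest u) :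
    ∫⁻ x, ‖(∇ u) x‖ₑ ^ 2 ≤
      (∫⁻ x, ‖(Δ u) x‖ₑ ^ 2) + ∫⁻ x, ‖x‖ₑ ^ 2 * ‖(∇ u) x‖ₑ ^ 2 := by
  have t1 : IsTest fun x => ‖x‖ ^ 2 * ‖(∇ u) x‖ ^ 2 := by
    have := hu.norm_gradient_sq.mul (contDiff_norm_sq ℝ)
    simpa only [mul_comm] using this
  have t2 : IsTest fun x => (Δ u) x ^ 2 := by
    simpa only [pow_two] using hu.laplacian.mul hu.laplacian.1
  have h := ENNReal.ofReal_le_ofReal hu.integral_norm_gradient_sq_le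
  rw [ENNReal.ofReal_add (integral_nonneg fun x => by positivity)
    (integral_nonneg fun x => by positivity),
    ofReal_integral_eq_lintegral_ofReal hu.norm_gradient_sq.integrable
      (Eventually.of_forall fun x => by positivity),
    ofReal_integral_eq_lintegral_ofReal t1.integrable (Eventually.of_forall fun x => by positivity),
    ofReal_integral_eq_lintegral_ofReal t2.integrable
      (Eventually.of_forall fun x => by positivity)] at h
  have e (x : EuclideanSpace ℝ (Fin n)) : (Δ u) x ^ 2 = ‖(Δ u) x‖ ^ 2 := by
    rw [Real.norm_eq_abs, sq_abs]
  simp_rw [e] at h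
  simpa only [ENNReal.ofReal_pow (norm_nonneg _), ENNReal.ofReal_mul (sq_nonneg _),
    ofReal_norm] using h

theorem IsTest.memLp_gradient {u : EuclideanSpace ℝ (Fin n) → ℝ} (hu : IsTest u) :
    MemLp (∇ u) 2 volume :=
  (continuous_gradient hu.contDiff).memLp_of_hasCompactSupport hu.hasCompactSupport_gradient

theorem IsTest.memLp_norm_smul_gradient {u : EuclideanSpace ℝ (Fin n) → ℝ} (hu : IsTest u) :
    MemLp (fun x => ‖x‖ • (∇ u) x) 2 volume :=
  (continuous_norm.smul (continuous_gradient hu.contDiff)).memLp_of_hasCompactSupport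
    hu.hasCompactSupport_gradient.smul_left

/-- The first two convergences are the definition of X. The unweighted convergence of gradients is
extra: the gradients are Cauchy by the a priori bound, and their limit is identified by almost
everywhere convergence of the weighted ones along a subsequence. -/
theorem MemX.exists_tendstoL2 {N : ℕ} [NeZero N] {u : EuclideanSpace ℝ (Fin N) → ℝ}
    (hu : MemX u) : ∃ φ : ℕ → EuclideanSpace ℝ (Fin N) → ℝ, (∀ j, IsTest (φ j)) ∧
      TendstoL2 (fun j => Δ (φ j)) (weakLaplacian u) volume ∧
      TendstoL2 (fun j x => ‖x‖ • (∇ (φ j)) x) (fun x => ‖x‖ • weakGradient u x) volume ∧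
      TendstoL2 (fun j => ∇ (φ j)) (weakGradient u) volume := by
  obtain ⟨φ, hφ, hlim⟩ := hu.approx
  have mG := (isWeakGradient_weakGradient hu.hasGradient).2.1.aestronglyMeasurable
  have mL := (isWeakLaplacian_weakLaplacian hu.hasLaplacian).2.1.aestronglyMeasurable
  set G := weakGradient u
  set L := weakLaplacian u
  have e1 (x a b : EuclideanSpace ℝ (Fin N)) :
      ‖‖x‖ • a - ‖x‖ • b‖ₑ ^ 2 = ‖x‖ₑ ^ 2 * ‖a - b‖ₑ ^ 2 := by
    rw [← smul_sub, enorm_smul, enorm_norm, mul_pow]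
  have h1 : TendstoL2 (fun j => Δ (φ j)) L volume :=
    .of_lintegral (fun j => (hφ j).laplacian.continuous.memLp_of_hasCompactSupport
      (hφ j).laplacian.2) mL
      (tendsto_of_tendsto_of_tendsto_of_le_of_le tendsto_const_nhds hlim (fun _ => zero_le)
        fun j => le_self_add)
  have h2 : TendstoL2 (fun j x => ‖x‖ • (∇ (φ j)) x) (fun x => ‖x‖ • G x) volume := by
    refine .of_lintegral (fun j => (hφ j).memLp_norm_smul_gradient)
      (continuous_norm.aestronglyMeasurable.smul mG) ?_
    simp_rw [e1]
    exact tendsto_of_tendsto_of_tendsto_of_le_of_le tendsto_const_nhds hlim (fun _ => zero_le)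
      fun j => le_add_self
  refine ⟨φ, hφ, h1, h2, .of_lintegral (fun j => (hφ j).memLp_gradient) mG ?_⟩
  set ε : ℕ → ℝ≥0∞ := fun j => (∫⁻ x, ‖(Δ (φ j)) x - L x‖ₑ ^ 2) +
    ∫⁻ x, ‖x‖ₑ ^ 2 * ‖(∇ (φ j)) x - G x‖ₑ ^ 2 with hε
  obtain ⟨ns, hns, hae⟩ := h2.exists_subseq_tendsto_ae
  have hcg (j : ℕ) : Continuous (∇ (φ j)) := continuous_gradient (hφ j).contDiff
  have hcl (j : ℕ) : Continuous (Δ (φ j)) := (hφ j).laplacian.continuous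
  have hpair (j k : ℕ) : ∫⁻ x, ‖(∇ (φ j)) x - (∇ (φ k)) x‖ₑ ^ 2 ≤ 2 * ε j + 2 * ε k := by
    have h := ((hφ j).sub (hφ k)).lintegral_norm_gradient_sq_le
    simp_rw [(hφ j).gradient_sub (hφ k), (hφ j).laplacian_sub (hφ k)] at h
    have hA : ∫⁻ x, ‖(Δ (φ j)) x - (Δ (φ k)) x‖ₑ ^ 2 ≤
        2 * (∫⁻ x, ‖(Δ (φ j)) x - L x‖ₑ ^ 2) + 2 * ∫⁻ x, ‖(Δ (φ k)) x - L x‖ₑ ^ 2 := by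
      rw [← lintegral_const_mul' _ _ (by norm_num), ← lintegral_const_mul' _ _ (by norm_num),
        ← lintegral_add_left' (by fun_prop)]
      exact lintegral_mono fun x => enorm_sub_sq_le _ _ _
    have hB : ∫⁻ x, ‖x‖ₑ ^ 2 * ‖(∇ (φ j)) x - (∇ (φ k)) x‖ₑ ^ 2 ≤
        2 * (∫⁻ x, ‖x‖ₑ ^ 2 * ‖(∇ (φ j)) x - G x‖ₑ ^ 2) +
          2 * ∫⁻ x, ‖x‖ₑ ^ 2 * ‖(∇ (φ k)) x - G x‖ₑ ^ 2 := by
      rw [← lintegral_const_mul' _ _ (by norm_num), ← lintegral_const_mul' _ _ (by norm_num),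
        ← lintegral_add_left' (by fun_prop)]
      refine lintegral_mono fun x => ?_
      refine (mul_le_mul_right (enorm_sub_sq_le _ _ (G x)) _).trans (le_of_eq ?_)
      ring
    refine h.trans ((add_le_add hA hB).trans (le_of_eq ?_))
    simp only [hε]
    ring
  -- Fatou along the almost everywhere convergent subsequence; the weight |x| may be divided out off
  -- the origin.
  have hbound (j : ℕ) : ∫⁻ x, ‖(∇ (φ j)) x - G x‖ₑ ^ 2 ≤ 2 * ε j := by
    have hae' : ∀ᵐ x : EuclideanSpace ℝ (Fin N), ‖(∇ (φ j)) x - G x‖ₑ ^ 2 =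
        liminf (fun i => ‖(∇ (φ j)) x - (∇ (φ (ns i))) x‖ₑ ^ 2) atTop := by
      have h0 : ∀ᵐ x : EuclideanSpace ℝ (Fin N), x ≠ 0 := by simp [ae_iff]
      filter_upwards [hae, h0] with x hx hx0
      have hx' : Tendsto (fun i => (∇ (φ (ns i))) x) atTop (𝓝 (G x)) := by
        have := hx.const_smul ‖x‖⁻¹
        simpa only [smul_smul, inv_mul_cancel₀ (norm_ne_zero_iff.2 hx0), one_smul] using this
      refine (Tendsto.liminf_eq ?_).symm
      exact ((ENNReal.continuous_pow 2).tendsto _).comp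
        ((continuous_enorm.tendsto _).comp (tendsto_const_nhds.sub hx'))
    rw [lintegral_congr_ae hae']
    refine (lintegral_liminf_le' fun i => by fun_prop).trans ?_
    refine (liminf_le_liminf (Eventually.of_forall fun i => hpair j (ns i))).trans (le_of_eq ?_)
    refine Tendsto.liminf_eq ?_
    have : Tendsto (fun i => 2 * ε (ns i)) atTop (𝓝 (2 * 0)) :=
      ENNReal.Tendsto.const_mul (hlim.comp hns.tendsto_atTop) (Or.inr (by norm_num))
    simpa using tendsto_const_nhds.add this
  have h2ε : Tendsto (fun j => 2 * ε j) atTop (𝓝 0) := by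
    simpa using ENNReal.Tendsto.const_mul hlim (Or.inr (by norm_num : (2 : ℝ≥0∞) ≠ ⊤))
  exact tendsto_of_tendsto_of_tendsto_of_le_of_le tendsto_const_nhds h2ε (fun _ => zero_le) hbound

/-! ### Gaussians and the distance to them -/

/-- The vector field `x ↦ e^{-|x|²/(2s²)} x`. -/
def gaussianField (n : ℕ) (s : ℝ) (x : EuclideanSpace ℝ (Fin n)) : EuclideanSpace ℝ (Fin n) :=
  Real.exp (-‖x‖ ^ 2 / (2 * s ^ 2)) • x

theorem norm_gaussianField_sq (s : ℝ) (x : EuclideanSpace ℝ (Fin n)) :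
    ‖gaussianField n s x‖ ^ 2 = ‖x‖ ^ 2 * Real.exp (-‖x‖ ^ 2 / s ^ 2) := by
  rw [gaussianField, norm_smul, mul_pow, Real.norm_of_nonneg (Real.exp_pos _).le,
    ← Real.exp_nat_mul, mul_comm]
  congr 2
  push_cast
  ring

theorem continuous_gaussianField (s : ℝ) : Continuous (gaussianField n s) := by
  unfold gaussianField
  fun_prop

theorem memLp_gaussianField {s : ℝ} (hs : 0 < s) : MemLp (gaussianField n s) 2 volume := by
  rw [memLp_two_iff_integrable_sq_norm (continuous_gaussianField s).aestronglyMeasurable]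
  simp_rw [norm_gaussianField_sq]
  have := integrable_norm_pow_mul_exp_neg_sq (n := n) 2 (b := 1 / s ^ 2) (by positivity)
  refine this.congr (Eventually.of_forall fun x => ?_)
  change _ * Real.exp _ = _ * Real.exp _
  congr 2
  ring

theorem integral_norm_gaussianField_sq (s : ℝ) :
    ∫ x, ‖gaussianField n s x‖ ^ 2 = gaussianGradNormSq n s := by
  simp_rw [norm_gaussianField_sq]
  rfl

theorem isWeakGradient_of_contDiff {w : EuclideanSpace ℝ (Fin n) → ℝ} (hw : ContDiff ℝ 1 w) :
    IsWeakGradient w (∇ w) := by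
  have hg := continuous_gradient hw
  refine ⟨hw.continuous.locallyIntegrable, hg.locallyIntegrable, fun φ hφ => ?_⟩
  have hgφ : Continuous (∇ φ) := continuous_gradient hφ.contDiff
  have i1 : Integrable fun x => w x • (∇ φ) x :=
    (hw.continuous.smul hgφ).integrable_of_hasCompactSupport
      hφ.hasCompactSupport_gradient.smul_left
  have i2 : Integrable fun x => φ x • (∇ w) x :=
    (hφ.continuous.smul hg).integrable_of_hasCompactSupport hφ.2.smul_right
  refine ext_inner_left ℝ fun v => ?_
  rw [← integral_inner i1, inner_neg_right, ← integral_inner i2]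
  have h := hφ.integral_mul_fderiv hw v
  have e (f : EuclideanSpace ℝ (Fin n) → ℝ) (x : EuclideanSpace ℝ (Fin n)) :
      inner ℝ v ((∇ f) x) = fderiv ℝ f x v := by rw [real_inner_comm, inner_gradient_left]
  simp_rw [inner_smul_right, e, h, neg_neg, mul_comm (w _)]

/-- Links the two parametrizations: β = 1/(2s²), and the amplitude −c s² makes the gradient c times
the field. -/
theorem gradient_gaussian {s : ℝ} (hs : 0 < s) (c : ℝ) (x : EuclideanSpace ℝ (Fin n)) :
    (∇ fun x : EuclideanSpace ℝ (Fin n) =>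
      -c * s ^ 2 * Real.exp (-(1 / (2 * s ^ 2)) * ‖x‖ ^ 2)) x = c • gaussianField n s x := by
  refine ext_inner_right ℝ fun v => ?_
  rw [inner_gradient_left]
  have h : HasFDerivAt (fun x : EuclideanSpace ℝ (Fin n) =>
      -c * s ^ 2 * Real.exp (-(1 / (2 * s ^ 2)) * ‖x‖ ^ 2)) _ x :=
    ((((hasStrictFDerivAt_norm_sq x).hasFDerivAt.const_mul _).exp).const_mul _)
  rw [h.fderiv]
  have e : -(1 / (2 * s ^ 2)) * ‖x‖ ^ 2 = -‖x‖ ^ 2 / (2 * s ^ 2) := by ring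
  simp only [gaussianField, smul_apply, innerSL_apply_apply, smul_eq_mul, real_inner_smul_left, e]
  simp
  field_simp

theorem gradNormSq_eq {u : EuclideanSpace ℝ (Fin n) → ℝ}
    {G : EuclideanSpace ℝ (Fin n) → EuclideanSpace ℝ (Fin n)} (h : IsWeakGradient u G) :
    gradNormSq u = ∫ x, ‖G x‖ ^ 2 := by
  refine integral_congr_ae ?_
  filter_upwards [(isWeakGradient_weakGradient ⟨G, h⟩).ae_eq h] with x hx
  rw [hx]

theorem IsWeakGradient.sub {u v : EuclideanSpace ℝ (Fin n) → ℝ}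
    {G H : EuclideanSpace ℝ (Fin n) → EuclideanSpace ℝ (Fin n)} (hu : IsWeakGradient u G)
    (hv : IsWeakGradient v H) : IsWeakGradient (fun x => u x - v x) fun x => G x - H x := by
  refine ⟨hu.1.sub hv.1, hu.2.1.sub hv.2.1, fun φ hφ => ?_⟩
  have hgφ : Continuous (∇ φ) := continuous_gradient hφ.contDiff
  simp_rw [sub_smul, smul_sub]
  rw [integral_sub, integral_sub, hu.2.2 φ hφ, hv.2.2 φ hφ]
  · abel
  · exact hu.2.1.integrable_smul_left_of_hasCompactSupport hφ.continuous hφ.2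
  · exact hv.2.1.integrable_smul_left_of_hasCompactSupport hφ.continuous hφ.2
  · exact hu.1.integrable_smul_right_of_hasCompactSupport hgφ hφ.hasCompactSupport_gradient
  · exact hv.1.integrable_smul_right_of_hasCompactSupport hgφ hφ.hasCompactSupport_gradient

theorem integral_norm_sub_smul_sq {α F : Type*} [MeasurableSpace α] {μ : Measure α}
    [NormedAddCommGroup F] [InnerProductSpace ℝ F] {f g : α → F} (hf : MemLp f 2 μ)
    (hg : MemLp g 2 μ) (c : ℝ) :
    ∫ x, ‖f x - c • g x‖ ^ 2 ∂μ = (∫ x, ‖f x‖ ^ 2 ∂μ) - 2 * c * (∫ x, inner ℝ (f x) (g x) ∂μ) +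
      c ^ 2 * ∫ x, ‖g x‖ ^ 2 ∂μ := by
  have i1 := (memLp_two_iff_integrable_sq_norm hf.1).1 hf
  have i2 := (memLp_two_iff_integrable_sq_norm hg.1).1 hg
  have i3 : Integrable (fun x => inner ℝ (f x) (g x)) μ := by
    have h := L2.integrable_inner (𝕜 := ℝ) (hf.toLp f) (hg.toLp g)
    refine h.congr ?_
    filter_upwards [hf.coeFn_toLp, hg.coeFn_toLp] with x h1 h2
    rw [h1, h2]
  have i4 : Integrable (fun x => ‖f x‖ ^ 2 - 2 * c * inner ℝ (f x) (g x)) μ :=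
    i1.sub (i3.const_mul _)
  rw [← integral_const_mul, ← integral_const_mul, ← integral_sub i1 (i3.const_mul _),
    ← integral_add i4 (i2.const_mul _)]
  congr 1
  ext x
  rw [norm_sub_sq_real, inner_smul_right, norm_smul, mul_pow, Real.norm_eq_abs, sq_abs]
  ring

theorem sq_integral_inner_div_le {α F : Type*} [MeasurableSpace α] {μ : Measure α}
    [NormedAddCommGroup F] [InnerProductSpace ℝ F] {f g : α → F} (hf : MemLp f 2 μ)
    (hg : MemLp g 2 μ) (h0 : 0 < ∫ x, ‖g x‖ ^ 2 ∂μ) :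
    (∫ x, inner ℝ (f x) (g x) ∂μ) ^ 2 / (∫ x, ‖g x‖ ^ 2 ∂μ) ≤ ∫ x, ‖f x‖ ^ 2 ∂μ := by
  have h := integral_norm_sub_smul_sq hf hg
    ((∫ x, inner ℝ (f x) (g x) ∂μ) / ∫ x, ‖g x‖ ^ 2 ∂μ)
  have h1 : 0 ≤ ∫ x, ‖f x - ((∫ x, inner ℝ (f x) (g x) ∂μ) / ∫ x, ‖g x‖ ^ 2 ∂μ) • g x‖ ^ 2 ∂μ :=
    integral_nonneg fun x => sq_nonneg _
  rw [h] at h1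
  field_simp at h1 ⊢
  linarith

/-- Let D = ‖∇u‖², let P be the inner product of ∇u with the Gaussian field and Q the squared norm
of that field. The competitor with gradient c times the field and c²Q = D is at squared distance 2D
− 2cP. With c of the sign of P, Cauchy–Schwarz gives cP ≥ P²/Q, hence a bound by 2(D − P²/Q). -/
theorem normalizedDistSq_le {N : ℕ} (hN : 1 ≤ N) {u : EuclideanSpace ℝ (Fin N) → ℝ}
    (hu : ∃ G, IsWeakGradient u G) (hG : MemLp (weakGradient u) 2 volume) {s : ℝ} (hs : 0 < s) :
    normalizedDistSq u ≤ 2 * (gradNormSq u -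
      (∫ x, inner ℝ (weakGradient u x) (gaussianField N s x)) ^ 2 / gaussianGradNormSq N s) := by
  have hQ : 0 < gaussianGradNormSq N s := by
    obtain ⟨k, rfl⟩ : ∃ k, N = k + 1 := ⟨N - 1, by omega⟩
    exact gaussianGradNormSq_pos hs
  have hg := memLp_gaussianField (n := N) hs
  have hcs := sq_integral_inner_div_le hG hg (by rwa [integral_norm_gaussianField_sq])
  have hexp := integral_norm_sub_smul_sq hG hg
  rw [integral_norm_gaussianField_sq] at hcs hexp
  set P := ∫ x, inner ℝ (weakGradient u x) (gaussianField N s x)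
  set Q := gaussianGradNormSq N s
  change P ^ 2 / Q ≤ gradNormSq u at hcs
  change ∀ c, _ = gradNormSq u - 2 * c * P + c ^ 2 * Q at hexp
  set D := gradNormSq u
  have hD : 0 ≤ D := integral_nonneg fun x => sq_nonneg _
  obtain ⟨c, hc1, hc2⟩ : ∃ c : ℝ, c ^ 2 * Q = D ∧ P ^ 2 / Q ≤ c * P := by
    have hb : |P / Q| ≤ √(D / Q) := by
      refine Real.abs_le_sqrt ?_
      rw [div_pow, pow_two Q, ← div_div]
      exact div_le_div_of_nonneg_right hcs hQ.le
    have hsq : √(D / Q) ^ 2 * Q = D := by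
      rw [Real.sq_sqrt (by positivity)]
      field_simp
    rcases le_total 0 P with hP | hP
    · refine ⟨√(D / Q), hsq, ?_⟩
      have := mul_le_mul_of_nonneg_right ((le_abs_self _).trans hb) hP
      calc P ^ 2 / Q = P / Q * P := by ring
        _ ≤ _ := this
    · refine ⟨-√(D / Q), by rw [neg_sq, hsq], ?_⟩
      have := mul_le_mul_of_nonneg_right ((neg_le_abs _).trans hb) (neg_nonneg.2 hP)
      calc P ^ 2 / Q = -(P / Q) * -P := by ring
        _ ≤ √(D / Q) * -P := this
        _ = _ := by ring
  set w : EuclideanSpace ℝ (Fin N) → ℝ := fun x =>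
    -c * s ^ 2 * Real.exp (-(1 / (2 * s ^ 2)) * ‖x‖ ^ 2) with hw
  have hwc : ContDiff ℝ 1 w := by
    have : ContDiff ℝ 1 fun x : EuclideanSpace ℝ (Fin N) => ‖x‖ ^ 2 := contDiff_norm_sq ℝ
    fun_prop
  have hwg : IsWeakGradient w fun x => c • gaussianField N s x := by
    have h := isWeakGradient_of_contDiff hwc
    rwa [show ∇ w = fun x => c • gaussianField N s x from
      funext fun x => gradient_gaussian hs c x] at h
  have h1 : gradNormSq w = c ^ 2 * Q := by
    rw [gradNormSq_eq hwg]
    simp_rw [norm_smul, mul_pow, Real.norm_eq_abs, sq_abs]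
    rw [integral_const_mul, integral_norm_gaussianField_sq]
  have h2 : gradNormSq (fun x => u x - w x) = D - 2 * c * P + c ^ 2 * Q := by
    rw [gradNormSq_eq ((isWeakGradient_weakGradient hu).sub hwg), hexp]
  have h3 : normalizedDistSq u ≤ gradNormSq (fun x => u x - w x) := by
    refine csInf_le ⟨0, ?_⟩ ⟨w, ⟨-c * s ^ 2, 1 / (2 * s ^ 2), by positivity, rfl⟩, ?_, rfl⟩
    · rintro d ⟨v, -, -, rfl⟩
      exact integral_nonneg fun x => sq_nonneg _
    · rw [h1, hc1]
  rw [h2, hc1] at h3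
  linarith

theorem normalizedDistSq_nonneg (u : EuclideanSpace ℝ (Fin n) → ℝ) : 0 ≤ normalizedDistSq u := by
  refine Real.sInf_nonneg ?_
  rintro d ⟨v, -, -, rfl⟩
  exact integral_nonneg fun x => sq_nonneg _

/-! ### The stability inequality -/

theorem MemX.gap_mul_le_of_scale {N : ℕ} (hN : 1 ≤ N) {u : EuclideanSpace ℝ (Fin N) → ℝ}
    (hu : MemX u) {s : ℝ} (hs : 0 < s) :
    gap N * (gradNormSq u - (∫ x, inner ℝ (weakGradient u x) (gaussianField N s x)) ^ 2 /
        gaussianGradNormSq N s) ≤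
      s ^ 2 * (∫ x, weakLaplacian u x ^ 2) + (∫ x, ‖x‖ ^ 2 * ‖weakGradient u x‖ ^ 2) / s ^ 2 -
        (N + 2) * gradNormSq u := by
  have : NeZero N := ⟨by omega⟩
  obtain ⟨φ, hφ, hL, hW, hG⟩ := hu.exists_tendstoL2
  have l1 := hL.tendsto_integral_norm_sq
  have l2 := hW.tendsto_integral_norm_sq
  have l3 := hG.tendsto_integral_norm_sq
  have l4 := hG.tendsto_integral_inner (.const (memLp_gaussianField hs))
  simp_rw [Real.norm_eq_abs, sq_abs] at l1
  simp_rw [norm_smul, norm_norm, mul_pow] at l2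
  refine le_of_tendsto_of_tendsto ((l3.sub ((l4.pow 2).div_const _)).const_mul _)
    (((l1.const_mul _).add (l2.div_const _)).sub (l3.const_mul _)) (Eventually.of_forall fun j => ?_)
  have h := (hφ j).gap_mul_le_of_scale hN hs
  have e (x : EuclideanSpace ℝ (Fin N)) : inner ℝ ((∇ (φ j)) x) (gaussianField N s x) =
      euler (φ j) x * Real.exp (-‖x‖ ^ 2 / (2 * s ^ 2)) := by
    rw [gaussianField, inner_smul_right, inner_gradient_left, euler, mul_comm]
  simp only [e]
  exact h

/-- With t = s², the estimate at scale s has tA + B/t on the right, A = ∫ |Δu|² and B = ∫ |x|²|∇u|².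
Its minimum 2√A√B turns the right side into twice the deficit. -/
theorem MemX.gap_mul_normalizedDistSq_le {N : ℕ} (hN : 1 ≤ N) {u : EuclideanSpace ℝ (Fin N) → ℝ}
    (hu : MemX u) : gap N / 4 * normalizedDistSq u ≤ deficit u := by
  have : NeZero N := ⟨by omega⟩
  have hG : MemLp (weakGradient u) 2 volume := by
    obtain ⟨φ, -, -, -, h⟩ := hu.exists_tendstoL2
    exact h.memLp_lim
  have hg0 := gap_nonneg hN
  have hdist {s : ℝ} (hs : 0 < s) := normalizedDistSq_le hN hu.hasGradient hG hs
  have hscale {s : ℝ} (hs : 0 < s) := hu.gap_mul_le_of_scale hN hs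
  have key (t : ℝ) (ht : 0 < t) : gap N / 2 * normalizedDistSq u ≤
      t * (∫ x, weakLaplacian u x ^ 2) + (∫ x, ‖x‖ ^ 2 * ‖weakGradient u x‖ ^ 2) / t -
        (N + 2) * gradNormSq u := by
    have h1 := hdist (Real.sqrt_pos.2 ht)
    have h2 := hscale (Real.sqrt_pos.2 ht)
    rw [Real.sq_sqrt ht.le] at h2
    have h3 := mul_le_mul_of_nonneg_left h1 (by linarith : 0 ≤ gap N / 2)
    linarith
  rw [deficit]
  have hd0 := normalizedDistSq_nonneg u
  have hA : 0 ≤ ∫ x, weakLaplacian u x ^ 2 := integral_nonneg fun x => sq_nonneg _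
  have hB : 0 ≤ ∫ x, ‖x‖ ^ 2 * ‖weakGradient u x‖ ^ 2 := integral_nonneg fun x => by positivity
  have hD : 0 ≤ gradNormSq u := integral_nonneg fun x => sq_nonneg _
  set A := ∫ x, weakLaplacian u x ^ 2
  set B := ∫ x, ‖x‖ ^ 2 * ‖weakGradient u x‖ ^ 2
  set D := gradNormSq u
  have hgd : 0 ≤ gap N / 2 * normalizedDistSq u := by positivity
  -- When A = 0 or B = 0 the infimum over t is not attained: t is taken so large, respectively so
  -- small, that the remaining term drops below c, which forces c ≤ 0.
  rcases hA.eq_or_lt with hA0 | hA0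
  · have hD0 : (N + 2) * D + gap N / 2 * normalizedDistSq u ≤ 0 := by
      by_contra! hpos
      set c := (N + 2) * D + gap N / 2 * normalizedDistSq u with hc
      have h := key ((B + 1) / c) (by positivity)
      rw [← hA0, mul_zero, zero_add, div_div_eq_mul_div] at h
      have h1 : B * c / (B + 1) < c := by
        rw [div_lt_iff₀ (by positivity)]
        nlinarith
      linarith
    have h1 : 0 ≤ √A * √B := by positivity
    nlinarith
  rcases hB.eq_or_lt with hB0 | hB0
  · have hD0 : (N + 2) * D + gap N / 2 * normalizedDistSq u ≤ 0 := by
      by_contra! hpos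
      set c := (N + 2) * D + gap N / 2 * normalizedDistSq u with hc
      have h := key (c / (A + 1)) (by positivity)
      rw [← hB0, zero_div, add_zero] at h
      have h1 : c / (A + 1) * A < c := by
        rw [div_mul_eq_mul_div, div_lt_iff₀ (by positivity)]
        nlinarith
      linarith
    have h1 : 0 ≤ √A * √B := by positivity
    nlinarith
  · have hsA := Real.sqrt_pos.2 hA0
    have hsB := Real.sqrt_pos.2 hB0
    -- The minimizer of tA + B/t, at which both terms equal √A √B.
    have h := key (√B / √A) (by positivity)
    have e1 : √B / √A * A = √A * √B := by
      nth_rewrite 2 [← Real.mul_self_sqrt hA]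
      field_simp
    have e2 : B / (√B / √A) = √A * √B := by
      nth_rewrite 1 [← Real.mul_self_sqrt hB]
      field_simp
    rw [e1, e2] at h
    linarith

/-- This is where C(N) ≤ gap N, and hence the explicit minimizing sequence, enters. -/
theorem MemX.stabilityConst_mul_normalizedDistSq_le {N : ℕ} (hN : 1 ≤ N)
    {u : EuclideanSpace ℝ (Fin N) → ℝ} (hu : MemX u) :
    stabilityConst N / 4 * normalizedDistSq u ≤ deficit u := by
  refine le_trans ?_ (hu.gap_mul_normalizedDistSq_le hN)
  have h1 := stabilityConst_le_gap hN
  exact mul_le_mul_of_nonneg_right (by linarith) (normalizedDistSq_nonneg u)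

theorem stabilityConst_div_four_le_sharpConst {N : ℕ} (hN : 1 ≤ N) :
    ((stabilityConst N / 4 : ℝ) : EReal) ≤ sharpConst N :=
  le_iSup₂ (f := fun (c : ℝ) (_ : c ∈ {c : ℝ | ∀ u : EuclideanSpace ℝ (Fin N) → ℝ, MemX u →
    c * normalizedDistSq u ≤ deficit u}) => (c : EReal)) (stabilityConst N / 4)
    fun _ hu => hu.stabilityConst_mul_normalizedDistSq_le hN

end SecondOrderHUP

end

theorem mainTheorem4 :
    (∀ N : ℕ, 1 ≤ N → ∀ u : EuclideanSpace ℝ (Fin N) → ℝ, SecondOrderHUP.MemX u →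
      SecondOrderHUP.stabilityConst N / 4 * SecondOrderHUP.normalizedDistSq u
        ≤ SecondOrderHUP.deficit u) ∧
    (∀ N : ℕ, 2 ≤ N → 1 / 768 < SecondOrderHUP.stabilityConst N / 4) ∧
    ((1 / 2 : ℝ) : EReal) ≤
      liminf (fun N : ℕ => ((SecondOrderHUP.stabilityConst N / 4 : ℝ) : EReal)) atTop ∧
    ((1 / 2 : ℝ) : EReal) ≤ liminf (fun N : ℕ => SecondOrderHUP.sharpConst N) atTop := by
  refine ⟨fun N hN u hu => hu.stabilityConst_mul_normalizedDistSq_le hN,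
    fun N hN => SecondOrderHUP.lt_stabilityConst_div_four hN,
    SecondOrderHUP.half_le_liminf_stabilityConst,
    SecondOrderHUP.half_le_liminf_stabilityConst.trans ?_⟩
  refine liminf_le_liminf ?_
  filter_upwards [eventually_ge_atTop 1] with N hN
  exact SecondOrderHUP.stabilityConst_div_four_le_sharpConst hN
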